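/- Let $0<\kappa<1$, $0<\gamma<1$, $0<g<1$, and let $f\in L^\infty(\mathbb{R}^3)$ be real-valued with $\|f\|_{L^\infty}\le 1$. For $n\in\mathbb{N}_0$ put $\rho_n:=\kappa\gamma^n$ and $B_n:=\{k\in\mathbb{R}^3:|k|<\rho_n\}$. Let $\omega(k):=|k|$, $$G(k):=g\,\frac{\mathbf 1_{\{|k|<\kappa\}}}{4\pi\sqrt{\omega(k)}}\,f(k)\,\sigma_1,\qquad \sigma_1=\begin{pmatrix}0&1\\1&0\end{pmatrix},\qquad \omega_n:=\mathbf 1_{\mathbb{R}^3\setminus B_n}\,\omega,\quad G_n:=\mathbf 1_{\mathbb{R}^3\setminus B_n}\,G .$$ On $\mathcal H_n:=\mathbb{C}^2\otimes\mathcal F[L^2(\mathbb{R}^3\setminus B_n)]$, where $\mathcal F[\mathfrak h]$ is the bosonic Fock space over $\mathfrak h$, consider the infrared-regularized spin-boson Hamiltonian $$H_n:=H_{\rm at}+\Phi(G_n)+H_{\rm ph}(\omega_n),\qquad H_{\rm at}=\begin{pmatrix}2&0\\0&0\end{pmatrix},$$ $$\Phi(G_n)=\int\big[G_n(k)\otimes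 a^*(k)+G_n(k)^*\otimes a(k)\big]\,dk,\qquad H_{\rm ph}(\omega_n)=\int\omega_n(k)\,a^*(k)a(k)\,dk,$$ where $a^*(k),a(k)$ are the usual creation and annihilation operators and the sum is defined on the intersection of the domains of its terms. Then for every $n\in\mathbb{N}_0$ the operator $H_n$ is self-adjoint and bounded below, so that $E_n:=\inf\sigma(H_n)$ is a well-defined real number, and $$|E_{n+1}-E_n|\le g\,\rho_n\qquad\text{for every } n\in\mathbb{N}_0 .$$ -/

import Mathlib

open MeasureTheory
open scoped ENNReal LinearPMap

noncomputable section

namespace SpinBoson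

/-! ### Spectrum of a densely defined (unbounded) operator -/

section Spectrum

variable {E : Type*} [NormedAddCommGroup E] [NormedSpace ℂ E]

/-- The resolvent set of an unbounded operator `T`: those `z` for which `T - z`, as a map from the
domain of `T` to `E`, has a bounded everywhere defined two-sided inverse. -/
def resolventSet (T : E →ₗ.[ℂ] E) : Set ℂ :=
  {z | ∃ R : E →L[ℂ] E,
    (∀ y : E, ∃ h : R y ∈ T.domain, T ⟨R y, h⟩ - z • R y = y) ∧
    ∀ x : T.domain, R (T x - z • (x : E)) = x}

/-- The spectrum of an unbounded operator. -/
def spectrum (T : E →ₗ.[ℂ] E) : Set ℂ := (resolventSet T)ᶜ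

/-- `inf σ(T)`. -/
def infSpectrum (T : E →ₗ.[ℂ] E) : ℝ := sInf (Complex.re '' spectrum T)

end Spectrum

/-! ### The Hilbert space of a two-level atom coupled to a boson field -/

/-- Momentum space `ℝ³`. -/
abbrev Momentum : Type := EuclideanSpace ℝ (Fin 3)

/-- The Hilbert space `ℂ²` of the atom. -/
abbrev Atom : Type := EuclideanSpace ℂ (Fin 2)

/-- `μ ⊗ ⋯ ⊗ μ` on `ℓ`-tuples of momenta. -/
abbrev tupleMeasure (μ : Measure Momentum) (ℓ : ℕ) : Measure (Fin ℓ → Momentum) :=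
  Measure.pi fun _ => μ

section Fock

variable (μ : Measure Momentum) [SigmaFinite μ]

theorem measurePreserving_perm {ℓ : ℕ} (s : Equiv.Perm (Fin ℓ)) :
    MeasurePreserving (fun k : Fin ℓ → Momentum => k ∘ s) (tupleMeasure μ ℓ)
      (tupleMeasure μ ℓ) := by
  have h := measurePreserving_piCongrLeft (fun _ : Fin ℓ => μ) s.symm
  convert h using 1
  ext k i
  simp [MeasurableEquiv.piCongrLeft, Equiv.piCongrLeft, Equiv.piCongrLeft']

theorem quasiMeasurePreserving_erase {ℓ : ℕ} (i : Fin (ℓ + 1)) :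
    Measure.QuasiMeasurePreserving (fun k : Fin (ℓ + 1) → Momentum => k ∘ i.succAbove)
      (tupleMeasure μ (ℓ + 1)) (tupleMeasure μ ℓ) :=
  Measure.quasiMeasurePreserving_snd.comp
    (measurePreserving_piFinSuccAbove (fun _ : Fin (ℓ + 1) => μ) i).quasiMeasurePreserving

/-- The `ℓ`-photon space `ℂ² ⊗ S_ℓ(L²(μ) ⊗ ⋯ ⊗ L²(μ))`, realized as the space of square-integrable
`ℂ²`-valued functions of `ℓ` momenta which are invariant under all permutations of the momenta. -/
def Sector (ℓ : ℕ) : Submodule ℂ (Lp Atom 2 (tupleMeasure μ ℓ)) :=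
  ⨅ s : Equiv.Perm (Fin ℓ),
    LinearMap.eqLocus
      (Lp.compMeasurePreservingₗᵢ ℂ (fun k : Fin ℓ → Momentum => k ∘ s)
        (measurePreserving_perm μ s)).toLinearMap
      LinearMap.id

variable {μ} in
theorem mem_Sector {ℓ : ℕ} (u : Lp Atom 2 (tupleMeasure μ ℓ)) :
    u ∈ Sector μ ℓ ↔
      ∀ s : Equiv.Perm (Fin ℓ), (fun k => u (k ∘ s)) =ᵐ[tupleMeasure μ ℓ] u := by
  simp only [Sector, Submodule.mem_iInf, LinearMap.mem_eqLocus]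
  refine forall_congr' fun s => ?_
  have h := Lp.coeFn_compMeasurePreserving u (measurePreserving_perm μ s)
  constructor
  · intro hu
    have hu' : Lp.compMeasurePreserving _ (measurePreserving_perm μ s) u = u := hu
    rw [hu'] at h
    exact h.symm
  · intro hu
    exact Lp.ext (h.trans hu)

theorem isClosed_Sector (ℓ : ℕ) :
    IsClosed (Sector μ ℓ : Set (Lp Atom 2 (tupleMeasure μ ℓ))) := by
  simp only [Sector, Submodule.coe_iInf]
  refine isClosed_iInter fun s => ?_
  exact isClosed_eq (LinearIsometry.continuous _) continuous_id

instance instCompleteSpaceSector (ℓ : ℕ) : CompleteSpace (Sector μ ℓ) :=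
  (isClosed_Sector μ ℓ).completeSpace_coe

/-- The Hilbert space `ℂ² ⊗ 𝓕[L²(μ)]` of the atom and the photons: the Hilbert direct sum over
`ℓ = 0, 1, 2, …` of the `ℓ`-photon spaces. -/
abbrev Fock : Type := lp (fun ℓ : ℕ => Sector μ ℓ) 2

variable {μ}

/-- The `ℓ`-photon component of a vector, as a function of `ℓ` momenta. -/
def comp (ψ : Fock μ) (ℓ : ℕ) : (Fin ℓ → Momentum) → Atom :=
  ((ψ ℓ : Sector μ ℓ) : Lp Atom 2 (tupleMeasure μ ℓ))

theorem comp_add (ψ φ : Fock μ) (ℓ : ℕ) :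
    comp (ψ + φ) ℓ =ᵐ[tupleMeasure μ ℓ] fun k => comp ψ ℓ k + comp φ ℓ k :=
  Lp.coeFn_add _ _

theorem comp_smul (c : ℂ) (ψ : Fock μ) (ℓ : ℕ) :
    comp (c • ψ) ℓ =ᵐ[tupleMeasure μ ℓ] fun k => c • comp ψ ℓ k :=
  Lp.coeFn_smul _ _

theorem comp_ext {ψ φ : Fock μ} (h : ∀ ℓ, comp ψ ℓ =ᵐ[tupleMeasure μ ℓ] comp φ ℓ) : ψ = φ :=
  lp.ext (funext fun ℓ => Subtype.ext (Lp.ext (h ℓ)))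

/-- The vectors `ψ` for which the prescribed components `T ψ ℓ` are the components of a vector in
Fock space. -/
def maximalDomain (T : Fock μ → ∀ ℓ : ℕ, (Fin ℓ → Momentum) → Atom)
    (hadd : ∀ ψ φ ℓ, T (ψ + φ) ℓ =ᵐ[tupleMeasure μ ℓ] fun k => T ψ ℓ k + T φ ℓ k)
    (hsmul : ∀ (c : ℂ) ψ ℓ, T (c • ψ) ℓ =ᵐ[tupleMeasure μ ℓ] fun k => c • T ψ ℓ k) :
    Submodule ℂ (Fock μ) where
  carrier := {ψ | ∃ η : Fock μ, ∀ ℓ, comp η ℓ =ᵐ[tupleMeasure μ ℓ] T ψ ℓ}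
  add_mem' := by
    rintro ψ φ ⟨η, hη⟩ ⟨ξ, hξ⟩
    refine ⟨η + ξ, fun ℓ => ?_⟩
    filter_upwards [comp_add η ξ ℓ, hη ℓ, hξ ℓ, hadd ψ φ ℓ] with k h1 h2 h3 h4
    rw [h1, h2, h3, h4]
  zero_mem' := by
    have h0 : (0 : ℂ) • (0 : Fock μ) = 0 := smul_zero (0 : ℂ)
    refine ⟨(0 : ℂ) • (0 : Fock μ), fun ℓ => ?_⟩
    have h2 := hsmul 0 0 ℓ
    rw [h0] at h2
    filter_upwards [comp_smul (0 : ℂ) (0 : Fock μ) ℓ, h2] with k h1 h2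
    rw [h1, h2, zero_smul, zero_smul]
  smul_mem' := by
    rintro c ψ ⟨η, hη⟩
    refine ⟨c • η, fun ℓ => ?_⟩
    filter_upwards [comp_smul c η ℓ, hη ℓ, hsmul c ψ ℓ] with k h1 h2 h3
    rw [h1, h2, h3]

/-- The operator, on its maximal domain, given by a linear prescription `T` for the components of
the image vector. -/
def maximalOp (T : Fock μ → ∀ ℓ : ℕ, (Fin ℓ → Momentum) → Atom)
    (hadd : ∀ ψ φ ℓ, T (ψ + φ) ℓ =ᵐ[tupleMeasure μ ℓ] fun k => T ψ ℓ k + T φ ℓ k)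
    (hsmul : ∀ (c : ℂ) ψ ℓ, T (c • ψ) ℓ =ᵐ[tupleMeasure μ ℓ] fun k => c • T ψ ℓ k) :
    Fock μ →ₗ.[ℂ] Fock μ where
  domain := maximalDomain T hadd hsmul
  toFun :=
    { toFun := fun ψ => Classical.choose ψ.2
      map_add' := by
        intro ψ φ
        have h1 := Classical.choose_spec (ψ + φ).2
        have h2 := Classical.choose_spec ψ.2
        have h3 := Classical.choose_spec φ.2
        refine comp_ext fun ℓ => ?_
        refine (h1 ℓ).trans ((hadd ψ φ ℓ).trans (Filter.EventuallyEq.trans ?_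
          (comp_add _ _ ℓ).symm))
        filter_upwards [h2 ℓ, h3 ℓ] with k h2 h3
        rw [h2, h3]
      map_smul' := by
        intro c ψ
        have h1 := Classical.choose_spec (c • ψ).2
        have h2 := Classical.choose_spec ψ.2
        refine comp_ext fun ℓ => ?_
        refine (h1 ℓ).trans ((hsmul c ψ ℓ).trans (Filter.EventuallyEq.trans ?_
          (comp_smul c _ ℓ).symm))
        filter_upwards [h2 ℓ] with k h2
        rw [h2] }

theorem comp_maximalOp {T : Fock μ → ∀ ℓ : ℕ, (Fin ℓ → Momentum) → Atom}
    {hadd : ∀ ψ φ ℓ, T (ψ + φ) ℓ =ᵐ[tupleMeasure μ ℓ] fun k => T ψ ℓ k + T φ ℓ k}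
    {hsmul : ∀ (c : ℂ) ψ ℓ, T (c • ψ) ℓ =ᵐ[tupleMeasure μ ℓ] fun k => c • T ψ ℓ k}
    (ψ : (maximalOp T hadd hsmul).domain) (ℓ : ℕ) :
    comp (maximalOp T hadd hsmul ψ) ℓ =ᵐ[tupleMeasure μ ℓ] T ψ ℓ :=
  Classical.choose_spec ψ.2 ℓ

/-- The operator `M ⊗ 1` for a `2 × 2` matrix `M` acting on the atom. -/
def atomOp (μ : Measure Momentum) [SigmaFinite μ] (M : Matrix (Fin 2) (Fin 2) ℂ) :
    Fock μ →ₗ.[ℂ] Fock μ :=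
  maximalOp (fun ψ ℓ k => Matrix.toEuclideanCLM (𝕜 := ℂ) M (comp ψ ℓ k))
    (fun ψ φ ℓ => by
      filter_upwards [comp_add ψ φ ℓ] with k h
      rw [h, map_add])
    (fun c ψ ℓ => by
      filter_upwards [comp_smul c ψ ℓ] with k h
      rw [h, map_smul])

/-- The second quantization `H_ph(w) = dΓ(w) = ∫ w(k) a*(k) a(k) dk` of multiplication by `w`:
on `ℓ`-photon functions it is multiplication by `w(k₁) + ⋯ + w(k_ℓ)`. -/
def photonEnergy (μ : Measure Momentum) [SigmaFinite μ] (w : Momentum → ℝ) :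
    Fock μ →ₗ.[ℂ] Fock μ :=
  maximalOp (fun ψ ℓ k => ((∑ i, w (k i) : ℝ) : ℂ) • comp ψ ℓ k)
    (fun ψ φ ℓ => by
      filter_upwards [comp_add ψ φ ℓ] with k h
      rw [h, smul_add])
    (fun c ψ ℓ => by
      filter_upwards [comp_smul c ψ ℓ] with k h
      rw [h, smul_comm])

/-- The components of `∫ G(k) ⊗ a*(k) dk ψ`: there is no zero-photon component, and the
`(ℓ + 1)`-photon component at `(k₀, …, k_ℓ)` is
`(ℓ + 1)^{-1/2} ∑ i, G(k_i) ψ_ℓ(k₀, …, k_{i-1}, k_{i+1}, …, k_ℓ)`. -/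
def creationComp (G : Momentum → Matrix (Fin 2) (Fin 2) ℂ) (ψ : Fock μ) :
    ∀ ℓ : ℕ, (Fin ℓ → Momentum) → Atom
  | 0 => fun _ => 0
  | ℓ + 1 => fun k =>
      (((Real.sqrt (ℓ + 1))⁻¹ : ℝ) : ℂ) •
        ∑ i : Fin (ℓ + 1), Matrix.toEuclideanCLM (𝕜 := ℂ) (G (k i)) (comp ψ ℓ (k ∘ i.succAbove))

/-- The creation operator `a*(G) = ∫ G(k) ⊗ a*(k) dk` with matrix-valued coupling function `G`. -/
def creation (μ : Measure Momentum) [SigmaFinite μ] (G : Momentum → Matrix (Fin 2) (Fin 2) ℂ) :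
    Fock μ →ₗ.[ℂ] Fock μ :=
  maximalOp (creationComp G)
    (by
      rintro ψ φ (_ | ℓ)
      · exact Filter.Eventually.of_forall fun k => (add_zero _).symm
      · have h : ∀ᵐ k ∂tupleMeasure μ (ℓ + 1), ∀ i : Fin (ℓ + 1),
            comp (ψ + φ) ℓ (k ∘ i.succAbove) =
              comp ψ ℓ (k ∘ i.succAbove) + comp φ ℓ (k ∘ i.succAbove) :=
          ae_all_iff.2 fun i => (quasiMeasurePreserving_erase μ i).ae (comp_add ψ φ ℓ)
        filter_upwards [h] with k h
        simp only [creationComp, h, map_add, Finset.sum_add_distrib, smul_add])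
    (by
      rintro c ψ (_ | ℓ)
      · exact Filter.Eventually.of_forall fun k => (smul_zero _).symm
      · have h : ∀ᵐ k ∂tupleMeasure μ (ℓ + 1), ∀ i : Fin (ℓ + 1),
            comp (c • ψ) ℓ (k ∘ i.succAbove) = c • comp ψ ℓ (k ∘ i.succAbove) :=
          ae_all_iff.2 fun i => (quasiMeasurePreserving_erase μ i).ae (comp_smul c ψ ℓ)
        filter_upwards [h] with k h
        simp only [creationComp, h, map_smul, ← Finset.smul_sum]
        rw [smul_comm])

/-- The annihilation operator `∫ G(k)* ⊗ a(k) dk`, the adjoint of `∫ G(k) ⊗ a*(k) dk`. -/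
def annihilation (μ : Measure Momentum) [SigmaFinite μ]
    (G : Momentum → Matrix (Fin 2) (Fin 2) ℂ) : Fock μ →ₗ.[ℂ] Fock μ :=
  (creation μ G)†

/-- The field operator `Φ(G) = ∫ (G(k) ⊗ a*(k) + G(k)* ⊗ a(k)) dk`. -/
def field (μ : Measure Momentum) [SigmaFinite μ] (G : Momentum → Matrix (Fin 2) (Fin 2) ℂ) :
    Fock μ →ₗ.[ℂ] Fock μ :=
  creation μ G + annihilation μ G

end Fock

/-! ### The infrared-regularized spin-boson Hamiltonians -/

/-- The Hamiltonian of the isolated atom. -/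
def atomMatrix : Matrix (Fin 2) (Fin 2) ℂ := !![2, 0; 0, 0]

/-- The first Pauli matrix. -/
def pauliX : Matrix (Fin 2) (Fin 2) ℂ := !![0, 1; 1, 0]

/-- The photon dispersion relation `ω(k) = |k|`. -/
def dispersion (k : Momentum) : ℝ := ‖k‖

/-- The coupling function `G(k) = g Λ(k) f(k) / (4 π √ω(k)) σ₁`, where `Λ` is the indicator of
`{|k| < κ}`. -/
def coupling (g κ : ℝ) (f : Momentum → ℝ) (k : Momentum) : Matrix (Fin 2) (Fin 2) ℂ :=
  ((g * (Set.indicator {p : Momentum | ‖p‖ < κ} (fun _ => (1 : ℝ)) k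
    / (4 * Real.pi * Real.sqrt (dispersion k))) * f k : ℝ) : ℂ) • pauliX

/-- The infrared cutoff energies `ρ_n = κ γ ^ n`. -/
def cutoff (κ γ : ℝ) (n : ℕ) : ℝ := κ * γ ^ n

/-- The complement of the ball `B_n = {|k| < ρ_n}`. -/
def outside (κ γ : ℝ) (n : ℕ) : Set Momentum := {k : Momentum | ‖k‖ < cutoff κ γ n}ᶜ

/-- Lebesgue measure on `ℝ³ \ B_n`. -/
abbrev outsideMeasure (κ γ : ℝ) (n : ℕ) : Measure Momentum :=
  (volume : Measure Momentum).restrict (outside κ γ n)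

/-- The Hamiltonian `H_n = H_at + Φ(G_n) + H_ph(ω_n)` on `𝓗_n = ℂ² ⊗ 𝓕[L²(ℝ³ \ B_n)]`, where
`G_n` and `ω_n` are the restrictions of `G` and `ω` to `ℝ³ \ B_n`. Sums of unbounded operators
are defined on the intersection of the domains. -/
def hamiltonian (g κ γ : ℝ) (f : Momentum → ℝ) (n : ℕ) :
    Fock (outsideMeasure κ γ n) →ₗ.[ℂ] Fock (outsideMeasure κ γ n) :=
  atomOp (outsideMeasure κ γ n) atomMatrix
    + field (outsideMeasure κ γ n) ((outside κ γ n).indicator (coupling g κ f))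
    + photonEnergy (outsideMeasure κ γ n) ((outside κ γ n).indicator dispersion)

/-- `E_n = inf σ(H_n)`. -/
def groundEnergy (g κ γ : ℝ) (f : Momentum → ℝ) (n : ℕ) : ℝ :=
  infSpectrum (hamiltonian g κ γ f n)

end SpinBoson

end

noncomputable section

namespace SpinBoson

/-! ### Self-adjointness and the bottom of the spectrum of a semibounded operator -/

section Abstract

variable {E : Type*} [NormedAddCommGroup E] [InnerProductSpace ℂ E]

/-! The ground energies are compared through quadratic forms, so that operators on different Fock
spaces never meet.

Self-adjointness is Kato-Rellich with the photon energy as the free operator. The infrared cutoff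
gives every photon energy at least ρ_n, so the photon number N is controlled by the photon energy,
and the field, which is of size N^{1/2}, has relative bound below one whatever the coupling
(`exists_number_bound`, `isSelfAdjoint_spinBoson`). For a self-adjoint semibounded operator the
infimum of the spectrum is the largest lower bound of the form (`infSpectrum_spec`), and it suffices
to test the form on states with finitely many photons (`isGreatest_infSpectrum_spinBoson`). Thus E_n
is the largest e satisfying `IsFormBound`, a condition on explicit integrals of symmetric functions.

Upper bound: extending functions by zero to momenta in the shell ρ_{n+1} ≤ |k| < ρ_n, that is,
putting the shell modes in the vacuum, turns test states for H_n into test states for H_{n+1} with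
the same form (`partialForm_cut`). Hence E_{n+1} ≤ E_n.

Lower bound: first adjoin the shell photons without energy or interaction. This does not lower the
form bound (`IsFormBound.of_restrict`). In place of a tensor factorization of Fock space, the part
of a state containing shell photons is weighted by their number; by symmetry its form becomes an
integral, over the momentum p of one shell photon, of the form at the state with that photon
removed, and induction on the photon number applies. Then switch on the shell energy and
interaction. Completing the square costs at most the integral of |G|²/ω over the shell
(`IsFormBound.add`). With |f| ≤ 1 this is at most g²/(16π²) times the integral of |k|⁻² over the
ball of radius ρ_n, namely g²ρ_n/(4π), which is below gρ_n. -/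

theorem inner_self_re_eq (x : E) : (inner ℂ x x).re = ‖x‖ ^ 2 := by
  have := inner_self_eq_norm_sq (𝕜 := ℂ) x
  simpa using this

variable [CompleteSpace E]

/-- A symmetric operator `T` for which `T + l` is onto for some real `l` is self-adjoint. -/
theorem isSelfAdjoint_of_surjective {T : E →ₗ.[ℂ] E} (hd : Dense (T.domain : Set E))
    (hs : T.IsFormalAdjoint T) (l : ℝ)
    (hl : ∀ y : E, ∃ x : T.domain, T x + (l : ℂ) • (x : E) = y) : IsSelfAdjoint T := by
  rw [LinearPMap.isSelfAdjoint_def]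
  symm
  have hle : T ≤ T† := LinearPMap.IsFormalAdjoint.le_adjoint hd hs
  refine LinearPMap.eq_of_le_of_domain_eq hle (le_antisymm hle.1 fun y hy => ?_)
  obtain ⟨x, hx⟩ := hl (T† ⟨y, hy⟩ + (l : ℂ) • y)
  -- Since (T† + l) y = (T + l) x, the difference y - x is orthogonal to the range of T + l, which
  -- is everything.
  have key : ∀ z : T.domain, inner ℂ (y - x) (T z + (l : ℂ) • (z : E)) = 0 := by
    intro z
    have h1 : inner ℂ (T† ⟨y, hy⟩) (z : E) = inner ℂ y (T z) :=
      LinearPMap.adjoint_isFormalAdjoint hd ⟨y, hy⟩ z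
    have h2 := hs x z
    have h3 : inner ℂ (T x + (l : ℂ) • (x : E)) (z : E) =
      inner ℂ (T† ⟨y, hy⟩ + (l : ℂ) • y) (z : E) := by rw [hx]
    simp only [inner_add_left, inner_smul_left, Complex.conj_ofReal] at h3
    simp only [inner_sub_left, inner_add_right, inner_smul_right]
    rw [← h1, ← h2]
    linear_combination -h3
  obtain ⟨z, hz⟩ := hl (y - x)
  have := key z
  rw [hz, inner_self_eq_zero, sub_eq_zero] at this
  rw [this]
  exact x.2

/-- A nonnegative operator `A` with `A + 1` onto has dense domain. -/
theorem dense_domain_of_surjective {A : E →ₗ.[ℂ] E}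
    (hpos : ∀ x : A.domain, 0 ≤ (inner ℂ (x : E) (A x)).re)
    (h1 : ∀ y : E, ∃ x : A.domain, A x + (x : E) = y) : Dense (A.domain : Set E) := by
  rw [Submodule.dense_iff_topologicalClosure_eq_top, Submodule.topologicalClosure_eq_top_iff,
    Submodule.eq_bot_iff]
  intro y hy
  -- Pairing A x + x, which is orthogonal to the domain, with x itself gives ⟨x, A x⟩ + ‖x‖² = 0, so
  -- x = 0.
  obtain ⟨x, rfl⟩ := h1 y
  have h := (Submodule.mem_orthogonal _ _).1 hy x x.2
  have h2 := congrArg Complex.re h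
  rw [inner_add_right, Complex.add_re, inner_self_re_eq] at h2
  have h3 := hpos x
  have h4 : ‖(x : E)‖ ^ 2 = 0 := le_antisymm (by simp at h2; linarith) (sq_nonneg _)
  have h5 : (x : E) = 0 := by simpa using h4
  have h6 : x = 0 := Subtype.ext h5
  simp [h6]

/-- The Kato-Rellich theorem for perturbations of nonnegative operators. -/
theorem isSelfAdjoint_of_relatively_bounded {A T : E →ₗ.[ℂ] E} (hdom : T.domain = A.domain)
    (hA : ∀ x : A.domain, 0 ≤ (inner ℂ (x : E) (A x)).re)
    (hsurj : ∀ l : ℝ, 0 < l → ∀ y : E, ∃ x : A.domain, A x + (l : ℂ) • (x : E) = y)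
    (hT : T.IsFormalAdjoint T) (a b : ℝ) (ha : 0 ≤ a) (ha1 : a < 1) (hb : 0 ≤ b)
    (hab : ∀ (x : E) (hx : x ∈ A.domain) (hx' : x ∈ T.domain),
      ‖T ⟨x, hx'⟩ - A ⟨x, hx⟩‖ ≤ a * ‖A ⟨x, hx⟩‖ + b * ‖x‖) : IsSelfAdjoint T := by
  have hd : Dense (T.domain : Set E) := by
    rw [hdom]
    exact dense_domain_of_surjective hA fun y => by simpa using hsurj 1 one_pos y
  obtain ⟨l, hl, hbl⟩ : ∃ l : ℝ, 0 < l ∧ a + b / l < 1 := by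
    -- For this l, b / l = (1 - a) * (b / (b + 1)) < 1 - a.
    refine ⟨(b + 1) / (1 - a), by apply div_pos <;> linarith, ?_⟩
    have h1 : 0 < 1 - a := by linarith
    have h2 : b / ((b + 1) / (1 - a)) = (1 - a) * (b / (b + 1)) := by
      field_simp
    have h3 : b / (b + 1) < 1 := by rw [div_lt_one (by linarith)]; linarith
    rw [h2]
    nlinarith
  refine isSelfAdjoint_of_surjective hd hT l ?_
  -- The cross term 2 l Re ⟨x, A x⟩ in the expanded square is nonnegative.
  have hnorm : ∀ x : A.domain, ‖A x‖ ^ 2 + l ^ 2 * ‖(x : E)‖ ^ 2 ≤ ‖A x + (l : ℂ) • (x : E)‖ ^ 2 := by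
    intro x
    rw [← inner_self_re_eq (A x + (l : ℂ) • (x : E))]
    have e : inner ℂ (A x + (l : ℂ) • (x : E)) (A x + (l : ℂ) • (x : E)) =
        inner ℂ (A x) (A x) + l * inner ℂ (A x) (x : E) + l * inner ℂ (x : E) (A x)
          + l * (l * inner ℂ (x : E) (x : E)) := by
      simp only [inner_add_left, inner_add_right, inner_smul_left, inner_smul_right,
        Complex.conj_ofReal]
      ring
    have e2 : (inner ℂ (A x) (x : E)).re = (inner ℂ (x : E) (A x)).re := by
      rw [← inner_conj_symm, Complex.conj_re]
    rw [e]
    simp only [Complex.add_re, Complex.re_ofReal_mul, inner_self_re_eq, e2]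
    nlinarith [mul_nonneg hl.le (hA x)]
  choose R hR using hsurj l hl
  have hle : A.domain ≤ T.domain := hdom.ge
  have huniq : ∀ x x' : A.domain, A x + (l : ℂ) • (x : E) = A x' + (l : ℂ) • (x' : E) → x = x' := by
    intro x x' h
    have h1 := hnorm (x - x')
    have h2 : A (x - x') + (l : ℂ) • ((x - x' : A.domain) : E) = 0 := by
      rw [A.map_sub, Submodule.coe_sub, smul_sub]
      rw [← sub_eq_zero] at h
      rw [← h]; abel
    rw [h2, norm_zero] at h1
    have h3 : ‖((x - x' : A.domain) : E)‖ ^ 2 ≤ 0 := by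
      have := sq_nonneg ‖A (x - x')‖
      have hl2 : 0 < l ^ 2 := by positivity
      by_contra hcon
      push Not at hcon
      nlinarith [mul_pos hl2 hcon]
    have h4 : ((x - x' : A.domain) : E) = 0 := by
      have := le_antisymm h3 (sq_nonneg _)
      simpa using this
    exact sub_eq_zero.1 (Subtype.ext h4)
  -- B = (T - A)(A + l)⁻¹, of norm at most a + b / l < 1.
  let B : E →ₗ[ℂ] E :=
    { toFun := fun y => T ⟨R y, hle (R y).2⟩ - A (R y)
      map_add' := by
        intro y z
        have h : R (y + z) = R y + R z := huniq _ _ (by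
          rw [hR, A.map_add, Submodule.coe_add, smul_add]
          nth_rewrite 1 [← hR y, ← hR z]
          abel)
        have h' : (⟨R (y + z), hle (R (y + z)).2⟩ : T.domain) =
            ⟨R y, hle (R y).2⟩ + ⟨R z, hle (R z).2⟩ :=
          Subtype.ext (by simp [h])
        rw [h', h, T.map_add, A.map_add]; abel
      map_smul' := by
        intro c y
        have h : R (c • y) = c • R y := huniq _ _ (by
          rw [hR, A.map_smul, Submodule.coe_smul, smul_comm, ← smul_add, hR])
        have h' : (⟨R (c • y), hle (R (c • y)).2⟩ : T.domain) = c • ⟨R y, hle (R y).2⟩ :=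
          Subtype.ext (by simp [h])
        rw [h', h, T.map_smul, A.map_smul, RingHom.id_apply, smul_sub] }
  have hB : ∀ y, ‖B y‖ ≤ (a + b / l) * ‖y‖ := by
    intro y
    have h1 := hab (R y) (R y).2 (hle (R y).2)
    have h2 := hnorm (R y)
    rw [hR] at h2
    have h3 : ‖A (R y)‖ ≤ ‖y‖ := by
      refine (sq_le_sq₀ (norm_nonneg _) (norm_nonneg _)).1 ?_
      nlinarith [sq_nonneg (l * ‖(R y : E)‖)]
    have h4 : l * ‖(R y : E)‖ ≤ ‖y‖ := by
      refine (sq_le_sq₀ (by positivity) (norm_nonneg _)).1 ?_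
      nlinarith [sq_nonneg ‖A (R y)‖]
    have h5 : ‖(R y : E)‖ ≤ ‖y‖ / l := by rw [le_div_iff₀ hl]; linarith
    calc ‖B y‖ ≤ a * ‖A (R y)‖ + b * ‖(R y : E)‖ := h1
      _ ≤ a * ‖y‖ + b * (‖y‖ / l) := by gcongr
      _ = (a + b / l) * ‖y‖ := by ring
  let Bc : E →L[ℂ] E := B.mkContinuous _ hB
  have hBn : ‖-Bc‖ < 1 := by
    rw [norm_neg]
    exact (LinearMap.mkContinuous_norm_le _ (by positivity) _).trans_lt hbl
  -- T + l = (1 + B)(A + l), and 1 + B is invertible by a Neumann series.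
  obtain ⟨U, hU⟩ := isUnit_one_sub_of_norm_lt_one hBn
  intro y
  have hy : (U : E →L[ℂ] E) ((↑U⁻¹ : E →L[ℂ] E) y) = y := by
    exact congrArg (fun S : E →L[ℂ] E => S y) U.mul_inv
  set z := (↑U⁻¹ : E →L[ℂ] E) y
  rw [hU] at hy
  refine ⟨⟨R z, hle (R z).2⟩, ?_⟩
  have hz : z + (T ⟨R z, hle (R z).2⟩ - A (R z)) = y := by
    rw [← hy]
    simp [Bc, B]
  calc T ⟨R z, hle (R z).2⟩ + (l : ℂ) • (R z : E)
      = (A (R z) + (l : ℂ) • (R z : E)) + (T ⟨R z, hle (R z).2⟩ - A (R z)) := by abel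
    _ = y := by rw [hR z, hz]

/-- Points with real part below a lower bound of the quadratic form are in the resolvent set. -/
theorem mem_resolventSet_of_re_lt {T : E →ₗ.[ℂ] E} (hT : IsSelfAdjoint T) {e : ℝ}
    (he : ∀ x : T.domain, e * ‖(x : E)‖ ^ 2 ≤ (inner ℂ (x : E) (T x)).re) {z : ℂ} (hz : z.re < e) :
    z ∈ resolventSet T := by
  have hd := hT.dense_domain
  have hpos : 0 < e - z.re := by linarith
  have hlow : ∀ x : T.domain, (e - z.re) * ‖(x : E)‖ ≤ ‖T x - z • (x : E)‖ := by
    intro x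
    by_cases hx : ‖(x : E)‖ = 0
    · rw [hx]; simp
    have hx' : 0 < ‖(x : E)‖ := lt_of_le_of_ne (norm_nonneg _) (Ne.symm hx)
    have h1 : (inner ℂ (x : E) (T x - z • (x : E))).re ≤ ‖(x : E)‖ * ‖T x - z • (x : E)‖ :=
      (Complex.re_le_norm _).trans (norm_inner_le_norm _ _)
    rw [inner_sub_right, inner_smul_right, Complex.sub_re, Complex.mul_re, inner_self_re_eq] at h1
    have h2 : (inner ℂ (x : E) (x : E)).im = 0 := inner_self_im (𝕜 := ℂ) (x : E)
    rw [h2] at h1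
    have h3 := he x
    by_contra hcon
    push Not at hcon
    nlinarith [mul_lt_mul_of_pos_left hcon hx']
  have hgc : IsClosed (T.graph : Set (E × E)) := hT.isClosed
  have : CompleteSpace T.graph := hgc.completeSpace_coe
  -- T - z becomes a bounded operator on the graph, which is complete because T is closed. The lower
  -- bound `hlow` holds in the graph norm as well, so the range is closed.
  let F : T.graph →L[ℂ] E :=
    ((ContinuousLinearMap.snd ℂ E E) - z • (ContinuousLinearMap.fst ℂ E E)).comp T.graph.subtypeL
  have hFv : ∀ x : T.domain, F ⟨((x : E), T x), T.mem_graph x⟩ = T x - z • (x : E) := by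
    intro x; simp [F]
  have hF : ∀ p : T.graph, ‖p‖ ≤ ((1 + ‖z‖) / (e - z.re) + 1) * ‖F p‖ := by
    rintro ⟨⟨p1, p2⟩, hp⟩
    obtain ⟨x, rfl, rfl⟩ := (LinearPMap.mem_graph_iff (f := T)).1 hp
    rw [hFv]
    have h1 := hlow x
    have h2 : ‖(x : E)‖ ≤ ‖T x - z • (x : E)‖ / (e - z.re) := by
      rw [le_div_iff₀ hpos]; linarith
    have h3 : ‖T x‖ ≤ ‖T x - z • (x : E)‖ + ‖z‖ * ‖(x : E)‖ := by
      rw [← norm_smul]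
      simpa using norm_add_le (T x - z • (x : E)) (z • (x : E))
    set N := ‖T x - z • (x : E)‖
    have hN : 0 ≤ N := norm_nonneg _
    have h4 : ((1 + ‖z‖) / (e - z.re) + 1) * N = N / (e - z.re) + ‖z‖ * (N / (e - z.re)) + N := by
      ring
    have h5 : 0 ≤ N / (e - z.re) := by positivity
    have h6 : ‖z‖ * ‖(x : E)‖ ≤ ‖z‖ * (N / (e - z.re)) := by gcongr
    change max ‖(x : E)‖ ‖T x‖ ≤ _
    rw [h4]
    apply max_le
    · nlinarith [mul_nonneg (norm_nonneg z) h5]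
    · linarith
  have hK : 0 ≤ (1 + ‖z‖) / (e - z.re) + 1 := by positivity
  have hanti : AntilipschitzWith ⟨_, hK⟩ F := F.antilipschitz_of_bound hF
  have hclosed : IsClosed (F.range : Set E) := by
    have h : (F.range : Set E) = Set.range F := rfl
    rw [h]
    exact hanti.isClosed_range F.uniformContinuous
  -- A vector y orthogonal to the range satisfies T† y = conj(z) y. It lies in the domain of T by
  -- self-adjointness, and the form bound then gives e ‖y‖² ≤ Re z ‖y‖², so y = 0.
  have hrange : F.range = ⊤ := by
    have : CompleteSpace F.range := hclosed.completeSpace_coe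
    rw [← Submodule.orthogonal_eq_bot_iff, Submodule.eq_bot_iff]
    intro y hy
    have hy' : ∀ x : T.domain, inner ℂ (T x - z • (x : E)) y = 0 := fun x =>
      (Submodule.mem_orthogonal _ _).1 hy _ ⟨_, hFv x⟩
    have hstar : ∀ x : T.domain, inner ℂ ((starRingEnd ℂ z) • y) (x : E) = inner ℂ y (T x) := by
      intro x
      have := congrArg (starRingEnd ℂ) (hy' x)
      rw [inner_conj_symm, map_zero, inner_sub_right, inner_smul_right, sub_eq_zero] at this
      rw [inner_smul_left, Complex.conj_conj, this]
    have hyd : y ∈ T†.domain := LinearPMap.mem_adjoint_domain_of_exists y ⟨_, hstar⟩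
    have hyv : T† ⟨y, hyd⟩ = (starRingEnd ℂ z) • y := LinearPMap.adjoint_apply_eq hd _ hstar
    obtain ⟨hle, hval⟩ := (le_of_eq (LinearPMap.isSelfAdjoint_def.1 hT) : T† ≤ T)
    have hyT : T ⟨y, hle hyd⟩ = (starRingEnd ℂ z) • y :=
      (hval (x := ⟨y, hyd⟩) (y := ⟨y, hle hyd⟩) rfl).symm.trans hyv
    have h := he ⟨y, hle hyd⟩
    rw [hyT, inner_smul_right, Complex.mul_re, inner_self_re_eq] at h
    have h2 : (inner ℂ y y).im = 0 := inner_self_im (𝕜 := ℂ) y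
    simp only [h2, Complex.conj_re, mul_zero, sub_zero] at h
    have h3 : ‖y‖ ^ 2 ≤ 0 := by
      by_contra hcon
      push Not at hcon
      nlinarith [mul_pos hpos hcon]
    simpa using le_antisymm h3 (sq_nonneg _)
  have hsurj : ∀ y : E, ∃ x : T.domain, T x - z • (x : E) = y := by
    intro y
    have : y ∈ F.range := by rw [hrange]; trivial
    obtain ⟨⟨⟨p1, p2⟩, hp⟩, hpy⟩ := this
    obtain ⟨x, rfl, rfl⟩ := (LinearPMap.mem_graph_iff (f := T)).1 hp
    exact ⟨x, by rw [← hpy]; exact (hFv x).symm⟩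
  have huniq : ∀ x x' : T.domain, T x - z • (x : E) = T x' - z • (x' : E) → x = x' := by
    intro x x' h
    have h1 := hlow (x - x')
    have h2 : T (x - x') - z • ((x - x' : T.domain) : E) = 0 := by
      rw [T.map_sub, Submodule.coe_sub, smul_sub]
      rw [← sub_eq_zero] at h
      rw [← h]; abel
    rw [h2, norm_zero] at h1
    have h4 : ‖((x - x' : T.domain) : E)‖ = 0 := by
      refine le_antisymm ?_ (norm_nonneg _)
      by_contra hcon
      push Not at hcon
      nlinarith [mul_pos hpos hcon]
    exact sub_eq_zero.1 (Subtype.ext (norm_eq_zero.1 h4))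
  choose R hR using hsurj
  let Rl : E →ₗ[ℂ] E :=
    { toFun := fun y => R y
      map_add' := by
        intro y y'
        have h : R (y + y') = R y + R y' := huniq _ _ (by
          rw [hR, T.map_add, Submodule.coe_add, smul_add]
          nth_rewrite 1 [← hR y, ← hR y']
          abel)
        rw [h, Submodule.coe_add]
      map_smul' := by
        intro c y
        have h : R (c • y) = c • R y := huniq _ _ (by
          rw [hR, T.map_smul, Submodule.coe_smul, smul_comm, ← smul_sub, hR])
        rw [h, Submodule.coe_smul, RingHom.id_apply] }
  have hRl : ∀ y, ‖Rl y‖ ≤ (e - z.re)⁻¹ * ‖y‖ := by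
    intro y
    have := hlow (R y)
    rw [hR] at this
    rw [inv_mul_eq_div, le_div_iff₀ hpos, mul_comm]
    exact this
  exact ⟨Rl.mkContinuous _ hRl, fun y => ⟨(R y).2, hR y⟩, fun x =>
    congrArg Subtype.val (huniq _ x (hR _))⟩

/-- The infimum of the spectrum of a self-adjoint operator which is bounded below is the largest
lower bound of its quadratic form. -/
theorem infSpectrum_spec [Nontrivial E] {T : E →ₗ.[ℂ] E} (hT : IsSelfAdjoint T) {c : ℝ}
    (hc : ∀ x : T.domain, c * ‖(x : E)‖ ^ 2 ≤ (inner ℂ (x : E) (T x)).re) :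
    IsGLB (Complex.re '' spectrum T) (infSpectrum T) ∧
      IsGreatest {e : ℝ | ∀ x : T.domain, e * ‖(x : E)‖ ^ 2 ≤ (inner ℂ (x : E) (T x)).re}
        (infSpectrum T) := by
  set S := {e : ℝ | ∀ x : T.domain, e * ‖(x : E)‖ ^ 2 ≤ (inner ℂ (x : E) (T x)).re} with hS
  have hd := hT.dense_domain
  have hsym : T.IsFormalAdjoint T := by
    have := LinearPMap.adjoint_isFormalAdjoint hd
    rwa [LinearPMap.isSelfAdjoint_def.1 hT] at this
  obtain ⟨x0, hx0⟩ : ∃ x : T.domain, (x : E) ≠ 0 := by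
    by_contra hcon
    push Not at hcon
    have h0 : T.domain = ⊥ := (Submodule.eq_bot_iff _).2 fun x hx => hcon ⟨x, hx⟩
    rw [h0] at hd
    have h1 : (Set.univ : Set E) = {0} := by
      rw [← hd.closure_eq]; simp
    obtain ⟨y, hy⟩ := exists_ne (0 : E)
    have : y ∈ (Set.univ : Set E) := trivial
    rw [h1] at this
    exact hy this
  have hbdd : BddAbove S := by
    refine ⟨(inner ℂ (x0 : E) (T x0)).re / ‖(x0 : E)‖ ^ 2, fun e he => ?_⟩
    rw [le_div_iff₀ (by positivity)]
    exact he x0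
  have hne : S.Nonempty := ⟨c, hc⟩
  have hmem : sSup S ∈ S := by
    intro x
    by_cases hx : (x : E) = 0
    · have : x = 0 := Subtype.ext hx
      simp [this]
    rw [← le_div_iff₀ (by positivity)]
    refine csSup_le hne fun e he => ?_
    rw [le_div_iff₀ (by positivity)]
    exact he x
  -- If T - e had a bounded inverse R at e = sup S, the form bound could be improved. For w = R x
  -- the form of T - e at x - s w is its value at x minus 2 s ‖x‖² plus s² Re ⟨w, x⟩. It is
  -- nonnegative, and with s = 1 / (‖R‖ + 1) this bounds the value at x below by s ‖x‖².
  have hspec : ((sSup S : ℝ) : ℂ) ∈ spectrum T := by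
    rintro ⟨R, hR1, hR2⟩
    set e := sSup S
    have hr : 0 < ‖R‖ + 1 := by positivity
    have : e + (‖R‖ + 1)⁻¹ ∈ S := by
      intro x
      obtain ⟨hd', hTx⟩ := hR1 (x : E)
      let w : T.domain := ⟨R x, hd'⟩
      have hTw : T w = (x : E) + (e : ℂ) • (w : E) := by
        rw [← sub_eq_iff_eq_add]; exact hTx
      set s : ℝ := (‖R‖ + 1)⁻¹ with hs
      have h1 := hmem (x - (s : ℂ) • w)
      have hsxw := hsym w x
      have e1 : (inner ℂ ((x - (s : ℂ) • w : T.domain) : E) (T (x - (s : ℂ) • w))).re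
          - e * ‖((x - (s : ℂ) • w : T.domain) : E)‖ ^ 2 =
          (inner ℂ (x : E) (T x)).re - e * ‖(x : E)‖ ^ 2 - 2 * s * ‖(x : E)‖ ^ 2
            + s ^ 2 * (inner ℂ (w : E) (x : E)).re := by
        rw [← inner_self_re_eq, ← inner_self_re_eq, T.map_sub, T.map_smul, hTw]
        rw [hTw] at hsxw
        rw [Submodule.coe_sub, Submodule.coe_smul]
        simp only [inner_sub_left, inner_sub_right, inner_add_left, inner_add_right,
          inner_smul_left, inner_smul_right, Complex.conj_ofReal] at hsxw ⊢
        rw [← hsxw]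
        have e3 : (inner ℂ (x : E) (w : E)).re = (inner ℂ (w : E) (x : E)).re := by
          rw [← inner_conj_symm, Complex.conj_re]
        simp only [Complex.add_re, Complex.sub_re, Complex.re_ofReal_mul, e3]
        ring
      have h2 : (inner ℂ (w : E) (x : E)).re ≤ ‖R‖ * ‖(x : E)‖ ^ 2 := by
        refine (Complex.re_le_norm _).trans ((norm_inner_le_norm _ _).trans ?_)
        have : ‖(w : E)‖ ≤ ‖R‖ * ‖(x : E)‖ := R.le_opNorm _
        nlinarith [norm_nonneg (x : E)]
      have h3 : s ^ 2 * (inner ℂ (w : E) (x : E)).re ≤ s * ‖(x : E)‖ ^ 2 := by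
        have hs0 : 0 < s := by positivity
        have hs1 : s * ‖R‖ ≤ 1 := by
          have : s * (‖R‖ + 1) = 1 := inv_mul_cancel₀ hr.ne'
          linarith
        calc s ^ 2 * (inner ℂ (w : E) (x : E)).re ≤ s ^ 2 * (‖R‖ * ‖(x : E)‖ ^ 2) := by gcongr
          _ = (s * ‖R‖) * (s * ‖(x : E)‖ ^ 2) := by ring
          _ ≤ 1 * (s * ‖(x : E)‖ ^ 2) := by gcongr
          _ = _ := one_mul _
      linarith
    have h2 := le_csSup hbdd this
    have h3 : 0 < (‖R‖ + 1)⁻¹ := by positivity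
    linarith
  have hlb : ∀ r ∈ Complex.re '' spectrum T, sSup S ≤ r := by
    rintro _ ⟨z, hz, rfl⟩
    by_contra hcon
    push Not at hcon
    exact hz (mem_resolventSet_of_re_lt hT hmem hcon)
  have hleast : IsLeast (Complex.re '' spectrum T) (sSup S) :=
    ⟨⟨_, hspec, Complex.ofReal_re _⟩, hlb⟩
  have heq : infSpectrum T = sSup S := hleast.csInf_eq
  rw [heq]
  exact ⟨hleast.isGLB, hmem, fun e he => le_csSup hbdd he⟩

end Abstract

/-! ### Fock space vectors and their components -/

section FockVectors

variable {μ : Measure Momentum} [SigmaFinite μ]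

theorem memLp_comp (ψ : Fock μ) (ℓ : ℕ) : MemLp (comp ψ ℓ) 2 (tupleMeasure μ ℓ) :=
  Lp.memLp _

theorem comp_perm (ψ : Fock μ) {ℓ : ℕ} (s : Equiv.Perm (Fin ℓ)) :
    (fun k => comp ψ ℓ (k ∘ s)) =ᵐ[tupleMeasure μ ℓ] comp ψ ℓ :=
  (mem_Sector _).1 (ψ ℓ).2 s

/-- The inner product of Fock space in terms of components. -/
theorem hasSum_integral_inner (ψ φ : Fock μ) :
    HasSum (fun ℓ => ∫ k, inner ℂ (comp ψ ℓ k) (comp φ ℓ k) ∂tupleMeasure μ ℓ) (inner ℂ ψ φ) :=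
  lp.hasSum_inner ψ φ

theorem integrable_inner_comp (ψ φ : Fock μ) (ℓ : ℕ) :
    Integrable (fun k => inner ℂ (comp ψ ℓ k) (comp φ ℓ k)) (tupleMeasure μ ℓ) :=
  L2.integrable_inner _ _

theorem norm_sector_eq (ψ : Fock μ) (ℓ : ℕ) :
    ‖ψ ℓ‖ = (eLpNorm (comp ψ ℓ) 2 (tupleMeasure μ ℓ)).toReal := rfl

theorem hasSum_norm_sq (ψ : Fock μ) : HasSum (fun ℓ => ‖ψ ℓ‖ ^ 2) (‖ψ‖ ^ 2) := by
  simpa using lp.hasSum_norm (p := 2) (by norm_num) ψ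

/-- A square-summable family of permutation invariant square-integrable functions is the family of
components of a vector in Fock space. -/
theorem exists_fock_of_comp (v : ∀ ℓ : ℕ, (Fin ℓ → Momentum) → Atom)
    (hv : ∀ ℓ, MemLp (v ℓ) 2 (tupleMeasure μ ℓ))
    (hs : ∀ ℓ (s : Equiv.Perm (Fin ℓ)), (fun k => v ℓ (k ∘ s)) =ᵐ[tupleMeasure μ ℓ] v ℓ)
    (hsum : Summable fun ℓ => (eLpNorm (v ℓ) 2 (tupleMeasure μ ℓ)).toReal ^ 2) :
    ∃ η : Fock μ, ∀ ℓ, comp η ℓ =ᵐ[tupleMeasure μ ℓ] v ℓ := by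
  have hm : ∀ ℓ, (hv ℓ).toLp (v ℓ) ∈ Sector μ ℓ := by
    intro ℓ
    rw [mem_Sector]
    intro s
    have h1 := (hv ℓ).coeFn_toLp
    have h2 := (measurePreserving_perm μ s).quasiMeasurePreserving.ae_eq_comp h1
    exact h2.trans ((hs ℓ s).trans h1.symm)
  let η0 : ∀ ℓ, Sector μ ℓ := fun ℓ => ⟨(hv ℓ).toLp (v ℓ), hm ℓ⟩
  have hη : Memℓp η0 2 := by
    refine memℓp_gen ?_
    have : ∀ ℓ, ‖η0 ℓ‖ = (eLpNorm (v ℓ) 2 (tupleMeasure μ ℓ)).toReal := fun ℓ =>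
      Lp.norm_toLp (v ℓ) (hv ℓ)
    simpa [this] using hsum
  exact ⟨⟨η0, hη⟩, fun ℓ => (hv ℓ).coeFn_toLp⟩

theorem norm_sector_le {ψ φ : Fock μ} {ℓ m : ℕ} {C : ℝ} (hC : 0 ≤ C)
    (h : eLpNorm (comp ψ ℓ) 2 (tupleMeasure μ ℓ) ≤
      ENNReal.ofReal C * eLpNorm (comp φ m) 2 (tupleMeasure μ m)) : ‖ψ ℓ‖ ≤ C * ‖φ m‖ := by
  rw [norm_sector_eq, norm_sector_eq]
  have := ENNReal.toReal_mono (ENNReal.mul_ne_top ENNReal.ofReal_ne_top (memLp_comp φ m).2.ne) h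
  rwa [ENNReal.toReal_mul, ENNReal.toReal_ofReal hC] at this

theorem norm_sector_le_of_ae {ψ φ : Fock μ} {ℓ : ℕ} {C : ℝ} (hC : 0 ≤ C)
    (h : ∀ᵐ k ∂tupleMeasure μ ℓ, ‖comp ψ ℓ k‖ ≤ C * ‖comp φ ℓ k‖) : ‖ψ ℓ‖ ≤ C * ‖φ ℓ‖ := by
  refine norm_sector_le hC ?_
  exact eLpNorm_le_mul_eLpNorm_of_ae_le_mul h 2

theorem norm_le_of_sector_le {ψ φ : Fock μ} {C : ℝ} (hC : 0 ≤ C)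
    (h : ∀ ℓ, ‖ψ ℓ‖ ≤ C * ‖φ ℓ‖) : ‖ψ‖ ≤ C * ‖φ‖ := by
  refine (sq_le_sq₀ (norm_nonneg _) (by positivity)).1 ?_
  rw [mul_pow]
  refine hasSum_le (fun ℓ => ?_) (hasSum_norm_sq ψ) ((hasSum_norm_sq φ).mul_left (C ^ 2))
  rw [← mul_pow]
  exact pow_le_pow_left₀ (norm_nonneg _) (h ℓ) 2

/-- A family of permutation invariant functions dominated by the components of a vector in Fock
space is the family of components of a vector in Fock space. -/
theorem exists_fock_of_le (φ : Fock μ) (v : ∀ ℓ : ℕ, (Fin ℓ → Momentum) → Atom) {C : ℝ}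
    (hC : 0 ≤ C) (hv : ∀ ℓ, AEStronglyMeasurable (v ℓ) (tupleMeasure μ ℓ))
    (hs : ∀ ℓ (s : Equiv.Perm (Fin ℓ)), (fun k => v ℓ (k ∘ s)) =ᵐ[tupleMeasure μ ℓ] v ℓ)
    (hle : ∀ ℓ, ∀ᵐ k ∂tupleMeasure μ ℓ, ‖v ℓ k‖ ≤ C * ‖comp φ ℓ k‖) :
    ∃ η : Fock μ, ∀ ℓ, comp η ℓ =ᵐ[tupleMeasure μ ℓ] v ℓ := by
  have hm : ∀ ℓ, MemLp (v ℓ) 2 (tupleMeasure μ ℓ) := fun ℓ =>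
    (memLp_comp φ ℓ).of_le_mul (hv ℓ) (hle ℓ)
  refine exists_fock_of_comp v hm hs ?_
  refine Summable.of_nonneg_of_le (fun ℓ => sq_nonneg _) (fun ℓ => ?_)
    ((hasSum_norm_sq φ).summable.mul_left (C ^ 2))
  rw [← mul_pow]
  refine pow_le_pow_left₀ ENNReal.toReal_nonneg ?_ 2
  have h := eLpNorm_le_mul_eLpNorm_of_ae_le_mul (hle ℓ) 2
  have := ENNReal.toReal_mono (ENNReal.mul_ne_top ENNReal.ofReal_ne_top (memLp_comp φ ℓ).2.ne) h
  rwa [ENNReal.toReal_mul, ENNReal.toReal_ofReal hC] at this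

/-- Every vector in Fock space has measurable, exactly permutation invariant components. -/
theorem exists_symmetric_representative (ψ : Fock μ) :
    ∃ u : ∀ ℓ : ℕ, (Fin ℓ → Momentum) → Atom, (∀ ℓ, Measurable (u ℓ)) ∧
      (∀ ℓ (s : Equiv.Perm (Fin ℓ)) k, u ℓ (k ∘ s) = u ℓ k) ∧
      ∀ ℓ, u ℓ =ᵐ[tupleMeasure μ ℓ] comp ψ ℓ := by
  have hm : ∀ ℓ, ∃ v : (Fin ℓ → Momentum) → Atom, Measurable v ∧
      comp ψ ℓ =ᵐ[tupleMeasure μ ℓ] v := fun ℓ =>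
    ⟨_, (memLp_comp ψ ℓ).1.stronglyMeasurable_mk.measurable, (memLp_comp ψ ℓ).1.ae_eq_mk⟩
  choose v hv hve using hm
  have hperm : ∀ ℓ (s : Equiv.Perm (Fin ℓ)),
      Measurable (fun k : Fin ℓ → Momentum => k ∘ s) := fun ℓ s =>
    (measurePreserving_perm μ s).measurable
  -- Averaging over all permutations makes the invariance exact. It is needed pointwise later, since
  -- slices with one momentum fixed must again be symmetric.
  refine ⟨fun ℓ k => ((Fintype.card (Equiv.Perm (Fin ℓ)) : ℂ))⁻¹ •
    ∑ s : Equiv.Perm (Fin ℓ), v ℓ (k ∘ s), fun ℓ => ?_, fun ℓ t k => ?_, fun ℓ => ?_⟩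
  · have h : Measurable fun k => ∑ s : Equiv.Perm (Fin ℓ), v ℓ (k ∘ s) :=
      Finset.measurable_sum _ fun s _ => (hv ℓ).comp (hperm ℓ s)
    exact h.const_smul ((Fintype.card (Equiv.Perm (Fin ℓ)) : ℂ))⁻¹
  · simp only
    congr 1
    exact Fintype.sum_equiv (Equiv.mulLeft t) _ _ fun s => rfl
  · have h : ∀ᵐ k ∂tupleMeasure μ ℓ, ∀ s : Equiv.Perm (Fin ℓ), v ℓ (k ∘ s) = comp ψ ℓ k := by
      refine ae_all_iff.2 fun s => ?_
      have h1 := (measurePreserving_perm μ s).quasiMeasurePreserving.ae_eq_comp (hve ℓ)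
      filter_upwards [h1, comp_perm ψ s] with k h1 h2
      rw [← h2]
      exact h1.symm
    filter_upwards [h] with k hk
    simp only [hk, Finset.sum_const, Finset.card_univ]
    rw [← Nat.cast_smul_eq_nsmul ℂ, smul_smul, inv_mul_cancel₀, one_smul]
    exact_mod_cast Fintype.card_ne_zero

/-- The vacuum is a nonzero vector even when μ = 0, because the product measure over no factors is a
Dirac mass. Without a nonzero vector the spectrum would be empty. -/
instance instNontrivialFock : Nontrivial (Fock μ) := by
  classical
  let v : ∀ ℓ : ℕ, (Fin ℓ → Momentum) → Atom := fun ℓ _ =>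
    if ℓ = 0 then EuclideanSpace.single 0 1 else 0
  have h0 : ∀ ℓ, ℓ ≠ 0 → v ℓ = 0 := fun ℓ h => by funext k; simp [v, h]
  have hdirac : tupleMeasure μ 0 = Measure.dirac isEmptyElim := Measure.pi_of_empty _ _
  have hv : ∀ ℓ, MemLp (v ℓ) 2 (tupleMeasure μ ℓ) := by
    intro ℓ
    rcases Nat.eq_zero_or_pos ℓ with rfl | h
    · rw [hdirac]; exact memLp_const _
    · rw [h0 ℓ h.ne']; exact MemLp.zero
  obtain ⟨η, hη⟩ := exists_fock_of_comp (μ := μ) v hv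
    (fun ℓ s => Filter.EventuallyEq.rfl) (by
      refine summable_of_ne_finset_zero (s := {0}) fun ℓ hℓ => ?_
      rw [h0 ℓ (by simpa using hℓ)]; simp)
  refine ⟨⟨η, 0, fun h => ?_⟩⟩
  have h1 : comp η 0 =ᵐ[tupleMeasure μ 0] fun _ => (0 : Atom) := by
    rw [h]; exact Lp.coeFn_zero _ _ _
  have h2 := (hη 0).symm.trans h1
  have h3 : tupleMeasure μ 0 ≠ 0 := by
    rw [hdirac]
    exact NeZero.ne _
  have : (ae (tupleMeasure μ 0)).NeBot := ae_neBot.2 h3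
  obtain ⟨k, hk⟩ := h2.exists
  have h4 := congrArg (fun z : Atom => z 0) hk
  simp [v] at h4

end FockVectors

/-! ### The photon energy and the atomic operator -/

section Operators

variable {μ : Measure Momentum} [SigmaFinite μ]

/-- The total energy `w(k₁) + ⋯ + w(k_ℓ)` of `ℓ` photons. -/
def tupleEnergy (w : Momentum → ℝ) {ℓ : ℕ} (k : Fin ℓ → Momentum) : ℝ := ∑ i, w (k i)

theorem tupleEnergy_perm (w : Momentum → ℝ) {ℓ : ℕ} (k : Fin ℓ → Momentum)
    (s : Equiv.Perm (Fin ℓ)) : tupleEnergy w (k ∘ s) = tupleEnergy w k :=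
  Equiv.sum_comp s fun i => w (k i)

theorem measurable_tupleEnergy {w : Momentum → ℝ} (hw : Measurable w) (ℓ : ℕ) :
    Measurable (tupleEnergy w (ℓ := ℓ)) :=
  Finset.measurable_sum _ fun i _ => hw.comp (measurable_pi_apply i)

theorem tupleEnergy_nonneg {w : Momentum → ℝ} (hw : ∀ k, 0 ≤ w k) {ℓ : ℕ}
    (k : Fin ℓ → Momentum) : 0 ≤ tupleEnergy w k :=
  Finset.sum_nonneg fun i _ => hw (k i)

theorem comp_photonEnergy {w : Momentum → ℝ} (ψ : (photonEnergy μ w).domain) (ℓ : ℕ) :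
    comp (photonEnergy μ w ψ) ℓ =ᵐ[tupleMeasure μ ℓ]
      fun k => (tupleEnergy w k : ℂ) • comp (ψ : Fock μ) ℓ k :=
  comp_maximalOp ψ ℓ

theorem photonEnergy_isFormalAdjoint (w : Momentum → ℝ) :
    (photonEnergy μ w).IsFormalAdjoint (photonEnergy μ w) := by
  intro ψ φ
  refine (hasSum_integral_inner _ _).unique ?_
  convert hasSum_integral_inner (ψ : Fock μ) (photonEnergy μ w φ) using 2 with ℓ
  refine integral_congr_ae ?_
  filter_upwards [comp_photonEnergy ψ ℓ, comp_photonEnergy φ ℓ] with k h1 h2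
  rw [h1, h2, inner_smul_left, inner_smul_right, Complex.conj_ofReal]

theorem hasSum_photonEnergy_form {w : Momentum → ℝ} (ψ : (photonEnergy μ w).domain) :
    HasSum (fun ℓ => ∫ k, tupleEnergy w k * ‖comp (ψ : Fock μ) ℓ k‖ ^ 2 ∂tupleMeasure μ ℓ)
      (inner ℂ (ψ : Fock μ) (photonEnergy μ w ψ)).re := by
  have h := Complex.hasSum_re (hasSum_integral_inner (ψ : Fock μ) (photonEnergy μ w ψ))
  convert h using 2 with ℓ
  have h3 : ∀ F : (Fin ℓ → Momentum) → ℂ, Integrable F (tupleMeasure μ ℓ) →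
    (∫ k, F k ∂tupleMeasure μ ℓ).re = ∫ k, (F k).re ∂tupleMeasure μ ℓ := fun F hF =>
      (integral_re hF).symm
  rw [h3 _ (integrable_inner_comp _ _ _)]
  refine integral_congr_ae ?_
  filter_upwards [comp_photonEnergy ψ ℓ] with k h1
  rw [h1, inner_smul_right, Complex.re_ofReal_mul, inner_self_re_eq]

theorem photonEnergy_nonneg {w : Momentum → ℝ} (hw : ∀ k, 0 ≤ w k)
    (ψ : (photonEnergy μ w).domain) :
    0 ≤ (inner ℂ (ψ : Fock μ) (photonEnergy μ w ψ)).re :=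
  (hasSum_photonEnergy_form ψ).nonneg fun ℓ => integral_nonneg fun k =>
    mul_nonneg (tupleEnergy_nonneg hw k) (sq_nonneg _)

/-- Multiplication by a bounded permutation invariant function. -/
theorem exists_fock_mul (φ : Fock μ) (m : ∀ ℓ : ℕ, (Fin ℓ → Momentum) → ℝ) {C : ℝ} (hC : 0 ≤ C)
    (hm : ∀ ℓ, Measurable (m ℓ)) (hs : ∀ ℓ (s : Equiv.Perm (Fin ℓ)) k, m ℓ (k ∘ s) = m ℓ k)
    (hle : ∀ ℓ k, |m ℓ k| ≤ C) :
    ∃ η : Fock μ, ∀ ℓ, comp η ℓ =ᵐ[tupleMeasure μ ℓ] fun k => (m ℓ k : ℂ) • comp φ ℓ k := by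
  refine exists_fock_of_le φ _ hC (fun ℓ => ?_) (fun ℓ s => ?_) (fun ℓ => ?_)
  · exact (Complex.measurable_ofReal.comp (hm ℓ)).aestronglyMeasurable.smul (memLp_comp φ ℓ).1
  · filter_upwards [comp_perm φ s] with k hk
    rw [hk, hs]
  · filter_upwards with k
    rw [norm_smul, Complex.norm_real, Real.norm_eq_abs]
    gcongr
    exact hle ℓ k

/-- The solution is φ multiplied by (E + l)⁻¹, with E the total photon energy. The multiplier E (E +
l)⁻¹ is bounded by 1, which places the solution in the domain. -/
theorem photonEnergy_add_surjective {w : Momentum → ℝ} (hwm : Measurable w) (hw : ∀ k, 0 ≤ w k)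
    {l : ℝ} (hl : 0 < l) (φ : Fock μ) :
    ∃ ψ : (photonEnergy μ w).domain, photonEnergy μ w ψ + (l : ℂ) • (ψ : Fock μ) = φ := by
  have hpos : ∀ {ℓ : ℕ} (k : Fin ℓ → Momentum), 0 < tupleEnergy w k + l := fun k =>
    add_pos_of_nonneg_of_pos (tupleEnergy_nonneg hw k) hl
  obtain ⟨ψ, hψ⟩ := exists_fock_mul φ (fun ℓ k => (tupleEnergy w k + l)⁻¹) (C := l⁻¹) (by positivity)
    (fun ℓ => ((measurable_tupleEnergy hwm ℓ).add_const l).inv)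
    (fun ℓ s k => by rw [tupleEnergy_perm]) (fun _ k => by
      rw [abs_of_pos (inv_pos.2 (hpos k))]
      exact inv_anti₀ hl (by linarith [tupleEnergy_nonneg hw k]))
  obtain ⟨η, hη⟩ := exists_fock_mul φ (fun ℓ k => tupleEnergy w k * (tupleEnergy w k + l)⁻¹)
    (C := 1) zero_le_one
    (fun ℓ => (measurable_tupleEnergy hwm ℓ).mul ((measurable_tupleEnergy hwm ℓ).add_const l).inv)
    (fun ℓ s k => by rw [tupleEnergy_perm]) (fun ℓ k => by
      have := tupleEnergy_nonneg hw k
      rw [abs_of_nonneg (mul_nonneg this (inv_pos.2 (hpos k)).le), ← div_eq_mul_inv,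
        div_le_one (hpos k)]
      linarith)
  have hd : ψ ∈ (photonEnergy μ w).domain := by
    refine ⟨η, fun ℓ => ?_⟩
    filter_upwards [hψ ℓ, hη ℓ] with k h1 h2
    rw [h1, h2, smul_smul]
    simp [tupleEnergy]
  refine ⟨⟨ψ, hd⟩, comp_ext fun ℓ => ?_⟩
  filter_upwards [comp_add (photonEnergy μ w ⟨ψ, hd⟩) ((l : ℂ) • ψ) ℓ, comp_smul (l : ℂ) ψ ℓ,
    comp_photonEnergy ⟨ψ, hd⟩ ℓ, hψ ℓ] with k h1 h2 h3 h4
  rw [h1, h2, h3, h4, ← add_smul, smul_smul, ← Complex.ofReal_add, ← Complex.ofReal_mul,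
    mul_inv_cancel₀ (hpos k).ne', Complex.ofReal_one, one_smul]

theorem ae_le_tupleEnergy {w : Momentum → ℝ} {r : ℝ} (hr : ∀ᵐ k ∂μ, r ≤ w k) (ℓ : ℕ) :
    ∀ᵐ k ∂tupleMeasure μ ℓ, r * ℓ ≤ tupleEnergy w k := by
  have h : ∀ᵐ k ∂tupleMeasure μ ℓ, ∀ i, r ≤ w (k i) :=
    ae_all_iff.2 fun i => (Measure.quasiMeasurePreserving_eval (fun _ : Fin ℓ => μ) i).ae hr
  filter_upwards [h] with k hk
  calc r * ℓ = ∑ _i : Fin ℓ, r := by simp [mul_comm]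
    _ ≤ _ := Finset.sum_le_sum fun i _ => hk i

/-- Each photon carries energy at least r almost everywhere. This is where the infrared cutoff
enters the self-adjointness proof. -/
theorem number_le_photonEnergy {w : Momentum → ℝ} {r : ℝ} (hr0 : 0 < r) (hr : ∀ᵐ k ∂μ, r ≤ w k)
    (ψ : (photonEnergy μ w).domain) (ℓ : ℕ) :
    r * ℓ * ‖(ψ : Fock μ) ℓ‖ ≤ ‖photonEnergy μ w ψ ℓ‖ := by
  rcases Nat.eq_zero_or_pos ℓ with rfl | h
  · simp
  have hpos : 0 < r * ℓ := by positivity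
  rw [← le_div_iff₀' hpos, div_eq_inv_mul]
  refine norm_sector_le_of_ae (by positivity) ?_
  filter_upwards [comp_photonEnergy ψ ℓ, ae_le_tupleEnergy hr ℓ] with k h1 h2
  rw [h1, norm_smul, Complex.norm_real, Real.norm_eq_abs, abs_of_pos (hpos.trans_le h2),
    ← div_eq_inv_mul, le_div_iff₀' hpos]
  gcongr

theorem comp_atomOp {M : Matrix (Fin 2) (Fin 2) ℂ} (ψ : (atomOp μ M).domain) (ℓ : ℕ) :
    comp (atomOp μ M ψ) ℓ =ᵐ[tupleMeasure μ ℓ]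
      fun k => Matrix.toEuclideanCLM (𝕜 := ℂ) M (comp (ψ : Fock μ) ℓ k) :=
  comp_maximalOp ψ ℓ

theorem atomOp_domain (M : Matrix (Fin 2) (Fin 2) ℂ) : (atomOp μ M).domain = ⊤ := by
  rw [eq_top_iff]
  intro ψ _
  refine exists_fock_of_le ψ _ (norm_nonneg (Matrix.toEuclideanCLM (𝕜 := ℂ) M)) (fun ℓ => ?_)
    (fun ℓ s => ?_) (fun ℓ => ?_)
  · exact (Matrix.toEuclideanCLM (𝕜 := ℂ) M).continuous.comp_aestronglyMeasurable (memLp_comp ψ ℓ).1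
  · filter_upwards [comp_perm ψ s] with k hk
    rw [hk]
  · exact Filter.Eventually.of_forall fun k => ContinuousLinearMap.le_opNorm _ _

theorem norm_atomOp_le {M : Matrix (Fin 2) (Fin 2) ℂ} (ψ : (atomOp μ M).domain) :
    ‖atomOp μ M ψ‖ ≤ ‖Matrix.toEuclideanCLM (𝕜 := ℂ) M‖ * ‖(ψ : Fock μ)‖ := by
  refine norm_le_of_sector_le (norm_nonneg _) fun ℓ => ?_
  refine norm_sector_le_of_ae (norm_nonneg _) ?_
  filter_upwards [comp_atomOp ψ ℓ] with k hk
  rw [hk]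
  exact ContinuousLinearMap.le_opNorm _ _

theorem atomOp_isFormalAdjoint {M : Matrix (Fin 2) (Fin 2) ℂ} (hM : M.IsHermitian) :
    (atomOp μ M).IsFormalAdjoint (atomOp μ M) := by
  have hsa : ∀ v v' : Atom, inner ℂ (Matrix.toEuclideanCLM (𝕜 := ℂ) M v) v' =
      inner ℂ v (Matrix.toEuclideanCLM (𝕜 := ℂ) M v') := by
    intro v v'
    rw [← ContinuousLinearMap.adjoint_inner_right, ← ContinuousLinearMap.star_eq_adjoint, ← map_star,
      Matrix.star_eq_conjTranspose, hM.eq]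
  intro ψ φ
  refine (hasSum_integral_inner _ _).unique ?_
  convert hasSum_integral_inner (ψ : Fock μ) (atomOp μ M φ) using 2 with ℓ
  refine integral_congr_ae ?_
  filter_upwards [comp_atomOp ψ ℓ, comp_atomOp φ ℓ] with k h1 h2
  rw [h1, h2, hsa]

theorem hasSum_atomOp_form {M : Matrix (Fin 2) (Fin 2) ℂ} (ψ : (atomOp μ M).domain) :
    HasSum (fun ℓ => ∫ k, (inner ℂ (comp (ψ : Fock μ) ℓ k)
        (Matrix.toEuclideanCLM (𝕜 := ℂ) M (comp (ψ : Fock μ) ℓ k))).re ∂tupleMeasure μ ℓ)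
      (inner ℂ (ψ : Fock μ) (atomOp μ M ψ)).re := by
  have h := Complex.hasSum_re (hasSum_integral_inner (ψ : Fock μ) (atomOp μ M ψ))
  convert h using 2 with ℓ
  have h3 : ∀ F : (Fin ℓ → Momentum) → ℂ, Integrable F (tupleMeasure μ ℓ) →
    (∫ k, F k ∂tupleMeasure μ ℓ).re = ∫ k, (F k).re ∂tupleMeasure μ ℓ := fun F hF =>
      (integral_re hF).symm
  rw [h3 _ (integrable_inner_comp _ _ _)]
  refine integral_congr_ae ?_
  filter_upwards [comp_atomOp ψ ℓ] with k h1
  rw [h1]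

end Operators

/-! ### Bounds on creation and annihilation operators -/

section Creation

variable {μ : Measure Momentum} [SigmaFinite μ]

/-- The first Pauli matrix as an operator on the atom. -/
def pauliCLM : Atom →L[ℂ] Atom := Matrix.toEuclideanCLM (𝕜 := ℂ) pauliX

theorem norm_pauliCLM (v : Atom) : ‖pauliCLM v‖ = ‖v‖ := by
  have h0 : pauliCLM v 0 = v 1 := by
    simp [pauliCLM, pauliX, Matrix.vecHead, Matrix.vecTail]
  have h1 : pauliCLM v 1 = v 0 := by
    simp [pauliCLM, pauliX, Matrix.vecHead, Matrix.vecTail]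
  rw [EuclideanSpace.norm_eq, EuclideanSpace.norm_eq, Fin.sum_univ_two, Fin.sum_univ_two, h0, h1,
    add_comm]

/-- The matrix-valued coupling function `c(k) σ₁`. -/
def pauliCoupling (c : Momentum → ℝ) (k : Momentum) : Matrix (Fin 2) (Fin 2) ℂ :=
  (c k : ℂ) • pauliX

theorem pauliCoupling_apply (c : Momentum → ℝ) (k : Momentum) (v : Atom) :
    Matrix.toEuclideanCLM (𝕜 := ℂ) (pauliCoupling c k) v = (c k : ℂ) • pauliCLM v := by
  rw [pauliCoupling, map_smul]; rfl

theorem measurePreserving_succAbove {ℓ : ℕ} (i : Fin (ℓ + 1)) :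
    MeasurePreserving (fun k : Fin (ℓ + 1) → Momentum => (k i, k ∘ i.succAbove))
      (tupleMeasure μ (ℓ + 1)) (μ.prod (tupleMeasure μ ℓ)) :=
  measurePreserving_piFinSuccAbove (fun _ : Fin (ℓ + 1) => μ) i

theorem measurePreserving_cons (ℓ : ℕ) :
    MeasurePreserving
      (fun z : Momentum × (Fin ℓ → Momentum) => (Fin.cons z.1 z.2 : Fin (ℓ + 1) → Momentum))
      (μ.prod (tupleMeasure μ ℓ)) (tupleMeasure μ (ℓ + 1)) := by
  have h := (measurePreserving_piFinSuccAbove (fun _ : Fin (ℓ + 1) => μ) 0).symm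
  convert h using 1
  ext z : 1
  exact (Fin.insertNth_zero (α := fun _ => Momentum) z.1 z.2).symm

/-- σ₁ preserves the norm, and separating the i-th momentum from the others is measure preserving
onto a product, where the square norm factorizes. -/
theorem eLpNorm_creation_term {c : Momentum → ℝ} (hc : Measurable c) {ℓ : ℕ} (i : Fin (ℓ + 1))
    {v : (Fin ℓ → Momentum) → Atom} (hv : AEStronglyMeasurable v (tupleMeasure μ ℓ)) :
    eLpNorm (fun k : Fin (ℓ + 1) → Momentum =>
        Matrix.toEuclideanCLM (𝕜 := ℂ) (pauliCoupling c (k i)) (v (k ∘ i.succAbove))) 2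
      (tupleMeasure μ (ℓ + 1)) = eLpNorm c 2 μ * eLpNorm v 2 (tupleMeasure μ ℓ) := by
  have hm : AEStronglyMeasurable
      (fun z : Momentum × (Fin ℓ → Momentum) => (c z.1 : ℂ) • pauliCLM (v z.2))
      (μ.prod (tupleMeasure μ ℓ)) := by
    have h1 : AEStronglyMeasurable (fun z : Momentum × (Fin ℓ → Momentum) => (c z.1 : ℂ))
        (μ.prod (tupleMeasure μ ℓ)) :=
      (Complex.measurable_ofReal.comp (hc.comp measurable_fst)).aestronglyMeasurable
    have h2 : AEStronglyMeasurable (fun z : Momentum × (Fin ℓ → Momentum) => pauliCLM (v z.2))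
        (μ.prod (tupleMeasure μ ℓ)) :=
      pauliCLM.continuous.comp_aestronglyMeasurable hv.comp_snd
    exact h1.smul h2
  have h1 := eLpNorm_comp_measurePreserving (p := 2) hm (measurePreserving_succAbove (μ := μ) i)
  have h2 : (fun k : Fin (ℓ + 1) → Momentum =>
        Matrix.toEuclideanCLM (𝕜 := ℂ) (pauliCoupling c (k i)) (v (k ∘ i.succAbove))) =
      (fun z : Momentum × (Fin ℓ → Momentum) => (c z.1 : ℂ) • pauliCLM (v z.2)) ∘
        (fun k : Fin (ℓ + 1) → Momentum => (k i, k ∘ i.succAbove)) := by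
    funext k
    exact pauliCoupling_apply c _ _
  rw [h2, h1]
  simp only [eLpNorm_eq_lintegral_rpow_enorm_toReal two_ne_zero ENNReal.ofNat_ne_top]
  rw [← ENNReal.mul_rpow_of_nonneg _ _ (by norm_num), ← lintegral_prod_mul]
  · congr 1
    refine lintegral_congr fun z => ?_
    rw [← ENNReal.mul_rpow_of_nonneg _ _ (by norm_num), enorm_smul]
    congr 2
    · simp [enorm_eq_nnnorm]
    · have := norm_pauliCLM (v z.2)
      rw [enorm_eq_nnnorm, enorm_eq_nnnorm]
      congr 1
      exact NNReal.eq this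
  · exact (hc.enorm.pow_const _).aemeasurable
  · exact hv.enorm.pow_const _

theorem aestronglyMeasurable_creation_term {c : Momentum → ℝ} (hc : Measurable c) {ℓ : ℕ}
    (i : Fin (ℓ + 1)) {v : (Fin ℓ → Momentum) → Atom}
    (hv : AEStronglyMeasurable v (tupleMeasure μ ℓ)) :
    AEStronglyMeasurable (fun k : Fin (ℓ + 1) → Momentum =>
        Matrix.toEuclideanCLM (𝕜 := ℂ) (pauliCoupling c (k i)) (v (k ∘ i.succAbove)))
      (tupleMeasure μ (ℓ + 1)) := by
  simp only [pauliCoupling_apply]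
  have h1 : AEStronglyMeasurable (fun k : Fin (ℓ + 1) → Momentum => (c (k i) : ℂ))
      (tupleMeasure μ (ℓ + 1)) :=
    (Complex.measurable_ofReal.comp (hc.comp (measurable_pi_apply i))).aestronglyMeasurable
  have h2 : AEStronglyMeasurable
      (fun k : Fin (ℓ + 1) → Momentum => pauliCLM (v (k ∘ i.succAbove)))
      (tupleMeasure μ (ℓ + 1)) :=
    pauliCLM.continuous.comp_aestronglyMeasurable
      (hv.comp_quasiMeasurePreserving (quasiMeasurePreserving_erase μ i))
  exact h1.smul h2

theorem aestronglyMeasurable_creationComp {c : Momentum → ℝ} (hc : Measurable c) (ψ : Fock μ)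
    (ℓ : ℕ) : AEStronglyMeasurable (creationComp (pauliCoupling c) ψ ℓ) (tupleMeasure μ ℓ) := by
  cases ℓ with
  | zero => exact aestronglyMeasurable_const
  | succ ℓ =>
    have h := Finset.aestronglyMeasurable_fun_sum (Finset.univ : Finset (Fin (ℓ + 1))) fun i _ =>
      aestronglyMeasurable_creation_term (μ := μ) hc i (memLp_comp ψ ℓ).1
    exact h.const_smul (((Real.sqrt (ℓ + 1))⁻¹ : ℝ) : ℂ)

/-- The triangle inequality over ℓ + 1 summands of equal norm gives (ℓ + 1) / √(ℓ + 1). -/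
theorem eLpNorm_creationComp_le {c : Momentum → ℝ} (hc : Measurable c) (ψ : Fock μ) (ℓ : ℕ) :
    eLpNorm (creationComp (pauliCoupling c) ψ (ℓ + 1)) 2 (tupleMeasure μ (ℓ + 1)) ≤
      ENNReal.ofReal (Real.sqrt (ℓ + 1)) *
        (eLpNorm c 2 μ * eLpNorm (comp ψ ℓ) 2 (tupleMeasure μ ℓ)) := by
  have h : creationComp (pauliCoupling c) ψ (ℓ + 1) = (((Real.sqrt (ℓ + 1))⁻¹ : ℝ) : ℂ) •
      ∑ i : Fin (ℓ + 1), fun k : Fin (ℓ + 1) → Momentum =>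
        Matrix.toEuclideanCLM (𝕜 := ℂ) (pauliCoupling c (k i)) (comp ψ ℓ (k ∘ i.succAbove)) := by
    funext k
    simp only [creationComp, Pi.smul_apply, Finset.sum_apply]
  rw [h, eLpNorm_const_smul]
  have h1 := eLpNorm_sum_le (s := Finset.univ) (p := 2) (fun (i : Fin (ℓ + 1)) _ =>
    aestronglyMeasurable_creation_term (μ := μ) hc i (memLp_comp ψ ℓ).1) one_le_two
  simp only [eLpNorm_creation_term hc _ (memLp_comp ψ ℓ).1, Finset.sum_const, Finset.card_univ,
    Fintype.card_fin] at h1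
  refine (mul_le_mul_right h1 _).trans (le_of_eq ?_)
  rw [nsmul_eq_mul, ← mul_assoc]
  congr 1
  have hpos : (0 : ℝ) < ℓ + 1 := by positivity
  have h2 : ‖(((Real.sqrt (ℓ + 1))⁻¹ : ℝ) : ℂ)‖ₑ = ENNReal.ofReal (Real.sqrt (ℓ + 1))⁻¹ := by
    rw [← ofReal_norm, Complex.norm_real, Real.norm_of_nonneg (by positivity)]
  have h3 : ((ℓ + 1 : ℕ) : ℝ≥0∞) = ENNReal.ofReal (ℓ + 1) := by
    rw [← Nat.cast_add_one, ENNReal.ofReal_natCast]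
  rw [h2, h3, ← ENNReal.ofReal_mul (by positivity)]
  congr 1
  rw [inv_mul_eq_div, Real.div_sqrt]

/-- Removing the `i`-th entry after a permutation amounts to a permutation after removing the
`s i`-th entry. -/
theorem exists_perm_succAbove {ℓ : ℕ} (s : Equiv.Perm (Fin (ℓ + 1))) (i : Fin (ℓ + 1)) :
    ∃ t : Equiv.Perm (Fin ℓ), ∀ j, s (i.succAbove j) = (s i).succAbove (t j) := by
  have hne : ∀ a : Fin (ℓ + 1), a ≠ i ↔ s a ≠ s i := fun a => s.injective.ne_iff.symm
  refine ⟨(finSuccAboveEquiv i).trans ((s.subtypeEquiv hne).trans (finSuccAboveEquiv (s i)).symm),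
    fun j => ?_⟩
  have := congrArg Subtype.val ((finSuccAboveEquiv (s i)).apply_symm_apply
    (s.subtypeEquiv hne (finSuccAboveEquiv i j)))
  exact this.symm

/-- Permuting the momenta permutes the summands, up to a permutation of the ℓ remaining momenta,
which the symmetry of ψ absorbs. -/
theorem creationComp_perm (G : Momentum → Matrix (Fin 2) (Fin 2) ℂ) (ψ : Fock μ) (ℓ : ℕ)
    (s : Equiv.Perm (Fin ℓ)) : (fun k => creationComp G ψ ℓ (k ∘ s)) =ᵐ[tupleMeasure μ ℓ]
      creationComp G ψ ℓ := by
  cases ℓ with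
  | zero => exact Filter.EventuallyEq.rfl
  | succ ℓ =>
    choose t ht using exists_perm_succAbove s
    have h : ∀ᵐ k ∂tupleMeasure μ (ℓ + 1), ∀ i, comp ψ ℓ ((k ∘ (s i).succAbove) ∘ t i) =
        comp ψ ℓ (k ∘ (s i).succAbove) := ae_all_iff.2 fun i =>
      (quasiMeasurePreserving_erase μ (s i)).ae (comp_perm ψ (t i))
    filter_upwards [h] with k hk
    simp only [creationComp]
    congr 1
    refine Fintype.sum_equiv s _ _ fun i => ?_
    have : (k ∘ s) ∘ i.succAbove = (k ∘ (s i).succAbove) ∘ t i := by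
      funext j
      simp [ht]
    rw [this, hk]
    rfl

theorem comp_creation {G : Momentum → Matrix (Fin 2) (Fin 2) ℂ} (ψ : (creation μ G).domain)
    (ℓ : ℕ) : comp (creation μ G ψ) ℓ =ᵐ[tupleMeasure μ ℓ] creationComp G (ψ : Fock μ) ℓ :=
  comp_maximalOp ψ ℓ

theorem norm_creation_zero {G : Momentum → Matrix (Fin 2) (Fin 2) ℂ} (ψ : (creation μ G).domain) :
    ‖creation μ G ψ 0‖ = 0 := by
  rw [norm_sector_eq, eLpNorm_congr_ae (comp_creation ψ 0)]
  change (eLpNorm (fun _ => (0 : Atom)) 2 _).toReal = 0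
  simp

theorem norm_creation_succ_le {c : Momentum → ℝ} (hc : Measurable c) (hc2 : MemLp c 2 μ)
    (ψ : (creation μ (pauliCoupling c)).domain) (ℓ : ℕ) :
    ‖creation μ (pauliCoupling c) ψ (ℓ + 1)‖ ≤
      Real.sqrt (ℓ + 1) * (eLpNorm c 2 μ).toReal * ‖(ψ : Fock μ) ℓ‖ := by
  refine norm_sector_le (by positivity) ?_
  refine (eLpNorm_congr_ae (comp_creation ψ (ℓ + 1))).trans_le ?_
  refine (eLpNorm_creationComp_le hc (ψ : Fock μ) ℓ).trans (le_of_eq ?_)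
  rw [ENNReal.ofReal_mul (Real.sqrt_nonneg _), ENNReal.ofReal_toReal hc2.2.ne, mul_assoc]

/-- The summability hypothesis is finiteness of the expected photon number, which compensates the
factor √(ℓ + 1) in the norm of the created component. -/
theorem mem_creation_domain {c : Momentum → ℝ} (hc : Measurable c) (hc2 : MemLp c 2 μ) {ψ : Fock μ}
    (hS : Summable fun ℓ : ℕ => (ℓ + 1 : ℝ) * ‖ψ ℓ‖ ^ 2) :
    ψ ∈ (creation μ (pauliCoupling c)).domain := by
  have hle : ∀ ℓ, (eLpNorm (creationComp (pauliCoupling c) ψ (ℓ + 1)) 2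
      (tupleMeasure μ (ℓ + 1))).toReal ≤ Real.sqrt (ℓ + 1) * ((eLpNorm c 2 μ).toReal * ‖ψ ℓ‖) := by
    intro ℓ
    have h := ENNReal.toReal_mono (ENNReal.mul_ne_top ENNReal.ofReal_ne_top
      (ENNReal.mul_ne_top hc2.2.ne (memLp_comp ψ ℓ).2.ne)) (eLpNorm_creationComp_le hc ψ ℓ)
    rwa [ENNReal.toReal_mul, ENNReal.toReal_mul, ENNReal.toReal_ofReal (Real.sqrt_nonneg _)] at h
  refine exists_fock_of_comp _ (fun ℓ => ⟨aestronglyMeasurable_creationComp hc ψ ℓ, ?_⟩)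
    (creationComp_perm _ ψ) ?_
  · cases ℓ with
    | zero =>
      change eLpNorm (fun _ => (0 : Atom)) 2 _ < ⊤
      simp
    | succ ℓ =>
      exact (eLpNorm_creationComp_le hc ψ ℓ).trans_lt (ENNReal.mul_lt_top ENNReal.ofReal_lt_top
        (ENNReal.mul_lt_top hc2.2 (memLp_comp ψ ℓ).2))
  · rw [← summable_nat_add_iff 1]
    refine Summable.of_nonneg_of_le (fun ℓ => sq_nonneg _) (fun ℓ => ?_)
      (hS.mul_left ((eLpNorm c 2 μ).toReal ^ 2))
    refine (pow_le_pow_left₀ ENNReal.toReal_nonneg (hle ℓ) 2).trans (le_of_eq ?_)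
    rw [mul_pow, mul_pow, Real.sq_sqrt (by positivity)]
    ring

theorem norm_creation_le {c : Momentum → ℝ} (hc : Measurable c) (hc2 : MemLp c 2 μ) {S : ℝ}
    (hS0 : 0 ≤ S) (ψ : (creation μ (pauliCoupling c)).domain)
    (hS : HasSum (fun ℓ : ℕ => (ℓ + 1 : ℝ) * ‖(ψ : Fock μ) ℓ‖ ^ 2) (S ^ 2)) :
    ‖creation μ (pauliCoupling c) ψ‖ ≤ (eLpNorm c 2 μ).toReal * S := by
  refine (sq_le_sq₀ (norm_nonneg _) (by positivity)).1 ?_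
  have h := hasSum_norm_sq (creation μ (pauliCoupling c) ψ)
  rw [← hasSum_nat_add_iff' 1] at h
  simp only [Finset.range_one, Finset.sum_singleton, norm_creation_zero, ne_eq,
    OfNat.ofNat_ne_zero, not_false_eq_true, zero_pow, sub_zero] at h
  rw [mul_pow]
  refine hasSum_le (fun ℓ => ?_) h (hS.mul_left _)
  refine (pow_le_pow_left₀ (norm_nonneg _) (norm_creation_succ_le hc hc2 ψ ℓ) 2).trans
    (le_of_eq ?_)
  rw [mul_pow, mul_pow, Real.sq_sqrt (by positivity)]
  ring

/-- The factor √(ℓ + 1) is moved from the created component onto ψ, so that the Cauchy-Schwarz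
inequality over sectors leaves only the norm of φ. Being linear in ‖φ‖, the bound controls the
adjoint at ψ. -/
theorem norm_inner_creation_le {c : Momentum → ℝ} (hc : Measurable c) (hc2 : MemLp c 2 μ) {S : ℝ}
    (hS0 : 0 ≤ S) {ψ : Fock μ} (hS : HasSum (fun ℓ : ℕ => (ℓ + 1 : ℝ) * ‖ψ ℓ‖ ^ 2) (S ^ 2))
    (φ : (creation μ (pauliCoupling c)).domain) :
    ‖inner ℂ ψ (creation μ (pauliCoupling c) φ)‖ ≤ (eLpNorm c 2 μ).toReal * S * ‖(φ : Fock μ)‖ := by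
  set γ := (eLpNorm c 2 μ).toReal
  have hγ : 0 ≤ γ := ENNReal.toReal_nonneg
  have h := lp.hasSum_inner (𝕜 := ℂ) (G := fun ℓ => Sector μ ℓ) ψ (creation μ (pauliCoupling c) φ)
  have hz : inner ℂ (ψ 0) (creation μ (pauliCoupling c) φ 0) = 0 := by
    rw [norm_eq_zero.1 (norm_creation_zero φ), inner_zero_right]
  rw [← hasSum_nat_add_iff' 1] at h
  simp only [Finset.range_one, Finset.sum_singleton, hz, sub_zero] at h
  -- The component with ℓ + 1 photons has weight ℓ + 2 in S², so the weight ℓ + 1 needed here is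
  -- dominated.
  have hS1 : Summable fun ℓ : ℕ => ((ℓ : ℝ) + 1) * ‖ψ (ℓ + 1)‖ ^ 2 := by
    refine Summable.of_nonneg_of_le (fun ℓ => by positivity) (fun ℓ => ?_)
      ((summable_nat_add_iff 1).2 hS.summable)
    push_cast
    nlinarith [sq_nonneg ‖ψ (ℓ + 1)‖]
  have hS2 : ∑' ℓ : ℕ, ((ℓ : ℝ) + 1) * ‖ψ (ℓ + 1)‖ ^ 2 ≤ S ^ 2 := by
    have h0 := hS.summable.sum_add_tsum_nat_add 1
    rw [hS.tsum_eq] at h0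
    have h1 : ∑' ℓ : ℕ, ((ℓ : ℝ) + 1) * ‖ψ (ℓ + 1)‖ ^ 2 ≤
        ∑' ℓ : ℕ, (((ℓ + 1 : ℕ) : ℝ) + 1) * ‖ψ (ℓ + 1)‖ ^ 2 := by
      refine Summable.tsum_le_tsum (fun ℓ => ?_) hS1 ((summable_nat_add_iff 1).2 hS.summable)
      push_cast
      nlinarith [sq_nonneg ‖ψ (ℓ + 1)‖]
    have h2 : 0 ≤ ∑ ℓ ∈ Finset.range 1, ((ℓ : ℝ) + 1) * ‖ψ ℓ‖ ^ 2 :=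
      Finset.sum_nonneg fun ℓ _ => by positivity
    linarith
  have hf : ∀ ℓ : ℕ, (Real.sqrt (ℓ + 1) * ‖ψ (ℓ + 1)‖) ^ (2 : ℝ) =
      ((ℓ : ℝ) + 1) * ‖ψ (ℓ + 1)‖ ^ 2 := fun ℓ => by
    rw [Real.rpow_two, mul_pow, Real.sq_sqrt (by positivity)]
  have hφ := hasSum_norm_sq (φ : Fock μ)
  obtain ⟨hs, hle⟩ := Real.summable_and_inner_le_Lp_mul_Lq_tsum_of_nonneg
    (f := fun ℓ : ℕ => Real.sqrt (ℓ + 1) * ‖ψ (ℓ + 1)‖) (g := fun ℓ => ‖(φ : Fock μ) ℓ‖)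
    Real.HolderConjugate.two_two (fun ℓ => by positivity) (fun ℓ => norm_nonneg _)
    (by simpa only [hf] using hS1) (by simpa only [Real.rpow_two] using hφ.summable)
  simp only [hf, Real.rpow_two, hφ.tsum_eq] at hle
  rw [← Real.sqrt_eq_rpow, ← Real.sqrt_eq_rpow, Real.sqrt_sq (norm_nonneg _)] at hle
  have hle2 : Real.sqrt (∑' ℓ : ℕ, ((ℓ : ℝ) + 1) * ‖ψ (ℓ + 1)‖ ^ 2) ≤ S :=
    Real.sqrt_le_iff.2 ⟨hS0, hS2⟩
  have hb : ∀ ℓ, ‖inner ℂ (ψ (ℓ + 1)) (creation μ (pauliCoupling c) φ (ℓ + 1))‖ ≤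
      γ * (Real.sqrt (ℓ + 1) * ‖ψ (ℓ + 1)‖ * ‖(φ : Fock μ) ℓ‖) := by
    intro ℓ
    refine (norm_inner_le_norm (𝕜 := ℂ) (E := Sector μ (ℓ + 1)) _ _).trans ?_
    refine (mul_le_mul_of_nonneg_left (norm_creation_succ_le hc hc2 φ ℓ)
      (norm_nonneg _)).trans (le_of_eq ?_)
    ring
  rw [← h.tsum_eq]
  refine (tsum_of_norm_bounded (hs.mul_left γ).hasSum hb).trans ?_
  rw [tsum_mul_left, mul_assoc]
  refine mul_le_mul_of_nonneg_left (hle.trans ?_) hγ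
  gcongr

theorem mem_annihilation_domain {c : Momentum → ℝ} (hc : Measurable c) (hc2 : MemLp c 2 μ) {S : ℝ}
    (hS0 : 0 ≤ S) {ψ : Fock μ} (hS : HasSum (fun ℓ : ℕ => (ℓ + 1 : ℝ) * ‖ψ ℓ‖ ^ 2) (S ^ 2)) :
    ψ ∈ (annihilation μ (pauliCoupling c)).domain := by
  refine (LinearPMap.mem_adjoint_domain_iff _ _).2 ?_
  exact AddMonoidHomClass.continuous_of_bound
    ((innerₛₗ ℂ ψ).comp (creation μ (pauliCoupling c)).toFun) ((eLpNorm c 2 μ).toReal * S)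
    fun φ => norm_inner_creation_le hc hc2 hS0 hS φ

/-- The bound on ⟨η, φ⟩, known for φ in the dense domain of the creation operator, extends to all φ
by continuity and is then used at φ = η. -/
theorem norm_annihilation_le {c : Momentum → ℝ} (hc : Measurable c) (hc2 : MemLp c 2 μ)
    (hd : Dense ((creation μ (pauliCoupling c)).domain : Set (Fock μ))) {S : ℝ} (hS0 : 0 ≤ S)
    (ψ : (annihilation μ (pauliCoupling c)).domain)
    (hS : HasSum (fun ℓ : ℕ => (ℓ + 1 : ℝ) * ‖(ψ : Fock μ) ℓ‖ ^ 2) (S ^ 2)) :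
    ‖annihilation μ (pauliCoupling c) ψ‖ ≤ (eLpNorm c 2 μ).toReal * S := by
  set η := annihilation μ (pauliCoupling c) ψ with hη
  set K := (eLpNorm c 2 μ).toReal * S
  have h1 : ∀ φ ∈ (creation μ (pauliCoupling c)).domain, ‖inner ℂ η φ‖ ≤ K * ‖φ‖ := by
    intro φ hφ
    have h := LinearPMap.adjoint_isFormalAdjoint hd ψ ⟨φ, hφ⟩
    change inner ℂ η φ = _ at h
    rw [h]
    exact norm_inner_creation_le hc hc2 hS0 hS ⟨φ, hφ⟩
  have hcl : IsClosed {φ : Fock μ | ‖inner ℂ η φ‖ ≤ K * ‖φ‖} :=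
    isClosed_le (by fun_prop) (by fun_prop)
  have h2 : ‖inner ℂ η η‖ ≤ K * ‖η‖ :=
    hcl.closure_subset_iff.2 h1 (hd η)
  have h3 : ‖η‖ ^ 2 ≤ K * ‖η‖ := by
    rw [← inner_self_re_eq]
    exact (Complex.re_le_norm _).trans h2
  rw [sq] at h3
  by_cases h0 : ‖η‖ = 0
  · rw [h0]; positivity
  · exact le_of_mul_le_mul_right h3 (lt_of_le_of_ne (norm_nonneg _) (Ne.symm h0))

end Creation

/-! ### Sums of the form A + (C + C†) + B -/

section AbstractSum

variable {E : Type*} [NormedAddCommGroup E] [InnerProductSpace ℂ E] [CompleteSpace E]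
  {A B C : E →ₗ.[ℂ] E}

theorem add_adjoint_isFormalAdjoint (hA : A.IsFormalAdjoint A) (hB : B.IsFormalAdjoint B)
    (hC : Dense (C.domain : Set E)) :
    (A + (C + C†) + B).IsFormalAdjoint (A + (C + C†) + B) := by
  intro x y
  have h1 := hA ⟨x, x.2.1.1⟩ ⟨y, y.2.1.1⟩
  have h2 := hB ⟨x, x.2.2⟩ ⟨y, y.2.2⟩
  have h3 := LinearPMap.adjoint_isFormalAdjoint hC ⟨x, x.2.1.2.2⟩ ⟨y, y.2.1.2.1⟩
  have h4 := (LinearPMap.adjoint_isFormalAdjoint hC).symm ⟨x, x.2.1.2.1⟩ ⟨y, y.2.1.2.2⟩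
  change inner ℂ (A ⟨x, x.2.1.1⟩ + (C ⟨x, x.2.1.2.1⟩ + C† ⟨x, x.2.1.2.2⟩) + B ⟨x, x.2.2⟩) (y : E) =
    inner ℂ (x : E) (A ⟨y, y.2.1.1⟩ + (C ⟨y, y.2.1.2.1⟩ + C† ⟨y, y.2.1.2.2⟩) + B ⟨y, y.2.2⟩)
  simp only [inner_add_left, inner_add_right]
  rw [h1, h2, h3, h4]
  ring

/-- C and C† contribute complex conjugate numbers, so only the creation operator has to be evaluated
in the form. -/
theorem add_adjoint_form (hC : Dense (C.domain : Set E)) (x : (A + (C + C†) + B).domain) :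
    (inner ℂ (x : E) ((A + (C + C†) + B) x)).re =
      (inner ℂ (x : E) (A ⟨x, x.2.1.1⟩)).re + (inner ℂ (x : E) (B ⟨x, x.2.2⟩)).re +
      2 * (inner ℂ (x : E) (C ⟨x, x.2.1.2.1⟩)).re := by
  have h3 := LinearPMap.adjoint_isFormalAdjoint hC ⟨x, x.2.1.2.2⟩ ⟨x, x.2.1.2.1⟩
  have h4 : (inner ℂ (x : E) (C† ⟨x, x.2.1.2.2⟩)).re =
      (inner ℂ (x : E) (C ⟨x, x.2.1.2.1⟩)).re := by
    rw [← inner_conj_symm, Complex.conj_re]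
    exact congrArg Complex.re h3
  change (inner ℂ (x : E)
    (A ⟨x, x.2.1.1⟩ + (C ⟨x, x.2.1.2.1⟩ + C† ⟨x, x.2.1.2.2⟩) + B ⟨x, x.2.2⟩)).re = _
  simp only [inner_add_right, Complex.add_re, h4]
  ring

theorem isSelfAdjoint_add_adjoint (hA : A.IsFormalAdjoint A) (hB : B.IsFormalAdjoint B)
    (hdom : (A + (C + C†) + B).domain = B.domain) (hC : Dense (C.domain : Set E))
    (hB0 : ∀ x : B.domain, 0 ≤ (inner ℂ (x : E) (B x)).re)
    (hsurj : ∀ l : ℝ, 0 < l → ∀ y : E, ∃ x : B.domain, B x + (l : ℂ) • (x : E) = y)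
    {a b : ℝ} (ha : 0 ≤ a) (ha1 : a < 1) (hb : 0 ≤ b)
    (hab : ∀ (x : E) (hx : x ∈ B.domain) (h1 : x ∈ A.domain) (h2 : x ∈ C.domain)
      (h3 : x ∈ C†.domain),
      ‖A ⟨x, h1⟩‖ + (‖C ⟨x, h2⟩‖ + ‖C† ⟨x, h3⟩‖) ≤ a * ‖B ⟨x, hx⟩‖ + b * ‖x‖) :
    IsSelfAdjoint (A + (C + C†) + B) := by
  refine isSelfAdjoint_of_relatively_bounded hdom hB0 hsurj
    (add_adjoint_isFormalAdjoint hA hB hC) a b ha ha1 hb fun x hx hx' => ?_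
  refine le_trans ?_ (hab x hx hx'.1.1 hx'.1.2.1 hx'.1.2.2)
  change ‖A ⟨x, hx'.1.1⟩ + (C ⟨x, hx'.1.2.1⟩ + C† ⟨x, hx'.1.2.2⟩) + B ⟨x, hx'.2⟩ - B ⟨x, hx⟩‖ ≤ _
  rw [add_sub_cancel_right]
  exact (norm_add_le _ _).trans (add_le_add_right (norm_add_le _ _) _)

end AbstractSum

/-- The numerical inequality behind the relative boundedness of the field operator. -/
theorem relative_bound_aux {m γ s C S N x a c d : ℝ} (hγ : 0 ≤ γ) (hs : 0 ≤ s) (hN : 0 ≤ N)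
    (hC : 0 ≤ C) (hx : 0 ≤ x) (hS0 : 0 ≤ S) (hγs : 2 * γ * s ≤ 1 / 2)
    (hle : S ^ 2 ≤ s ^ 2 * N ^ 2 + C ^ 2 * x ^ 2) (ha : a ≤ m * x) (hc : c ≤ γ * S)
    (hd : d ≤ γ * S) : a + (c + d) ≤ 1 / 2 * N + (m + 2 * γ * C) * x := by
  have h4 : S ≤ s * N + C * x := by
    refine (sq_le_sq₀ hS0 (by positivity)).1 ?_
    have : 0 ≤ s * N * (C * x) := by positivity
    nlinarith
  have h5 : γ * S ≤ γ * (s * N + C * x) := mul_le_mul_of_nonneg_left h4 hγ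
  have h6 : 2 * γ * s * N ≤ 1 / 2 * N := mul_le_mul_of_nonneg_right hγs hN
  nlinarith

/-! ### Self-adjointness of the spin-boson Hamiltonian -/

section Hamiltonian

variable {μ : Measure Momentum} [SigmaFinite μ]

/-- The spin-boson Hamiltonian with coupling function `c σ₁` and photon dispersion relation `w`. -/
def spinBoson (μ : Measure Momentum) [SigmaFinite μ] (c w : Momentum → ℝ) :
    Fock μ →ₗ.[ℂ] Fock μ :=
  atomOp μ atomMatrix + field μ (pauliCoupling c) + photonEnergy μ w

/-- Here S is the norm of (N + 1)^{1/2} ψ, with N the photon number. Since ℓ is at most t (rℓ)² + 1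
/ (4 t r²) and rℓ is bounded by the energy, S is relatively bounded by the photon energy with
arbitrarily small constant √t. -/
theorem exists_number_bound {w : Momentum → ℝ} {r : ℝ} (hr0 : 0 < r) (hr : ∀ᵐ k ∂μ, r ≤ w k)
    {t : ℝ} (ht : 0 < t) (ψ : (photonEnergy μ w).domain) :
    ∃ S : ℝ, 0 ≤ S ∧ HasSum (fun ℓ : ℕ => (ℓ + 1 : ℝ) * ‖(ψ : Fock μ) ℓ‖ ^ 2) (S ^ 2) ∧
      S ^ 2 ≤ t * ‖photonEnergy μ w ψ‖ ^ 2 + (1 + 1 / (4 * t * r ^ 2)) * ‖(ψ : Fock μ)‖ ^ 2 := by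
  have hb := ((hasSum_norm_sq (photonEnergy μ w ψ)).mul_left t).add
    ((hasSum_norm_sq (ψ : Fock μ)).mul_left (1 + 1 / (4 * t * r ^ 2)))
  have hle : ∀ ℓ : ℕ, (ℓ + 1 : ℝ) * ‖(ψ : Fock μ) ℓ‖ ^ 2 ≤ t * ‖photonEnergy μ w ψ ℓ‖ ^ 2 +
      (1 + 1 / (4 * t * r ^ 2)) * ‖(ψ : Fock μ) ℓ‖ ^ 2 := by
    intro ℓ
    have h1 := pow_le_pow_left₀ (by positivity) (number_le_photonEnergy hr0 hr ψ ℓ) 2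
    have h2 : (ℓ : ℝ) ≤ t * (r * ℓ) ^ 2 + 1 / (4 * t * r ^ 2) := by
      have h3 : 0 < 4 * t * r ^ 2 := by positivity
      have h4 : t * (r * ℓ) ^ 2 + 1 / (4 * t * r ^ 2) - ℓ =
          (2 * t * r ^ 2 * ℓ - 1) ^ 2 / (4 * t * r ^ 2) := by
        field_simp
        ring
      have h5 : 0 ≤ (2 * t * r ^ 2 * ℓ - 1) ^ 2 / (4 * t * r ^ 2) := by positivity
      linarith
    have h6 := mul_le_mul_of_nonneg_right h2 (sq_nonneg ‖(ψ : Fock μ) ℓ‖)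
    have h7 := mul_le_mul_of_nonneg_left h1 ht.le
    rw [mul_pow] at h7
    nlinarith
  have hs : Summable fun ℓ : ℕ => (ℓ + 1 : ℝ) * ‖(ψ : Fock μ) ℓ‖ ^ 2 :=
    Summable.of_nonneg_of_le (fun ℓ => by positivity) hle hb.summable
  have h0 : 0 ≤ ∑' ℓ : ℕ, (ℓ + 1 : ℝ) * ‖(ψ : Fock μ) ℓ‖ ^ 2 := tsum_nonneg fun ℓ => by positivity
  refine ⟨Real.sqrt (∑' ℓ : ℕ, (ℓ + 1 : ℝ) * ‖(ψ : Fock μ) ℓ‖ ^ 2), Real.sqrt_nonneg _, ?_, ?_⟩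
  · rw [Real.sq_sqrt h0]; exact hs.hasSum
  · rw [Real.sq_sqrt h0]; exact hasSum_le hle hs.hasSum hb

theorem photonEnergy_domain_le_creation {c w : Momentum → ℝ} (hc : Measurable c)
    (hc2 : MemLp c 2 μ) {r : ℝ} (hr0 : 0 < r) (hr : ∀ᵐ k ∂μ, r ≤ w k) :
    (photonEnergy μ w).domain ≤ (creation μ (pauliCoupling c)).domain := by
  intro ψ hψ
  obtain ⟨S, -, hS, -⟩ := exists_number_bound hr0 hr one_pos ⟨ψ, hψ⟩
  exact mem_creation_domain hc hc2 hS.summable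

theorem photonEnergy_domain_le_annihilation {c w : Momentum → ℝ} (hc : Measurable c)
    (hc2 : MemLp c 2 μ) {r : ℝ} (hr0 : 0 < r) (hr : ∀ᵐ k ∂μ, r ≤ w k) :
    (photonEnergy μ w).domain ≤ (annihilation μ (pauliCoupling c)).domain := by
  intro ψ hψ
  obtain ⟨S, hS0, hS, -⟩ := exists_number_bound hr0 hr one_pos ⟨ψ, hψ⟩
  exact mem_annihilation_domain hc hc2 hS0 hS

theorem dense_photonEnergy_domain {w : Momentum → ℝ} (hwm : Measurable w) (hw : ∀ k, 0 ≤ w k) :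
    Dense ((photonEnergy μ w).domain : Set (Fock μ)) :=
  dense_domain_of_surjective (photonEnergy_nonneg hw) fun y => by
    simpa using photonEnergy_add_surjective hwm hw one_pos y

theorem spinBoson_domain {c w : Momentum → ℝ} (hc : Measurable c)
    (hc2 : MemLp c 2 μ) {r : ℝ} (hr0 : 0 < r) (hr : ∀ᵐ k ∂μ, r ≤ w k) :
    (spinBoson μ c w).domain = (photonEnergy μ w).domain := by
  refine le_antisymm (fun ψ hψ => hψ.2) fun ψ hψ => ⟨⟨?_, ?_, ?_⟩, hψ⟩
  · rw [atomOp_domain]; trivial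
  · exact photonEnergy_domain_le_creation hc hc2 hr0 hr hψ
  · exact photonEnergy_domain_le_annihilation hc hc2 hr0 hr hψ

theorem atomMatrix_isHermitian : atomMatrix.IsHermitian := by
  ext i j
  fin_cases i <;> fin_cases j <;> simp [atomMatrix]

theorem isSelfAdjoint_spinBoson {c w : Momentum → ℝ} (hc : Measurable c) (hc2 : MemLp c 2 μ)
    (hwm : Measurable w) (hw : ∀ k, 0 ≤ w k) {r : ℝ} (hr0 : 0 < r) (hr : ∀ᵐ k ∂μ, r ≤ w k) :
    IsSelfAdjoint (spinBoson μ c w) := by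
  have hd : Dense ((creation μ (pauliCoupling c)).domain : Set (Fock μ)) :=
    (dense_photonEnergy_domain hwm hw).mono (photonEnergy_domain_le_creation hc hc2 hr0 hr)
  set γ := (eLpNorm c 2 μ).toReal with hγ
  have hγ0 : 0 ≤ γ := ENNReal.toReal_nonneg
  set m := ‖Matrix.toEuclideanCLM (𝕜 := ℂ) atomMatrix‖
  have hm0 : 0 ≤ m := norm_nonneg _
  -- Creation and annihilation each cost at most γ S, and S ≤ s ‖photon energy‖ + C ‖ψ‖ for t = s².
  -- This s makes the total relative bound 2 γ s at most 1/2.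
  set s := 1 / (4 * (γ + 1)) with hs
  have hs0 : 0 < s := by positivity
  have hγs : 2 * γ * s ≤ 1 / 2 := by
    rw [hs]
    field_simp
    linarith
  set C := Real.sqrt (1 + 1 / (4 * s ^ 2 * r ^ 2)) with hC
  have hC0 : 0 ≤ C := Real.sqrt_nonneg _
  have hC2 : C ^ 2 = 1 + 1 / (4 * s ^ 2 * r ^ 2) := Real.sq_sqrt (by positivity)
  refine isSelfAdjoint_add_adjoint (atomOp_isFormalAdjoint atomMatrix_isHermitian)
    (photonEnergy_isFormalAdjoint w) (spinBoson_domain hc hc2 hr0 hr) hd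
    (photonEnergy_nonneg hw) (fun l hl y => photonEnergy_add_surjective hwm hw hl y)
    (a := 1 / 2) (b := m + 2 * γ * C) (by norm_num) (by norm_num)
    (by positivity) fun ψ hψ h1 h2 h3 => ?_
  obtain ⟨S, hS0, hS, hle⟩ := exists_number_bound hr0 hr (pow_pos hs0 2) ⟨ψ, hψ⟩
  rw [← hC2] at hle
  exact relative_bound_aux hγ0 hs0.le (norm_nonneg _) hC0 (norm_nonneg _) hS0 hγs hle
    (norm_atomOp_le ⟨ψ, h1⟩) (norm_creation_le hc hc2 hS0 ⟨ψ, h2⟩ hS)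
    (norm_annihilation_le hc hc2 hd hS0 ⟨ψ, h3⟩ hS)

theorem mem_domains_of_mem_spinBoson_domain {c w : Momentum → ℝ} {ψ : Fock μ}
    (h : ψ ∈ (spinBoson μ c w).domain) : ψ ∈ (atomOp μ atomMatrix).domain ∧
      ψ ∈ (creation μ (pauliCoupling c)).domain ∧ ψ ∈ (photonEnergy μ w).domain :=
  ⟨h.1.1, h.1.2.1, h.2⟩

theorem spinBoson_form {c w : Momentum → ℝ}
    (hd : Dense ((creation μ (pauliCoupling c)).domain : Set (Fock μ))) {ψ : Fock μ}
    (h : ψ ∈ (spinBoson μ c w).domain) (h1 : ψ ∈ (atomOp μ atomMatrix).domain)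
    (h2 : ψ ∈ (creation μ (pauliCoupling c)).domain) (h3 : ψ ∈ (photonEnergy μ w).domain) :
    (inner ℂ ψ (spinBoson μ c w ⟨ψ, h⟩)).re =
      (inner ℂ ψ (atomOp μ atomMatrix ⟨ψ, h1⟩)).re +
      (inner ℂ ψ (photonEnergy μ w ⟨ψ, h3⟩)).re +
      2 * (inner ℂ ψ (creation μ (pauliCoupling c) ⟨ψ, h2⟩)).re :=
  add_adjoint_form hd ⟨ψ, h⟩

end Hamiltonian

/-! ### The interaction form between consecutive photon numbers -/

section Interaction

variable {μ : Measure Momentum} [SigmaFinite μ]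

/-- The integrand of the interaction between the `ℓ`-photon and the `(ℓ + 1)`-photon component. -/
def interactionDensity (c : Momentum → ℝ) {ℓ : ℕ} (u : (Fin ℓ → Momentum) → Atom)
    (v : (Fin (ℓ + 1) → Momentum) → Atom) (z : Momentum × (Fin ℓ → Momentum)) : ℝ :=
  c z.1 * (inner ℂ (v (Fin.cons z.1 z.2)) (pauliCLM (u z.2))).re

/-- The interaction between the `ℓ`-photon and the `(ℓ + 1)`-photon component. -/
def interaction (μ : Measure Momentum) [SigmaFinite μ] (c : Momentum → ℝ) {ℓ : ℕ}
    (u : (Fin ℓ → Momentum) → Atom) (v : (Fin (ℓ + 1) → Momentum) → Atom) : ℝ :=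
  Real.sqrt (ℓ + 1) * ∫ z, interactionDensity c u v z ∂μ.prod (tupleMeasure μ ℓ)

theorem measurable_cons (ℓ : ℕ) :
    Measurable fun z : Momentum × (Fin ℓ → Momentum) =>
      (Fin.cons z.1 z.2 : Fin (ℓ + 1) → Momentum) :=
  measurable_pi_iff.2 fun i => by
    refine Fin.cases ?_ (fun j => ?_) i
    · simpa using measurable_fst
    · simpa [Function.comp_def] using (measurable_pi_apply j).comp measurable_snd

theorem measurable_interactionDensity {c : Momentum → ℝ} (hc : Measurable c) {ℓ : ℕ}
    {u : (Fin ℓ → Momentum) → Atom} (hu : Measurable u) {v : (Fin (ℓ + 1) → Momentum) → Atom}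
    (hv : Measurable v) : Measurable (interactionDensity c u v) := by
  have h1 := hv.comp (measurable_cons ℓ)
  have h2 : Measurable fun z : Momentum × (Fin ℓ → Momentum) => pauliCLM (u z.2) :=
    pauliCLM.measurable.comp (hu.comp measurable_snd)
  exact (hc.comp measurable_fst).mul (Complex.measurable_re.comp (h1.inner h2))

theorem abs_interactionDensity_le (c : Momentum → ℝ) {ℓ : ℕ} (u : (Fin ℓ → Momentum) → Atom)
    (v : (Fin (ℓ + 1) → Momentum) → Atom) (z : Momentum × (Fin ℓ → Momentum)) :
    |interactionDensity c u v z| ≤ |c z.1| * (‖v (Fin.cons z.1 z.2)‖ * ‖u z.2‖) := by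
  rw [interactionDensity, abs_mul, ← norm_pauliCLM (u z.2)]
  gcongr
  exact (Complex.abs_re_le_norm _).trans (norm_inner_le_norm _ _)

theorem integrable_interactionDensity {c : Momentum → ℝ} (hc : Measurable c)
    (hc2 : Integrable (fun k => c k ^ 2) μ) {ℓ : ℕ}
    {u : (Fin ℓ → Momentum) → Atom} (hu : Measurable u) {v : (Fin (ℓ + 1) → Momentum) → Atom}
    (hv : Measurable v) (hu2 : Integrable (fun k => ‖u k‖ ^ 2) (tupleMeasure μ ℓ))
    (hv2 : Integrable (fun k => ‖v k‖ ^ 2) (tupleMeasure μ (ℓ + 1))) :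
    Integrable (interactionDensity c u v) (μ.prod (tupleMeasure μ ℓ)) := by
  have h1 : Integrable (fun z : Momentum × (Fin ℓ → Momentum) => ‖v (Fin.cons z.1 z.2)‖ ^ 2)
      (μ.prod (tupleMeasure μ ℓ)) :=
    (measurePreserving_cons (μ := μ) ℓ).integrable_comp_of_integrable hv2
  have h2 := hc2.mul_prod hu2
  refine (h1.add h2).mono' (measurable_interactionDensity hc hu hv).aestronglyMeasurable ?_
  filter_upwards with z
  rw [Real.norm_eq_abs]
  refine (abs_interactionDensity_le c u v z).trans ?_
  simp only [Pi.add_apply]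
  have e : c z.1 ^ 2 = |c z.1| ^ 2 := (sq_abs _).symm
  rw [e]
  nlinarith [sq_nonneg (|c z.1| * ‖u z.2‖ - ‖v (Fin.cons z.1 z.2)‖),
    sq_nonneg (|c z.1| * ‖u z.2‖), sq_nonneg ‖v (Fin.cons z.1 z.2)‖]

/-- Inserting a momentum at any place is, up to a permutation, the same as prepending it. -/
theorem exists_perm_cons {ℓ : ℕ} (i : Fin (ℓ + 1)) : ∃ s : Equiv.Perm (Fin (ℓ + 1)),
    ∀ k : Fin (ℓ + 1) → Momentum, k ∘ s = Fin.cons (k i) (k ∘ i.succAbove) := by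
  refine ⟨i.cycleRange.symm, fun k => ?_⟩
  funext j
  refine Fin.cases ?_ (fun j => ?_) j
  · simp
  · simp

/-- By symmetry the ℓ + 1 summands of the creation operator have the same integral, so the prefactor
becomes (ℓ + 1) / √(ℓ + 1) = √(ℓ + 1), and the created photon may be taken first. -/
theorem hasSum_creation_form {c : Momentum → ℝ} (hc : Measurable c)
    (hc2 : Integrable (fun k => c k ^ 2) μ) (ψ : (creation μ (pauliCoupling c)).domain)
    {u : ∀ ℓ : ℕ, (Fin ℓ → Momentum) → Atom} (hum : ∀ ℓ, Measurable (u ℓ))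
    (hus : ∀ ℓ (s : Equiv.Perm (Fin ℓ)) k, u ℓ (k ∘ s) = u ℓ k)
    (hu : ∀ ℓ, u ℓ =ᵐ[tupleMeasure μ ℓ] comp (ψ : Fock μ) ℓ) :
    HasSum (fun ℓ => interaction μ c (u ℓ) (u (ℓ + 1)))
      (inner ℂ (ψ : Fock μ) (creation μ (pauliCoupling c) ψ)).re := by
  have hu2 : ∀ ℓ, Integrable (fun k => ‖u ℓ k‖ ^ 2) (tupleMeasure μ ℓ) := fun ℓ =>
    (memLp_two_iff_integrable_sq_norm (hum ℓ).aestronglyMeasurable).1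
      ((memLp_congr_ae (hu ℓ)).2 (memLp_comp _ _))
  have h := Complex.hasSum_re (hasSum_integral_inner (ψ : Fock μ) (creation μ (pauliCoupling c) ψ))
  have h0 : ∫ k, inner ℂ (comp (ψ : Fock μ) 0 k) (comp (creation μ (pauliCoupling c) ψ) 0 k)
      ∂tupleMeasure μ 0 = 0 := by
    rw [← integral_zero (Fin 0 → Momentum) ℂ (μ := tupleMeasure μ 0)]
    refine integral_congr_ae ?_
    filter_upwards [comp_creation ψ 0] with k hk
    rw [hk]
    exact inner_zero_right _
  rw [← hasSum_nat_add_iff' 1] at h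
  simp only [Finset.range_one, Finset.sum_singleton, h0, Complex.zero_re, sub_zero] at h
  suffices hf : ∀ ℓ, interaction μ c (u ℓ) (u (ℓ + 1)) =
      (∫ k, inner ℂ (comp (ψ : Fock μ) (ℓ + 1) k)
        (comp (creation μ (pauliCoupling c) ψ) (ℓ + 1) k) ∂tupleMeasure μ (ℓ + 1)).re by
    simpa only [hf] using h
  intro ℓ
  have h3 : ∀ F : (Fin (ℓ + 1) → Momentum) → ℂ, Integrable F (tupleMeasure μ (ℓ + 1)) →
    (∫ k, F k ∂tupleMeasure μ (ℓ + 1)).re = ∫ k, (F k).re ∂tupleMeasure μ (ℓ + 1) := fun F hF =>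
      (integral_re hF).symm
  rw [h3 _ (integrable_inner_comp _ _ _)]
  have hF := integrable_interactionDensity hc hc2 (hum ℓ) (hum (ℓ + 1)) (hu2 ℓ) (hu2 (ℓ + 1))
  have hterm : ∀ i : Fin (ℓ + 1),
      Integrable (fun k : Fin (ℓ + 1) → Momentum =>
        interactionDensity c (u ℓ) (u (ℓ + 1)) (k i, k ∘ i.succAbove)) (tupleMeasure μ (ℓ + 1)) ∧
      ∫ k : Fin (ℓ + 1) → Momentum,
        interactionDensity c (u ℓ) (u (ℓ + 1)) (k i, k ∘ i.succAbove) ∂tupleMeasure μ (ℓ + 1) =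
      ∫ z, interactionDensity c (u ℓ) (u (ℓ + 1)) z ∂μ.prod (tupleMeasure μ ℓ) := by
    intro i
    refine ⟨(measurePreserving_succAbove i).integrable_comp_of_integrable hF, ?_⟩
    exact (measurePreserving_piFinSuccAbove (fun _ : Fin (ℓ + 1) => μ) i).integral_comp'
      (interactionDensity c (u ℓ) (u (ℓ + 1)))
  have hae : ∀ᵐ k ∂tupleMeasure μ (ℓ + 1), ∀ i : Fin (ℓ + 1),
      u ℓ (k ∘ i.succAbove) = comp (ψ : Fock μ) ℓ (k ∘ i.succAbove) :=
    ae_all_iff.2 fun i => (quasiMeasurePreserving_erase μ i).ae (hu ℓ)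
  have hcongr : ∀ᵐ k ∂tupleMeasure μ (ℓ + 1),
      (inner ℂ (comp (ψ : Fock μ) (ℓ + 1) k)
        (comp (creation μ (pauliCoupling c) ψ) (ℓ + 1) k)).re =
      (Real.sqrt (ℓ + 1))⁻¹ * ∑ i : Fin (ℓ + 1),
        interactionDensity c (u ℓ) (u (ℓ + 1)) (k i, k ∘ i.succAbove) := by
    filter_upwards [comp_creation ψ (ℓ + 1), hu (ℓ + 1), hae] with k h1 h2 h3
    rw [h1, ← h2, creationComp, inner_smul_right, Complex.re_ofReal_mul, inner_sum,
      Complex.re_sum]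
    congr 1
    refine Finset.sum_congr rfl fun i _ => ?_
    obtain ⟨s, hs⟩ := exists_perm_cons i
    rw [interactionDensity, pauliCoupling_apply, inner_smul_right, Complex.re_ofReal_mul, ← h3 i,
      ← hs k, hus]
  rw [integral_congr_ae hcongr, integral_const_mul, integral_finsetSum _ fun i _ => (hterm i).1]
  simp only [(hterm _).2, Finset.sum_const, Finset.card_univ, Fintype.card_fin, nsmul_eq_mul]
  rw [← mul_assoc, interaction]
  congr 1
  push_cast
  rw [inv_mul_eq_div, Real.div_sqrt]

end Interaction

/-! ### The quadratic form on states with finitely many photons -/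

section PartialForm

variable {μ : Measure Momentum} [SigmaFinite μ]

/-- A family of measurable, permutation invariant, square-integrable functions of finitely many
momenta, each of finite energy. -/
structure IsFiniteEnergy (μ : Measure Momentum) [SigmaFinite μ] (w : Momentum → ℝ)
    (u : ∀ ℓ : ℕ, (Fin ℓ → Momentum) → Atom) : Prop where
  measurable : ∀ ℓ, Measurable (u ℓ)
  perm : ∀ ℓ (s : Equiv.Perm (Fin ℓ)) k, u ℓ (k ∘ s) = u ℓ k
  integrable_sq : ∀ ℓ, Integrable (fun k => ‖u ℓ k‖ ^ 2) (tupleMeasure μ ℓ)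
  integrable_energy_sq : ∀ ℓ,
    Integrable (fun k => tupleEnergy w k ^ 2 * ‖u ℓ k‖ ^ 2) (tupleMeasure μ ℓ)

/-- The quadratic form of the Hamiltonian of the isolated atom. -/
def atomForm (v : Atom) : ℝ := (inner ℂ v (Matrix.toEuclideanCLM (𝕜 := ℂ) atomMatrix v)).re

theorem atomForm_eq (v : Atom) : atomForm v = 2 * ‖v 0‖ ^ 2 := by
  have h0 : Matrix.toEuclideanCLM (𝕜 := ℂ) atomMatrix v 0 = 2 * v 0 := by
    simp [atomMatrix, Matrix.vecHead]
  have h1 : Matrix.toEuclideanCLM (𝕜 := ℂ) atomMatrix v 1 = 0 := by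
    simp [atomMatrix]
  rw [atomForm, PiLp.inner_apply, Fin.sum_univ_two, h0, h1, inner_zero_right, add_zero]
  have : inner ℂ (v 0) (2 * v 0) = (2 : ℂ) * inner ℂ (v 0) (v 0) := inner_smul_right _ _ _
  rw [this, ← Complex.ofReal_ofNat, Complex.re_ofReal_mul, inner_self_re_eq]

theorem atomForm_nonneg (v : Atom) : 0 ≤ atomForm v := by
  rw [atomForm_eq]; positivity

theorem atomForm_le (v : Atom) : atomForm v ≤ 2 * ‖v‖ ^ 2 := by
  rw [atomForm_eq, EuclideanSpace.norm_sq_eq, Fin.sum_univ_two]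
  nlinarith [sq_nonneg ‖v 1‖]

theorem measurable_atomForm : Measurable atomForm :=
  Complex.measurable_re.comp
    (measurable_id.inner (Matrix.toEuclideanCLM (𝕜 := ℂ) atomMatrix).measurable)

/-- The density of the energy, reduced by `e`, of the atom and `ℓ` free photons. -/
def energyDensity (w : Momentum → ℝ) (e : ℝ) {ℓ : ℕ} (u : (Fin ℓ → Momentum) → Atom)
    (k : Fin ℓ → Momentum) : ℝ :=
  atomForm (u k) + (tupleEnergy w k - e) * ‖u k‖ ^ 2

namespace IsFiniteEnergy

variable {w : Momentum → ℝ} {u : ∀ ℓ : ℕ, (Fin ℓ → Momentum) → Atom}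

theorem integrable_energy (hu : IsFiniteEnergy μ w u) (hw : Measurable w) (ℓ : ℕ) :
    Integrable (fun k => tupleEnergy w k * ‖u ℓ k‖ ^ 2) (tupleMeasure μ ℓ) := by
  refine ((hu.integrable_sq ℓ).add (hu.integrable_energy_sq ℓ)).mono'
    ((measurable_tupleEnergy hw ℓ).mul
      ((hu.measurable ℓ).norm.pow_const 2)).aestronglyMeasurable ?_
  filter_upwards with k
  rw [norm_mul, Real.norm_eq_abs, Real.norm_of_nonneg (sq_nonneg _)]
  simp only [Pi.add_apply]
  have h : |tupleEnergy w k| ≤ 1 + tupleEnergy w k ^ 2 := by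
    rw [← sq_abs]; nlinarith [sq_nonneg (|tupleEnergy w k| - 1), sq_nonneg |tupleEnergy w k|]
  nlinarith [mul_le_mul_of_nonneg_right h (sq_nonneg ‖u ℓ k‖)]

theorem integrable_atomForm (hu : IsFiniteEnergy μ w u) (ℓ : ℕ) :
    Integrable (fun k => atomForm (u ℓ k)) (tupleMeasure μ ℓ) := by
  refine ((hu.integrable_sq ℓ).const_mul 2).mono'
    (measurable_atomForm.comp (hu.measurable ℓ)).aestronglyMeasurable ?_
  filter_upwards with k
  rw [Real.norm_of_nonneg (atomForm_nonneg _)]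
  exact atomForm_le _

theorem integrable_energyDensity (hu : IsFiniteEnergy μ w u) (hw : Measurable w) (e : ℝ) (ℓ : ℕ) :
    Integrable (energyDensity w e (u ℓ)) (tupleMeasure μ ℓ) := by
  refine ((hu.integrable_atomForm ℓ).add ((hu.integrable_energy hw ℓ).sub
    ((hu.integrable_sq ℓ).const_mul e))).congr (Filter.Eventually.of_forall fun k => ?_)
  simp only [Pi.add_apply, Pi.sub_apply, energyDensity]
  ring

theorem integral_energyDensity (hu : IsFiniteEnergy μ w u) (hw : Measurable w) (e : ℝ) (ℓ : ℕ) :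
    ∫ k, energyDensity w e (u ℓ) k ∂tupleMeasure μ ℓ =
      ∫ k, atomForm (u ℓ k) ∂tupleMeasure μ ℓ +
        (∫ k, tupleEnergy w k * ‖u ℓ k‖ ^ 2 ∂tupleMeasure μ ℓ -
          e * ∫ k, ‖u ℓ k‖ ^ 2 ∂tupleMeasure μ ℓ) := by
  have hi : Integrable (fun k => tupleEnergy w k * ‖u ℓ k‖ ^ 2 - e * ‖u ℓ k‖ ^ 2)
      (tupleMeasure μ ℓ) := (hu.integrable_energy hw ℓ).sub ((hu.integrable_sq ℓ).const_mul e)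
  rw [← integral_const_mul, ← integral_sub (hu.integrable_energy hw ℓ)
    ((hu.integrable_sq ℓ).const_mul e), ← integral_add (hu.integrable_atomForm ℓ) hi]
  refine integral_congr_ae (Filter.Eventually.of_forall fun k => ?_)
  simp only [energyDensity]
  ring

theorem integrable_interaction (hu : IsFiniteEnergy μ w u) {c : Momentum → ℝ} (hc : Measurable c)
    (hc2 : Integrable (fun k => c k ^ 2) μ) (ℓ : ℕ) :
    Integrable (interactionDensity c (u ℓ) (u (ℓ + 1))) (μ.prod (tupleMeasure μ ℓ)) :=
  integrable_interactionDensity hc hc2 (hu.measurable ℓ) (hu.measurable (ℓ + 1))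
    (hu.integrable_sq ℓ) (hu.integrable_sq (ℓ + 1))

end IsFiniteEnergy

/-- The quadratic form of the spin-boson Hamiltonian, reduced by `e`, on states with at most `L`
photons. -/
def partialForm (μ : Measure Momentum) [SigmaFinite μ] (c w : Momentum → ℝ) (e : ℝ)
    (u : ∀ ℓ : ℕ, (Fin ℓ → Momentum) → Atom) (L : ℕ) : ℝ :=
  ∑ ℓ ∈ Finset.range (L + 1), ∫ k, energyDensity w e (u ℓ) k ∂tupleMeasure μ ℓ +
    2 * ∑ ℓ ∈ Finset.range L, interaction μ c (u ℓ) (u (ℓ + 1))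

/-- The number `e` is a lower bound of the quadratic form on states with finitely many photons. -/
def IsFormBound (μ : Measure Momentum) [SigmaFinite μ] (c w : Momentum → ℝ) (e : ℝ) : Prop :=
  ∀ u, IsFiniteEnergy μ w u → ∀ L, 0 ≤ partialForm μ c w e u L

/-- Square integrability of energy times component, rather than mere form finiteness, is what
membership in the operator domain gives in each sector; it is also what puts truncated families back
into that domain. -/
theorem isFiniteEnergy_of_mem_domain {w : Momentum → ℝ} (ψ : (photonEnergy μ w).domain)
    {u : ∀ ℓ : ℕ, (Fin ℓ → Momentum) → Atom} (hum : ∀ ℓ, Measurable (u ℓ))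
    (hus : ∀ ℓ (s : Equiv.Perm (Fin ℓ)) k, u ℓ (k ∘ s) = u ℓ k)
    (hu : ∀ ℓ, u ℓ =ᵐ[tupleMeasure μ ℓ] comp (ψ : Fock μ) ℓ) : IsFiniteEnergy μ w u where
  measurable := hum
  perm := hus
  integrable_sq ℓ := (memLp_two_iff_integrable_sq_norm (hum ℓ).aestronglyMeasurable).1
    ((memLp_congr_ae (hu ℓ)).2 (memLp_comp _ _))
  integrable_energy_sq ℓ := by
    have h := (memLp_two_iff_integrable_sq_norm (memLp_comp (photonEnergy μ w ψ) ℓ).1).1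
      (memLp_comp (photonEnergy μ w ψ) ℓ)
    refine h.congr ?_
    filter_upwards [comp_photonEnergy ψ ℓ, hu ℓ] with k h1 h2
    rw [h1, h2, norm_smul, mul_pow, Complex.norm_real, Real.norm_eq_abs, sq_abs]

theorem hasSum_of_eq {f g : ℕ → ℝ} {a : ℝ} (hg : HasSum g a) (h : ∀ n, f n = g n) :
    HasSum f a := by
  rwa [funext h]

theorem hasSum_energy {w : Momentum → ℝ} (hw : Measurable w) (e : ℝ) (ψ : Fock μ)
    (hψ : ψ ∈ (photonEnergy μ w).domain) (hψ' : ψ ∈ (atomOp μ atomMatrix).domain)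
    {u : ∀ ℓ : ℕ, (Fin ℓ → Momentum) → Atom} (hum : ∀ ℓ, Measurable (u ℓ))
    (hus : ∀ ℓ (s : Equiv.Perm (Fin ℓ)) k, u ℓ (k ∘ s) = u ℓ k)
    (hu : ∀ ℓ, u ℓ =ᵐ[tupleMeasure μ ℓ] comp ψ ℓ) :
    HasSum (fun ℓ => ∫ k, energyDensity w e (u ℓ) k ∂tupleMeasure μ ℓ)
      ((inner ℂ ψ (atomOp μ atomMatrix ⟨ψ, hψ'⟩)).re +
        ((inner ℂ ψ (photonEnergy μ w ⟨ψ, hψ⟩)).re - e * ‖ψ‖ ^ 2)) := by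
  have hfe : IsFiniteEnergy μ w u := isFiniteEnergy_of_mem_domain ⟨ψ, hψ⟩ hum hus hu
  simp only [hfe.integral_energyDensity hw]
  refine HasSum.add ?_ (HasSum.sub ?_ (HasSum.mul_left e ?_))
  · refine hasSum_of_eq (hasSum_atomOp_form ⟨ψ, hψ'⟩) fun ℓ => ?_
    refine integral_congr_ae ?_
    filter_upwards [hu ℓ] with k hk
    rw [hk, atomForm]
  · refine hasSum_of_eq (hasSum_photonEnergy_form ⟨ψ, hψ⟩) fun ℓ => ?_
    refine integral_congr_ae ?_
    filter_upwards [hu ℓ] with k hk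
    rw [hk]
  · rw [← inner_self_re_eq]
    refine hasSum_of_eq (Complex.hasSum_re (hasSum_integral_inner ψ ψ)) fun ℓ => ?_
    have h3 : ∀ F : (Fin ℓ → Momentum) → ℂ, Integrable F (tupleMeasure μ ℓ) →
      (∫ k, F k ∂tupleMeasure μ ℓ).re = ∫ k, (F k).re ∂tupleMeasure μ ℓ := fun F hF =>
        (integral_re hF).symm
    rw [h3 _ (integrable_inner_comp _ _ _)]
    refine integral_congr_ae ?_
    filter_upwards [hu ℓ] with k hk
    rw [hk, inner_self_re_eq]

theorem interaction_zero_right (c : Momentum → ℝ) {ℓ : ℕ} (u : (Fin ℓ → Momentum) → Atom) :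
    interaction μ c u 0 = 0 := by
  simp [interaction, interactionDensity]

theorem integral_energyDensity_zero (w : Momentum → ℝ) (e : ℝ) (ℓ : ℕ) :
    ∫ k, energyDensity w e (0 : (Fin ℓ → Momentum) → Atom) k ∂tupleMeasure μ ℓ = 0 := by
  simp [energyDensity, atomForm]

section Equivalence

variable {c w : Momentum → ℝ} {r : ℝ}

theorem dense_creation_domain (hc : Measurable c) (hc2 : MemLp c 2 μ)
    (hwm : Measurable w) (hw : ∀ k, 0 ≤ w k) (hr0 : 0 < r) (hr : ∀ᵐ k ∂μ, r ≤ w k) :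
    Dense ((creation μ (pauliCoupling c)).domain : Set (Fock μ)) :=
  (dense_photonEnergy_domain hwm hw).mono (photonEnergy_domain_le_creation hc hc2 hr0 hr)

theorem hasSum_spinBoson_form (hc : Measurable c) (hc2 : MemLp c 2 μ)
    (hwm : Measurable w) (hw : ∀ k, 0 ≤ w k) (hr0 : 0 < r) (hr : ∀ᵐ k ∂μ, r ≤ w k)
    {ψ : Fock μ} (hψ : ψ ∈ (spinBoson μ c w).domain)
    {u : ∀ ℓ : ℕ, (Fin ℓ → Momentum) → Atom} (hum : ∀ ℓ, Measurable (u ℓ))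
    (hus : ∀ ℓ (s : Equiv.Perm (Fin ℓ)) k, u ℓ (k ∘ s) = u ℓ k)
    (hu : ∀ ℓ, u ℓ =ᵐ[tupleMeasure μ ℓ] comp ψ ℓ) (e : ℝ) :
    ∃ a b : ℝ, HasSum (fun ℓ => ∫ k, energyDensity w e (u ℓ) k ∂tupleMeasure μ ℓ) a ∧
      HasSum (fun ℓ => interaction μ c (u ℓ) (u (ℓ + 1))) b ∧
      a + 2 * b = (inner ℂ ψ (spinBoson μ c w ⟨ψ, hψ⟩)).re - e * ‖ψ‖ ^ 2 := by
  obtain ⟨h1, h2, h3⟩ := mem_domains_of_mem_spinBoson_domain hψ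
  refine ⟨_, _, hasSum_energy hwm e ψ h3 h1 hum hus hu,
    hasSum_creation_form hc hc2.integrable_sq ⟨ψ, h2⟩ hum hus hu, ?_⟩
  rw [spinBoson_form (dense_creation_domain hc hc2 hwm hw hr0 hr) hψ h1 h2 h3]
  ring

/-- The forms of the truncations of ψ to at most L photons are nonnegative and converge, as partial
sums, to the full form. -/
theorem form_ge_of_isFormBound (hc : Measurable c) (hc2 : MemLp c 2 μ)
    (hwm : Measurable w) (hw : ∀ k, 0 ≤ w k) (hr0 : 0 < r) (hr : ∀ᵐ k ∂μ, r ≤ w k) {e : ℝ}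
    (h : IsFormBound μ c w e) (ψ : (spinBoson μ c w).domain) :
    e * ‖(ψ : Fock μ)‖ ^ 2 ≤ (inner ℂ (ψ : Fock μ) (spinBoson μ c w ψ)).re := by
  obtain ⟨ψ, hψ⟩ := ψ
  obtain ⟨u, hum, hus, hu⟩ := exists_symmetric_representative ψ
  obtain ⟨a, b, ha, hb, hab⟩ := hasSum_spinBoson_form hc hc2 hwm hw hr0 hr hψ hum hus hu e
  have hfe : IsFiniteEnergy μ w u := isFiniteEnergy_of_mem_domain
    ⟨ψ, (mem_domains_of_mem_spinBoson_domain hψ).2.2⟩ hum hus hu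
  have ht := ((Filter.tendsto_add_atTop_iff_nat 1).2 ha.tendsto_sum_nat).add
    (hb.tendsto_sum_nat.const_mul 2)
  have h0 : 0 ≤ a + 2 * b := ge_of_tendsto' ht (h u hfe)
  rw [hab, sub_nonneg] at h0
  exact h0

/-- A finite-energy family cut off after L photons is a genuine vector of the operator domain, whose
full form is the partial form. -/
theorem isFormBound_of_form_ge (hc : Measurable c) (hc2 : MemLp c 2 μ)
    (hwm : Measurable w) (hw : ∀ k, 0 ≤ w k) (hr0 : 0 < r) (hr : ∀ᵐ k ∂μ, r ≤ w k) {e : ℝ}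
    (h : ∀ ψ : (spinBoson μ c w).domain,
      e * ‖(ψ : Fock μ)‖ ^ 2 ≤ (inner ℂ (ψ : Fock μ) (spinBoson μ c w ψ)).re) :
    IsFormBound μ c w e := by
  intro u hu L
  let v : ∀ ℓ : ℕ, (Fin ℓ → Momentum) → Atom := fun ℓ => if ℓ ≤ L then u ℓ else 0
  have hv1 : ∀ ℓ, ℓ ≤ L → v ℓ = u ℓ := fun ℓ h => if_pos h
  have hv0 : ∀ ℓ, ¬ ℓ ≤ L → v ℓ = 0 := fun ℓ h => if_neg h
  have hvm : ∀ ℓ, Measurable (v ℓ) := fun ℓ => by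
    by_cases hℓ : ℓ ≤ L
    · rw [hv1 ℓ hℓ]; exact hu.measurable ℓ
    · rw [hv0 ℓ hℓ]; exact measurable_const
  have hvs : ∀ ℓ (s : Equiv.Perm (Fin ℓ)) k, v ℓ (k ∘ s) = v ℓ k := fun ℓ s k => by
    by_cases hℓ : ℓ ≤ L
    · rw [hv1 ℓ hℓ]; exact hu.perm ℓ s k
    · rw [hv0 ℓ hℓ]; rfl
  have hfin : ∀ F : ∀ ℓ : ℕ, (Fin ℓ → Momentum) → Atom, (∀ ℓ, ¬ ℓ ≤ L → F ℓ = 0) →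
      Summable fun ℓ => (eLpNorm (F ℓ) 2 (tupleMeasure μ ℓ)).toReal ^ 2 := fun F hF => by
    refine summable_of_ne_finset_zero (s := Finset.range (L + 1)) fun ℓ hℓ => ?_
    rw [hF ℓ (by simpa [Nat.lt_succ_iff] using hℓ)]
    simp
  obtain ⟨ψ, hψ⟩ := exists_fock_of_comp (μ := μ) v (fun ℓ => by
      by_cases hℓ : ℓ ≤ L
      · rw [hv1 ℓ hℓ]
        exact (memLp_two_iff_integrable_sq_norm (hu.measurable ℓ).aestronglyMeasurable).2
          (hu.integrable_sq ℓ)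
      · rw [hv0 ℓ hℓ]; exact MemLp.zero)
    (fun ℓ s => Filter.Eventually.of_forall fun k => hvs ℓ s k) (hfin v hv0)
  obtain ⟨η, hη⟩ := exists_fock_of_comp (μ := μ) (fun ℓ k => (tupleEnergy w k : ℂ) • v ℓ k)
    (fun ℓ => by
      have hm : Measurable fun k => (tupleEnergy w k : ℂ) • v ℓ k :=
        (Complex.measurable_ofReal.comp (measurable_tupleEnergy hwm ℓ)).smul (hvm ℓ)
      rw [memLp_two_iff_integrable_sq_norm hm.aestronglyMeasurable]
      by_cases hℓ : ℓ ≤ L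
      · rw [hv1 ℓ hℓ]
        refine (hu.integrable_energy_sq ℓ).congr (Filter.Eventually.of_forall fun k => ?_)
        simp only [norm_smul, mul_pow, Complex.norm_real, Real.norm_eq_abs, sq_abs]
      · rw [hv0 ℓ hℓ]; simp)
    (fun ℓ s => Filter.Eventually.of_forall fun k => by simp only [tupleEnergy_perm, hvs])
    (hfin _ fun ℓ hℓ => by rw [hv0 ℓ hℓ]; funext k; simp)
  have hd : ψ ∈ (photonEnergy μ w).domain := by
    refine ⟨η, fun ℓ => ?_⟩
    filter_upwards [hψ ℓ, hη ℓ] with k h1 h2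
    rw [h1, h2]
    rfl
  rw [← spinBoson_domain hc hc2 hr0 hr] at hd
  obtain ⟨a, b, ha, hb, hab⟩ := hasSum_spinBoson_form hc hc2 hwm hw hr0 hr hd hvm hvs
    (fun ℓ => (hψ ℓ).symm) e
  have ha' := ha.unique (hasSum_sum_of_ne_finset_zero (s := Finset.range (L + 1)) fun ℓ hℓ => by
    rw [hv0 ℓ (by simpa [Nat.lt_succ_iff] using hℓ)]
    exact integral_energyDensity_zero w e ℓ)
  -- The sum stops one index earlier than the energy sum: the term with index L couples to the
  -- component with L + 1 photons, which vanishes.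
  have hb' := hb.unique (hasSum_sum_of_ne_finset_zero (s := Finset.range L) fun ℓ hℓ => by
    rw [hv0 (ℓ + 1) (by simpa [Nat.succ_le_iff] using hℓ)]
    exact interaction_zero_right c _)
  have hp : partialForm μ c w e u L = a + 2 * b := by
    rw [partialForm, ha', hb']
    congr 1
    · refine Finset.sum_congr rfl fun ℓ hℓ => ?_
      rw [hv1 ℓ (by simpa [Nat.lt_succ_iff] using hℓ)]
    · congr 1
      refine Finset.sum_congr rfl fun ℓ hℓ => ?_
      have := Finset.mem_range.1 hℓ
      rw [hv1 ℓ (by omega), hv1 (ℓ + 1) (by omega)]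
  rw [hp, hab, sub_nonneg]
  exact h ⟨ψ, hd⟩

end Equivalence

end PartialForm

/-! ### Integrals of symmetric functions -/

theorem integral_comp_measurePreserving {α β : Type*} [MeasurableSpace α] [MeasurableSpace β]
    {a : Measure α} {b : Measure β} {T : α → β} (h : MeasurePreserving T a b) {g : β → ℝ}
    (hg : AEStronglyMeasurable g b) : ∫ x, g (T x) ∂a = ∫ y, g y ∂b := by
  rw [← h.map_eq] at hg ⊢
  exact (integral_map h.aemeasurable hg).symm

/-- The integral of a symmetric function against a sum of one-particle functions is a multiple of
the integral against the function of the first particle. -/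
theorem integral_sum_mul_of_symmetric {X Y : Type*} [MeasurableSpace X] [MeasurableSpace Y]
    {μ : Measure Momentum} {m0 : Measure X} {m1 : Measure Y} {T : Momentum × X → Y}
    (hT : MeasurePreserving T (μ.prod m0) m1) {n : ℕ} (f : Fin n → Y → Momentum)
    {f0 : Y → Momentum} (hf0T : ∀ z, f0 (T z) = z.1) {χ : Momentum → ℝ} {F : Y → ℝ}
    (hsym : ∀ i, ∃ π : Y → Y, MeasurePreserving π m1 m1 ∧ (∀ y, f0 (π y) = f i y) ∧
      ∀ y, F (π y) = F y) (hint : Integrable (fun y => χ (f0 y) * F y) m1) :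
    Integrable (fun z => χ z.1 * F (T z)) (μ.prod m0) ∧
      ∫ y, (∑ i, χ (f i y)) * F y ∂m1 = n * ∫ z, χ z.1 * F (T z) ∂μ.prod m0 := by
  have h0 : (fun z => χ z.1 * F (T z)) = fun z => (fun y => χ (f0 y) * F y) (T z) := by
    funext z; simp only [hf0T]
  have h1 : ∀ i, Integrable (fun y => χ (f i y) * F y) m1 ∧
      ∫ y, χ (f i y) * F y ∂m1 = ∫ z, χ z.1 * F (T z) ∂μ.prod m0 := by
    intro i
    obtain ⟨π, hπ, hπ1, hπ2⟩ := hsym i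
    have e : (fun y => χ (f i y) * F y) = fun y => (fun y => χ (f0 y) * F y) (π y) := by
      funext y; simp only [hπ1, hπ2]
    rw [e, h0]
    refine ⟨hπ.integrable_comp_of_integrable hint, ?_⟩
    rw [integral_comp_measurePreserving hπ hint.1, integral_comp_measurePreserving hT hint.1]
  refine ⟨by rw [h0]; exact hT.integrable_comp_of_integrable hint, ?_⟩
  simp only [Finset.sum_mul]
  rw [integral_finsetSum _ fun i _ => (h1 i).1]
  simp only [(h1 _).2, Finset.sum_const, Finset.card_univ, Fintype.card_fin, nsmul_eq_mul]

section Symmetric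

variable {μ : Measure Momentum} [SigmaFinite μ]

theorem integral_tupleEnergy_mul {χ : Momentum → ℝ} {ℓ : ℕ} {F : (Fin (ℓ + 1) → Momentum) → ℝ}
    (hsym : ∀ (s : Equiv.Perm (Fin (ℓ + 1))) k, F (k ∘ s) = F k)
    (hint : Integrable (fun k => χ (k 0) * F k) (tupleMeasure μ (ℓ + 1))) :
    Integrable (fun z : Momentum × (Fin ℓ → Momentum) => χ z.1 * F (Fin.cons z.1 z.2))
        (μ.prod (tupleMeasure μ ℓ)) ∧
      ∫ k, tupleEnergy χ k * F k ∂tupleMeasure μ (ℓ + 1) =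
        (ℓ + 1 : ℕ) * ∫ z, χ z.1 * F (Fin.cons z.1 z.2) ∂μ.prod (tupleMeasure μ ℓ) := by
  refine integral_sum_mul_of_symmetric (measurePreserving_cons (μ := μ) ℓ)
    (fun (i : Fin (ℓ + 1)) k => k i) (f0 := fun k => k 0) (fun z => rfl) (fun i => ?_) hint
  refine ⟨fun k => k ∘ (Equiv.swap 0 i), measurePreserving_perm μ _, fun k => ?_, hsym _⟩
  simp

/-- The middle coordinate is the momentum created by the interaction, and the outer one is a photon
already present. The rearrangement keeps the former apart while inserting the latter among the
remaining photons. -/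
theorem measurePreserving_cons_snd (ℓ : ℕ) :
    MeasurePreserving (fun z : Momentum × (Momentum × (Fin ℓ → Momentum)) =>
        (z.2.1, (Fin.cons z.1 z.2.2 : Fin (ℓ + 1) → Momentum)))
      (μ.prod (μ.prod (tupleMeasure μ ℓ))) (μ.prod (tupleMeasure μ (ℓ + 1))) := by
  have h1 : MeasurePreserving
      (fun z : Momentum × (Momentum × (Fin ℓ → Momentum)) => ((z.1, z.2.1), z.2.2))
      (μ.prod (μ.prod (tupleMeasure μ ℓ))) ((μ.prod μ).prod (tupleMeasure μ ℓ)) :=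
    (measurePreserving_prodAssoc μ μ (tupleMeasure μ ℓ)).symm
  have h2 : MeasurePreserving
      (fun z : (Momentum × Momentum) × (Fin ℓ → Momentum) => (z.1.swap, z.2))
      ((μ.prod μ).prod (tupleMeasure μ ℓ)) ((μ.prod μ).prod (tupleMeasure μ ℓ)) :=
    Measure.measurePreserving_swap.prod (MeasurePreserving.id _)
  have h3 := measurePreserving_prodAssoc μ μ (tupleMeasure μ ℓ)
  have h4 := (MeasurePreserving.id μ).prod (measurePreserving_cons (μ := μ) ℓ)
  exact h4.comp (h3.comp (h2.comp h1))

theorem integral_prod_tupleEnergy_mul {χ : Momentum → ℝ} {ℓ : ℕ}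
    {F : Momentum × (Fin (ℓ + 1) → Momentum) → ℝ}
    (hsym : ∀ (s : Equiv.Perm (Fin (ℓ + 1))) x k, F (x, k ∘ s) = F (x, k))
    (hint : Integrable (fun z => χ (z.2 0) * F z) (μ.prod (tupleMeasure μ (ℓ + 1)))) :
    Integrable (fun z : Momentum × (Momentum × (Fin ℓ → Momentum)) =>
        χ z.1 * F (z.2.1, Fin.cons z.1 z.2.2)) (μ.prod (μ.prod (tupleMeasure μ ℓ))) ∧
      ∫ z, tupleEnergy χ z.2 * F z ∂μ.prod (tupleMeasure μ (ℓ + 1)) =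
        (ℓ + 1 : ℕ) * ∫ z : Momentum × (Momentum × (Fin ℓ → Momentum)),
          χ z.1 * F (z.2.1, Fin.cons z.1 z.2.2) ∂μ.prod (μ.prod (tupleMeasure μ ℓ)) := by
  refine integral_sum_mul_of_symmetric (measurePreserving_cons_snd (μ := μ) ℓ)
    (fun (i : Fin (ℓ + 1)) z => z.2 i) (f0 := fun z => z.2 0) (fun z => rfl) (fun i => ?_) hint
  refine ⟨fun z => (z.1, z.2 ∘ (Equiv.swap 0 i)),
    (MeasurePreserving.id μ).prod (measurePreserving_perm μ _), fun k => ?_, fun z => hsym _ _ _⟩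
  simp

end Symmetric

/-! ### Homogeneity of the forms -/

section Scaling

theorem atomForm_real_smul (a : ℝ) (v : Atom) : atomForm ((a : ℂ) • v) = a ^ 2 * atomForm v := by
  rw [atomForm_eq, atomForm_eq, PiLp.smul_apply, norm_smul, Complex.norm_real, Real.norm_eq_abs,
    mul_pow, sq_abs]
  ring

theorem norm_real_smul_sq (a : ℝ) (v : Atom) : ‖(a : ℂ) • v‖ ^ 2 = a ^ 2 * ‖v‖ ^ 2 := by
  rw [norm_smul, Complex.norm_real, Real.norm_eq_abs, mul_pow, sq_abs]

theorem re_inner_pauli_real_smul (a b : ℝ) (v v' : Atom) :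
    (inner ℂ ((a : ℂ) • v) (pauliCLM ((b : ℂ) • v'))).re =
      a * b * (inner ℂ v (pauliCLM v')).re := by
  rw [map_smul, inner_smul_left, inner_smul_right, Complex.conj_ofReal, ← mul_assoc,
    ← Complex.ofReal_mul, Complex.re_ofReal_mul]

end Scaling

/-! ### Restricting the momenta: vacuum in the removed modes -/

section Cut

variable {μ : Measure Momentum} [SigmaFinite μ] {O : Set Momentum}

/-- The restriction of a family of functions to tuples of momenta in `O`. -/
def cut (O : Set Momentum) (u : ∀ ℓ : ℕ, (Fin ℓ → Momentum) → Atom) (ℓ : ℕ) :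
    (Fin ℓ → Momentum) → Atom :=
  (Set.univ.pi fun _ => O).indicator (u ℓ)

theorem tupleMeasure_restrict (ℓ : ℕ) :
    tupleMeasure (μ.restrict O) ℓ = (tupleMeasure μ ℓ).restrict (Set.univ.pi fun _ => O) :=
  (Measure.restrict_pi_pi (fun _ : Fin ℓ => μ) fun _ => O).symm

theorem measurableSet_pi_univ (hO : MeasurableSet O) (ℓ : ℕ) :
    MeasurableSet (Set.univ.pi fun _ : Fin ℓ => O) :=
  MeasurableSet.univ_pi fun _ => hO

theorem perm_mem_pi {ℓ : ℕ} (s : Equiv.Perm (Fin ℓ)) (k : Fin ℓ → Momentum) :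
    k ∘ s ∈ (Set.univ.pi fun _ => O) ↔ k ∈ (Set.univ.pi fun _ : Fin ℓ => O) := by
  simp only [Set.mem_univ_pi, Function.comp_apply]
  exact s.forall_congr_left.trans (by simp)

theorem cons_mem_pi {ℓ : ℕ} {x : Momentum} {k : Fin ℓ → Momentum} :
    (Fin.cons x k : Fin (ℓ + 1) → Momentum) ∈ (Set.univ.pi fun _ => O) ↔
      x ∈ O ∧ k ∈ (Set.univ.pi fun _ : Fin ℓ => O) := by
  simp [Fin.forall_fin_succ]

theorem tupleEnergy_congr {w w' : Momentum → ℝ} (h : Set.EqOn w w' O) {ℓ : ℕ}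
    {k : Fin ℓ → Momentum} (hk : k ∈ (Set.univ.pi fun _ : Fin ℓ => O)) :
    tupleEnergy w k = tupleEnergy w' k :=
  Finset.sum_congr rfl fun i _ => h (hk i trivial)

theorem isFiniteEnergy_cut (hO : MeasurableSet O) {w w' : Momentum → ℝ} (hw : Set.EqOn w w' O)
    {u : ∀ ℓ : ℕ, (Fin ℓ → Momentum) → Atom} (hu : IsFiniteEnergy (μ.restrict O) w' u) :
    IsFiniteEnergy μ w (cut O u) where
  measurable ℓ := (hu.measurable ℓ).indicator (measurableSet_pi_univ hO ℓ)
  perm ℓ s k := by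
    classical
    simp only [cut, Set.indicator_apply, perm_mem_pi, hu.perm]
  integrable_sq ℓ := by
    have h := hu.integrable_sq ℓ
    rw [tupleMeasure_restrict] at h
    refine ((integrable_indicator_iff (measurableSet_pi_univ hO ℓ)).2 h).congr
      (Filter.Eventually.of_forall fun k => ?_)
    by_cases hk : k ∈ (Set.univ.pi fun _ : Fin ℓ => O)
    · simp only [cut, Set.indicator_of_mem hk]
    · simp [cut, Set.indicator_of_notMem hk]
  integrable_energy_sq ℓ := by
    have h := hu.integrable_energy_sq ℓ
    rw [tupleMeasure_restrict] at h
    refine ((integrable_indicator_iff (measurableSet_pi_univ hO ℓ)).2 h).congr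
      (Filter.Eventually.of_forall fun k => ?_)
    by_cases hk : k ∈ (Set.univ.pi fun _ : Fin ℓ => O)
    · simp only [cut, Set.indicator_of_mem hk, tupleEnergy_congr hw hk]
    · simp [cut, Set.indicator_of_notMem hk]

/-- The extended functions vanish as soon as one momentum leaves O, so only the values of coupling
and dispersion on O are seen. -/
theorem partialForm_cut (hO : MeasurableSet O) {c c' w w' : Momentum → ℝ} (hc : Set.EqOn c c' O)
    (hw : Set.EqOn w w' O) (e : ℝ) (u : ∀ ℓ : ℕ, (Fin ℓ → Momentum) → Atom) (L : ℕ) :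
    partialForm μ c w e (cut O u) L = partialForm (μ.restrict O) c' w' e u L := by
  rw [partialForm, partialForm]
  congr 1
  · refine Finset.sum_congr rfl fun ℓ _ => ?_
    rw [tupleMeasure_restrict, ← integral_indicator (measurableSet_pi_univ hO ℓ)]
    refine integral_congr_ae (Filter.Eventually.of_forall fun k => ?_)
    by_cases hk : k ∈ (Set.univ.pi fun _ : Fin ℓ => O)
    · simp only [energyDensity, cut, Set.indicator_of_mem hk, tupleEnergy_congr hw hk]
    · simp [energyDensity, atomForm, cut, Set.indicator_of_notMem hk]
  · congr 1
    refine Finset.sum_congr rfl fun ℓ _ => ?_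
    rw [interaction, interaction, tupleMeasure_restrict, Measure.prod_restrict,
      ← integral_indicator (hO.prod (measurableSet_pi_univ hO ℓ))]
    congr 1
    refine integral_congr_ae (Filter.Eventually.of_forall fun z => ?_)
    by_cases hz : z ∈ O ×ˢ (Set.univ.pi fun _ : Fin ℓ => O)
    · have h1 : z.2 ∈ (Set.univ.pi fun _ : Fin ℓ => O) := hz.2
      have h2 : (Fin.cons z.1 z.2 : Fin (ℓ + 1) → Momentum) ∈ (Set.univ.pi fun _ => O) :=
        cons_mem_pi.2 hz
      simp only [interactionDensity, cut, Set.indicator_of_mem h1, Set.indicator_of_mem h2,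
        Set.indicator_of_mem hz, hc hz.1]
    · have h2 : (Fin.cons z.1 z.2 : Fin (ℓ + 1) → Momentum) ∉ (Set.univ.pi fun _ => O) :=
        fun h => hz (cons_mem_pi.1 h)
      simp only [interactionDensity, cut, Set.indicator_of_notMem h2,
        Set.indicator_of_notMem hz, inner_zero_left, Complex.zero_re, mul_zero]

/-- States over O embed, with the vacuum in all other modes, as test states over the larger space
with the same form. -/
theorem IsFormBound.restrict (hO : MeasurableSet O) {c c' w w' : Momentum → ℝ}
    (hc : Set.EqOn c c' O) (hw : Set.EqOn w w' O) {e : ℝ} (h : IsFormBound μ c w e) :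
    IsFormBound (μ.restrict O) c' w' e := fun u hu L => by
  rw [← partialForm_cut hO hc hw]
  exact h _ (isFiniteEnergy_cut hO hw hu) L

theorem IsFiniteEnergy.restrict {w : Momentum → ℝ} {u : ∀ ℓ : ℕ, (Fin ℓ → Momentum) → Atom}
    (hu : IsFiniteEnergy μ w u) (O : Set Momentum) : IsFiniteEnergy (μ.restrict O) w u where
  measurable := hu.measurable
  perm := hu.perm
  integrable_sq ℓ := by rw [tupleMeasure_restrict]; exact (hu.integrable_sq ℓ).restrict
  integrable_energy_sq ℓ := by
    rw [tupleMeasure_restrict]; exact (hu.integrable_energy_sq ℓ).restrict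

end Cut

/-! ### Adding photons without energy or interaction -/

section Decoupling

variable {μ : Measure Momentum} [SigmaFinite μ] {O : Set Momentum}

/-- The indicator function of the complement of `O`. -/
def outer (O : Set Momentum) : Momentum → ℝ := Oᶜ.indicator fun _ => 1

theorem outer_of_mem {p : Momentum} (hp : p ∈ O) : outer O p = 0 :=
  Set.indicator_of_notMem (s := Oᶜ) (fun h : p ∈ Oᶜ => h hp) _

theorem outer_of_notMem {p : Momentum} (hp : p ∉ O) : outer O p = 1 :=
  Set.indicator_of_mem (s := Oᶜ) hp _

theorem outer_nonneg (p : Momentum) : 0 ≤ outer O p :=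
  Set.indicator_nonneg (fun _ _ => zero_le_one) p

theorem abs_outer_le (p : Momentum) : |outer O p| ≤ 1 := by
  by_cases hp : p ∈ O
  · simp [outer_of_mem hp]
  · simp [outer_of_notMem hp]

theorem measurable_outer (hO : MeasurableSet O) : Measurable (outer O) :=
  measurable_const.indicator hO.compl

theorem tupleEnergy_cons (w : Momentum → ℝ) {ℓ : ℕ} (x : Momentum) (k : Fin ℓ → Momentum) :
    tupleEnergy w (Fin.cons x k : Fin (ℓ + 1) → Momentum) = w x + tupleEnergy w k := by
  simp [tupleEnergy, Fin.sum_univ_succ]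

/-- The quantity `tupleEnergy (outer O)` counts the momenta outside O. -/
theorem tupleEnergy_outer_of_mem {ℓ : ℕ} {k : Fin ℓ → Momentum}
    (hk : k ∈ (Set.univ.pi fun _ : Fin ℓ => O)) : tupleEnergy (outer O) k = 0 :=
  Finset.sum_eq_zero fun i _ => outer_of_mem (hk i trivial)

theorem one_le_tupleEnergy_outer {ℓ : ℕ} {k : Fin ℓ → Momentum}
    (hk : k ∉ (Set.univ.pi fun _ : Fin ℓ => O)) : 1 ≤ tupleEnergy (outer O) k := by
  simp only [Set.mem_univ_pi, not_forall] at hk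
  obtain ⟨i, hi⟩ := hk
  rw [← outer_of_notMem hi]
  exact Finset.single_le_sum (f := fun i => outer O (k i)) (fun j _ => outer_nonneg _)
    (Finset.mem_univ i)

/-- The part of a family of functions where some momentum is outside `O`, divided by the square
root of the number of such momenta. -/
def outerPart (O : Set Momentum) (u : ∀ ℓ : ℕ, (Fin ℓ → Momentum) → Atom) (ℓ : ℕ)
    (k : Fin ℓ → Momentum) : Atom :=
  (((Real.sqrt (tupleEnergy (outer O) k))⁻¹ : ℝ) : ℂ) • u ℓ k

/-- Where the count is zero, the convention 0⁻¹ = 0 makes the outer part vanish; elsewhere the count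
is at least one. -/
theorem norm_outerPart_sq_le (u : ∀ ℓ : ℕ, (Fin ℓ → Momentum) → Atom) (ℓ : ℕ)
    (k : Fin ℓ → Momentum) : ‖outerPart O u ℓ k‖ ^ 2 ≤ ‖u ℓ k‖ ^ 2 := by
  rw [outerPart, norm_real_smul_sq, inv_pow, Real.sq_sqrt (tupleEnergy_nonneg outer_nonneg k)]
  by_cases hk : k ∈ (Set.univ.pi fun _ : Fin ℓ => O)
  · rw [tupleEnergy_outer_of_mem hk]; simp
  · have := inv_le_one_of_one_le₀ (one_le_tupleEnergy_outer hk)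
    nlinarith [sq_nonneg ‖u ℓ k‖]

theorem isFiniteEnergy_outerPart (hO : MeasurableSet O) {w : Momentum → ℝ} (hw : Measurable w)
    {u : ∀ ℓ : ℕ, (Fin ℓ → Momentum) → Atom} (hu : IsFiniteEnergy μ w u) :
    IsFiniteEnergy μ w (outerPart O u) := by
  have hm : ∀ ℓ, Measurable (outerPart O u ℓ) := fun ℓ =>
    (Complex.measurable_ofReal.comp
      (measurable_tupleEnergy (measurable_outer hO) ℓ).sqrt.inv).smul (hu.measurable ℓ)
  refine ⟨hm, fun ℓ s k => ?_, fun ℓ => ?_, fun ℓ => ?_⟩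
  · rw [outerPart, outerPart, tupleEnergy_perm, hu.perm]
  · refine (hu.integrable_sq ℓ).mono' ((hm ℓ).norm.pow_const 2).aestronglyMeasurable
      (Filter.Eventually.of_forall fun k => ?_)
    rw [Real.norm_of_nonneg (sq_nonneg _)]
    exact norm_outerPart_sq_le u ℓ k
  · refine (hu.integrable_energy_sq ℓ).mono' (((measurable_tupleEnergy hw ℓ).pow_const 2).mul
      ((hm ℓ).norm.pow_const 2)).aestronglyMeasurable (Filter.Eventually.of_forall fun k => ?_)
    rw [Real.norm_of_nonneg (by positivity)]
    exact mul_le_mul_of_nonneg_left (norm_outerPart_sq_le u ℓ k) (sq_nonneg _)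

/-- The count cancels the squared normalization of the outer part wherever it is nonzero; elsewhere
the cut part is the whole function. -/
theorem energyDensity_split (w : Momentum → ℝ) (e : ℝ)
    (u : ∀ ℓ : ℕ, (Fin ℓ → Momentum) → Atom) (ℓ : ℕ) (k : Fin ℓ → Momentum) :
    energyDensity w e (u ℓ) k = energyDensity w e (cut O u ℓ) k +
      tupleEnergy (outer O) k * energyDensity w e (outerPart O u ℓ) k := by
  by_cases hk : k ∈ (Set.univ.pi fun _ : Fin ℓ => O)
  · simp [energyDensity, cut, Set.indicator_of_mem hk, tupleEnergy_outer_of_mem hk]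
  · have h1 := one_le_tupleEnergy_outer hk
    simp only [energyDensity, cut, Set.indicator_of_notMem hk, outerPart, atomForm_real_smul,
      norm_real_smul_sq, inv_pow, Real.sq_sqrt (zero_le_one.trans h1)]
    have h0 : tupleEnergy (outer O) k ≠ 0 := by positivity
    simp only [atomForm, inner_zero_left, Complex.zero_re, norm_zero]
    field_simp
    ring

/-- Only momenta in O are created, so both states paired by the interaction contain the same number
of momenta outside O, and the two square-root normalizations combine to its inverse. -/
theorem interactionDensity_split {c : Momentum → ℝ} (hc : ∀ k ∉ O, c k = 0)
    (u : ∀ ℓ : ℕ, (Fin ℓ → Momentum) → Atom) (ℓ : ℕ) (z : Momentum × (Fin ℓ → Momentum)) :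
    interactionDensity c (u ℓ) (u (ℓ + 1)) z =
      interactionDensity c (cut O u ℓ) (cut O u (ℓ + 1)) z +
      tupleEnergy (outer O) z.2 *
        interactionDensity c (outerPart O u ℓ) (outerPart O u (ℓ + 1)) z := by
  by_cases hz : z.1 ∈ O
  · by_cases hk : z.2 ∈ (Set.univ.pi fun _ : Fin ℓ => O)
    · have h2 : (Fin.cons z.1 z.2 : Fin (ℓ + 1) → Momentum) ∈ (Set.univ.pi fun _ => O) :=
        cons_mem_pi.2 ⟨hz, hk⟩
      simp only [interactionDensity, cut, Set.indicator_of_mem hk, Set.indicator_of_mem h2,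
        tupleEnergy_outer_of_mem hk, zero_mul, add_zero]
    · have h1 := one_le_tupleEnergy_outer hk
      have h0 : 0 < tupleEnergy (outer O) z.2 := by positivity
      simp only [interactionDensity, cut, Set.indicator_of_notMem hk, map_zero, inner_zero_right,
        Complex.zero_re, mul_zero, zero_add, outerPart, re_inner_pauli_real_smul,
        tupleEnergy_cons, outer_of_mem hz]
      rw [← mul_inv, Real.mul_self_sqrt h0.le]
      field_simp
  · simp [interactionDensity, hc _ hz]

/-- The state after a photon of momentum `p` has been annihilated. -/
def fiber (u : ∀ ℓ : ℕ, (Fin ℓ → Momentum) → Atom) (p : Momentum) (ℓ : ℕ)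
    (k : Fin ℓ → Momentum) : Atom :=
  ((Real.sqrt (ℓ + 1) : ℝ) : ℂ) • u (ℓ + 1) (Fin.cons p k)

theorem exists_perm_cons_comp {ℓ : ℕ} (s : Equiv.Perm (Fin ℓ)) :
    ∃ t : Equiv.Perm (Fin (ℓ + 1)), ∀ (p : Momentum) (k : Fin ℓ → Momentum),
      (Fin.cons p (k ∘ s) : Fin (ℓ + 1) → Momentum) = Fin.cons p k ∘ t := by
  refine ⟨Equiv.Perm.decomposeFin.symm (0, s), fun p k => ?_⟩
  funext j
  refine Fin.cases ?_ (fun j => ?_) j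
  · simp
  · simp

theorem cons_cons_swap {ℓ : ℕ} (x p : Momentum) (k : Fin ℓ → Momentum) :
    (Fin.cons x (Fin.cons p k : Fin (ℓ + 1) → Momentum) : Fin (ℓ + 2) → Momentum) ∘
      (Equiv.swap 0 1 : Equiv.Perm (Fin (ℓ + 2))) =
      Fin.cons p (Fin.cons x k : Fin (ℓ + 1) → Momentum) := by
  funext j
  refine Fin.cases ?_ (fun j => Fin.cases ?_ (fun j => ?_) j) j
  · rw [Function.comp_apply, Equiv.swap_apply_left]; rfl
  · rw [Function.comp_apply, Fin.succ_zero_eq_one, Equiv.swap_apply_right]; rfl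
  · have h0 : j.succ.succ ≠ 0 := Fin.succ_ne_zero _
    have h1 : j.succ.succ ≠ 1 := fun h => Fin.succ_ne_zero j (Fin.succ_injective _ h)
    rw [Function.comp_apply, Equiv.swap_apply_of_ne_of_ne h0 h1]; rfl

section Fiber

variable {w : Momentum → ℝ} {u : ∀ ℓ : ℕ, (Fin ℓ → Momentum) → Atom}

/-- A photon outside O has no energy, so the remaining photons carry all of it. Integrability of the
slices holds for almost every p by Fubini's theorem. -/
theorem isFiniteEnergy_fiber (hw0 : ∀ k ∉ O, w k = 0) (hu : IsFiniteEnergy μ w u) :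
    ∀ᵐ p ∂μ, p ∉ O → IsFiniteEnergy μ w (fiber u p) := by
  have h1 : ∀ᵐ p ∂μ, ∀ ℓ : ℕ, Integrable
      (fun k : Fin ℓ → Momentum => ‖u (ℓ + 1) (Fin.cons p k)‖ ^ 2) (tupleMeasure μ ℓ) :=
    ae_all_iff.2 fun ℓ =>
      ((measurePreserving_cons ℓ).integrable_comp_of_integrable
        (hu.integrable_sq (ℓ + 1))).prod_right_ae
  have h2 : ∀ᵐ p ∂μ, ∀ ℓ : ℕ, Integrable (fun k : Fin ℓ → Momentum =>
      tupleEnergy w (Fin.cons p k : Fin (ℓ + 1) → Momentum) ^ 2 *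
        ‖u (ℓ + 1) (Fin.cons p k)‖ ^ 2) (tupleMeasure μ ℓ) :=
    ae_all_iff.2 fun ℓ =>
      ((measurePreserving_cons ℓ).integrable_comp_of_integrable
        (hu.integrable_energy_sq (ℓ + 1))).prod_right_ae
  filter_upwards [h1, h2] with p h1 h2 hp
  refine ⟨fun ℓ => ?_, fun ℓ s k => ?_, fun ℓ => ?_, fun ℓ => ?_⟩
  · have hm : Measurable fun k : Fin ℓ → Momentum => u (ℓ + 1) (Fin.cons p k) :=
      (hu.measurable (ℓ + 1)).comp ((measurable_cons ℓ).comp measurable_prodMk_left)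
    exact hm.const_smul ((Real.sqrt (ℓ + 1) : ℝ) : ℂ)
  · obtain ⟨t, ht⟩ := exists_perm_cons_comp s
    rw [fiber, fiber, ht, hu.perm]
  · simp only [fiber, norm_real_smul_sq]
    exact (h1 ℓ).const_mul _
  · simp only [fiber, norm_real_smul_sq]
    refine ((h2 ℓ).const_mul (Real.sqrt (ℓ + 1) ^ 2)).congr
      (Filter.Eventually.of_forall fun k => ?_)
    simp only [tupleEnergy_cons, hw0 p hp, zero_add]
    ring

/-- Counting photons outside O amounts, by symmetry, to ℓ + 1 times testing the first one. The
factor √(ℓ + 1) in `fiber`, squared by the form, accounts for ℓ + 1. -/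
theorem integral_outer_mul_energyDensity (hO : MeasurableSet O) (hw : Measurable w)
    (hw0 : ∀ k ∉ O, w k = 0) (hu : IsFiniteEnergy μ w u) (e : ℝ) (ℓ : ℕ) :
    Integrable (fun p => outer O p *
        ∫ k, energyDensity w e (fiber u p ℓ) k ∂tupleMeasure μ ℓ) μ ∧
      ∫ k, tupleEnergy (outer O) k * energyDensity w e (u (ℓ + 1)) k ∂tupleMeasure μ (ℓ + 1) =
        ∫ p, outer O p * ∫ k, energyDensity w e (fiber u p ℓ) k ∂tupleMeasure μ ℓ ∂μ := by
  have hE := hu.integrable_energyDensity hw e (ℓ + 1)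
  obtain ⟨hi, heq⟩ := integral_tupleEnergy_mul (χ := outer O) (F := energyDensity w e (u (ℓ + 1)))
    (fun s k => by simp only [energyDensity, tupleEnergy_perm, hu.perm])
    (hE.bdd_mul (c := 1)
      ((measurable_outer hO).comp (measurable_pi_apply 0)).aestronglyMeasurable
      (Filter.Eventually.of_forall fun k => abs_outer_le _))
  have hpt : ∀ (p : Momentum) (k : Fin ℓ → Momentum),
      outer O p * energyDensity w e (fiber u p ℓ) k =
        (ℓ + 1 : ℕ) * (outer O p * energyDensity w e (u (ℓ + 1)) (Fin.cons p k)) := by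
    intro p k
    by_cases hp : p ∈ O
    · simp [outer_of_mem hp]
    · simp only [energyDensity, fiber, atomForm_real_smul, norm_real_smul_sq, tupleEnergy_cons,
        hw0 p hp, zero_add, Real.sq_sqrt (by positivity : (0 : ℝ) ≤ ℓ + 1)]
      push_cast
      ring
  have hi' := hi.const_mul ((ℓ + 1 : ℕ) : ℝ)
  rw [heq, ← integral_const_mul, integral_prod _ hi']
  have hI := hi'.integral_prod_left
  simp only [← hpt, integral_const_mul] at hI ⊢
  exact ⟨hI, trivial⟩

/-- Symmetry gives the prefactor √(ℓ + 2) (ℓ + 1). The two fibers supply √(ℓ + 1) √(ℓ + 2), and the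
interaction between them one more √(ℓ + 1). -/
theorem integral_outer_mul_interaction (hO : MeasurableSet O) {c : Momentum → ℝ}
    (hc : Measurable c) (hc2 : Integrable (fun k => c k ^ 2) μ)
    (hu : IsFiniteEnergy μ w u) (ℓ : ℕ) :
    Integrable (fun p => outer O p * interaction μ c (fiber u p ℓ) (fiber u p (ℓ + 1))) μ ∧
      Real.sqrt ((ℓ + 1 : ℕ) + 1) * ∫ z, tupleEnergy (outer O) z.2 *
        interactionDensity c (u (ℓ + 1)) (u (ℓ + 2)) z ∂μ.prod (tupleMeasure μ (ℓ + 1)) =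
        ∫ p, outer O p * interaction μ c (fiber u p ℓ) (fiber u p (ℓ + 1)) ∂μ := by
  have hE := hu.integrable_interaction hc hc2 (ℓ + 1)
  obtain ⟨hi, heq⟩ := integral_prod_tupleEnergy_mul (χ := outer O)
    (F := interactionDensity c (u (ℓ + 1)) (u (ℓ + 2)))
    (fun s x k => by
      obtain ⟨t, ht⟩ := exists_perm_cons_comp s
      simp only [interactionDensity, ht, hu.perm])
    (hE.bdd_mul (c := 1)
      ((measurable_outer hO).comp ((measurable_pi_apply 0).comp
        measurable_snd)).aestronglyMeasurable
      (Filter.Eventually.of_forall fun k => abs_outer_le _))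
  have hpt : ∀ (p : Momentum) (z : Momentum × (Fin ℓ → Momentum)),
      Real.sqrt (ℓ + 1) * (outer O p * interactionDensity c (fiber u p ℓ) (fiber u p (ℓ + 1)) z) =
        Real.sqrt ((ℓ + 1 : ℕ) + 1) * ((ℓ + 1 : ℕ) *
          (outer O p * interactionDensity c (u (ℓ + 1)) (u (ℓ + 2)) (z.1, Fin.cons p z.2))) := by
    intro p z
    -- The fiber puts p before the created photon, whereas the creation form puts the created photon
    -- first; symmetry interchanges them.
    have h1 : u (ℓ + 2) (Fin.cons z.1 (Fin.cons p z.2 : Fin (ℓ + 1) → Momentum)) =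
        u (ℓ + 2) (Fin.cons p (Fin.cons z.1 z.2 : Fin (ℓ + 1) → Momentum)) := by
      rw [← cons_cons_swap, hu.perm]
    have h2 : Real.sqrt (ℓ + 1) * Real.sqrt (ℓ + 1) = ℓ + 1 :=
      Real.mul_self_sqrt (by positivity)
    simp only [interactionDensity, fiber, re_inner_pauli_real_smul, h1]
    push_cast
    linear_combination (Real.sqrt (ℓ + 1 + 1) * outer O p * c z.1 *
      (inner ℂ (u (ℓ + 2) (Fin.cons p (Fin.cons z.1 z.2 : Fin (ℓ + 1) → Momentum)))
        (pauliCLM (u (ℓ + 1) (Fin.cons p z.2)))).re) * h2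
  have hi' := (hi.const_mul ((ℓ + 1 : ℕ) : ℝ)).const_mul (Real.sqrt ((ℓ + 1 : ℕ) + 1))
  rw [heq, ← integral_const_mul, ← integral_const_mul, integral_prod _ hi']
  have hI := hi'.integral_prod_left
  simp only [← hpt, integral_const_mul] at hI ⊢
  have hcomm : ∀ p, Real.sqrt (ℓ + 1) * (outer O p * ∫ z, interactionDensity c (fiber u p ℓ)
      (fiber u p (ℓ + 1)) z ∂μ.prod (tupleMeasure μ ℓ)) =
      outer O p * interaction μ c (fiber u p ℓ) (fiber u p (ℓ + 1)) := fun p => by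
    rw [interaction]; ring
  refine ⟨by simpa only [hcomm] using hI, ?_⟩
  rw [← integral_const_mul]
  simp only [hcomm]

end Fiber

theorem integral_split {α : Type*} [MeasurableSpace α] {m : Measure α} {f g h : α → ℝ}
    (hf : Integrable f m) (hg : Integrable g m) (hfg : ∀ x, f x = g x + h x) :
    ∫ x, f x ∂m = ∫ x, g x ∂m + ∫ x, h x ∂m := by
  have hh : Integrable h m :=
    (hf.sub hg).congr (Filter.Eventually.of_forall fun x => by simp [hfg])
  rw [← integral_add hg hh]
  exact integral_congr_ae (Filter.Eventually.of_forall hfg)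

/-- Photons which do not interact and have no energy do not lower the lower bounds of the quadratic
form. -/
theorem IsFormBound.of_restrict (hO : MeasurableSet O) {c w : Momentum → ℝ} (hc : Measurable c)
    (hc2 : Integrable (fun k => c k ^ 2) μ) (hc0 : ∀ k ∉ O, c k = 0) (hw : Measurable w)
    (hw0 : ∀ k ∉ O, w k = 0) {e : ℝ} (h : IsFormBound (μ.restrict O) c w e) :
    IsFormBound μ c w e := by
  have hsplit : ∀ u, IsFiniteEnergy μ w u → ∀ L, partialForm μ c w e u L =
      partialForm μ c w e (cut O u) L +
      (∑ ℓ ∈ Finset.range (L + 1), ∫ k, tupleEnergy (outer O) k *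
          energyDensity w e (outerPart O u ℓ) k ∂tupleMeasure μ ℓ +
        2 * ∑ ℓ ∈ Finset.range L, Real.sqrt (ℓ + 1) * ∫ z, tupleEnergy (outer O) z.2 *
          interactionDensity c (outerPart O u ℓ) (outerPart O u (ℓ + 1)) z
            ∂μ.prod (tupleMeasure μ ℓ)) := by
    intro u hu L
    have hcut : IsFiniteEnergy μ w (cut O u) :=
      isFiniteEnergy_cut hO (Set.eqOn_refl w O) (hu.restrict O)
    have h1 : ∀ ℓ, ∫ k, energyDensity w e (u ℓ) k ∂tupleMeasure μ ℓ = _ := fun ℓ =>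
      integral_split (hu.integrable_energyDensity hw e ℓ)
        (hcut.integrable_energyDensity hw e ℓ) (energyDensity_split (O := O) w e u ℓ)
    have h2 : ∀ ℓ, ∫ z, interactionDensity c (u ℓ) (u (ℓ + 1)) z ∂μ.prod (tupleMeasure μ ℓ) = _ :=
      fun ℓ => integral_split (hu.integrable_interaction hc hc2 ℓ)
        (hcut.integrable_interaction hc hc2 ℓ) (interactionDensity_split hc0 u ℓ)
    simp only [partialForm, interaction, h1, h2, Finset.sum_add_distrib, mul_add]
    ring
  have hcutpos : ∀ u, IsFiniteEnergy μ w u → ∀ L, 0 ≤ partialForm μ c w e (cut O u) L := by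
    intro u hu L
    rw [partialForm_cut hO (Set.eqOn_refl c O) (Set.eqOn_refl w O)]
    exact h u (hu.restrict O) L
  have hzero : ∀ k : Fin 0 → Momentum, tupleEnergy (outer O) k = 0 := fun k =>
    Finset.sum_of_isEmpty _
  intro u hu L
  -- The state must be generalized, because the induction hypothesis is applied to the fibers of the
  -- outer part, which contain one photon fewer.
  induction L generalizing u with
  | zero =>
    rw [hsplit u hu 0]
    simpa [hzero] using hcutpos u hu 0
  | succ L ih =>
    have hv : IsFiniteEnergy μ w (outerPart O u) := isFiniteEnergy_outerPart hO hw hu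
    rw [hsplit u hu (L + 1)]
    refine add_nonneg (hcutpos u hu (L + 1)) ?_
    -- The terms with no photon vanish, since nothing lies outside O. The remaining indices, lowered
    -- by one, are exactly those of the partial form of a fiber at L.
    rw [Finset.sum_range_succ' (fun ℓ => ∫ k, tupleEnergy (outer O) k *
        energyDensity w e (outerPart O u ℓ) k ∂tupleMeasure μ ℓ) (L + 1),
      Finset.sum_range_succ' (fun ℓ : ℕ => Real.sqrt (ℓ + 1) * ∫ z, tupleEnergy (outer O) z.2 *
        interactionDensity c (outerPart O u ℓ) (outerPart O u (ℓ + 1)) z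
          ∂μ.prod (tupleMeasure μ ℓ)) L]
    simp only [hzero, zero_mul, integral_zero, mul_zero, add_zero]
    have hE := fun ℓ => integral_outer_mul_energyDensity hO hw hw0 hv e ℓ
    have hI := fun ℓ => integral_outer_mul_interaction hO hc hc2 hv ℓ
    have e1 : ∑ ℓ ∈ Finset.range (L + 1), ∫ k, tupleEnergy (outer O) k *
          energyDensity w e (outerPart O u (ℓ + 1)) k ∂tupleMeasure μ (ℓ + 1) +
        2 * ∑ ℓ ∈ Finset.range L, Real.sqrt ((ℓ + 1 : ℕ) + 1) * ∫ z, tupleEnergy (outer O) z.2 *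
          interactionDensity c (outerPart O u (ℓ + 1)) (outerPart O u (ℓ + 1 + 1)) z
            ∂μ.prod (tupleMeasure μ (ℓ + 1)) =
        ∫ p, outer O p * partialForm μ c w e (fiber (outerPart O u) p) L ∂μ := by
      rw [Finset.sum_congr rfl fun ℓ _ => (hE ℓ).2, Finset.sum_congr rfl fun ℓ _ => (hI ℓ).2,
        ← integral_finsetSum _ fun ℓ _ => (hE ℓ).1, ← integral_finsetSum _ fun ℓ _ => (hI ℓ).1,
        ← integral_const_mul, ← integral_add (integrable_finsetSum _ fun ℓ _ => (hE ℓ).1)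
          ((integrable_finsetSum _ fun ℓ _ => (hI ℓ).1).const_mul 2)]
      refine integral_congr_ae (Filter.Eventually.of_forall fun p => ?_)
      simp only [partialForm, Finset.mul_sum, mul_add]
      congr 1
      refine Finset.sum_congr rfl fun ℓ _ => ?_
      ring
    rw [e1]
    refine integral_nonneg_of_ae ?_
    filter_upwards [isFiniteEnergy_fiber hw0 hv] with p hp
    by_cases hpO : p ∈ O
    · simp [outer_of_mem hpO]
    · exact mul_nonneg (outer_nonneg p) (ih _ (hp hpO))

end Decoupling

/-! ### Completing the square -/

section Perturbation

variable {μ : Measure Momentum} [SigmaFinite μ]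

theorem IsFiniteEnergy.mono {w w' : Momentum → ℝ} (hw' : Measurable w') (h0 : ∀ k, 0 ≤ w' k)
    (hle : ∀ k, w' k ≤ w k) {u : ∀ ℓ : ℕ, (Fin ℓ → Momentum) → Atom}
    (hu : IsFiniteEnergy μ w u) : IsFiniteEnergy μ w' u where
  measurable := hu.measurable
  perm := hu.perm
  integrable_sq := hu.integrable_sq
  integrable_energy_sq ℓ := by
    refine (hu.integrable_energy_sq ℓ).mono' (((measurable_tupleEnergy hw' ℓ).pow_const 2).mul
      ((hu.measurable ℓ).norm.pow_const 2)).aestronglyMeasurable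
      (Filter.Eventually.of_forall fun k => ?_)
    rw [Real.norm_of_nonneg (by positivity)]
    exact mul_le_mul_of_nonneg_right (pow_le_pow_left₀ (tupleEnergy_nonneg h0 k)
      (Finset.sum_le_sum fun i _ => hle _) 2) (sq_nonneg _)

/-- Completing the square in the interaction with photons of positive energy. -/
theorem photonEnergy_add_interaction_nonneg {c w : Momentum → ℝ} (hc : Measurable c)
    (hc2 : Integrable (fun k => c k ^ 2) μ) (hw : Measurable w) (hw0 : ∀ k, 0 ≤ w k)
    (hcw : ∀ k, c k ≠ 0 → 0 < w k) (hδi : Integrable (fun k => c k ^ 2 / w k) μ) {δ : ℝ}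
    (hδ : ∫ k, c k ^ 2 / w k ∂μ ≤ δ) {u : ∀ ℓ : ℕ, (Fin ℓ → Momentum) → Atom}
    (hu : IsFiniteEnergy μ w u) (ℓ : ℕ) :
    0 ≤ ∫ k, tupleEnergy w k * ‖u (ℓ + 1) k‖ ^ 2 ∂tupleMeasure μ (ℓ + 1) +
      δ * ∫ k, ‖u ℓ k‖ ^ 2 ∂tupleMeasure μ ℓ + 2 * interaction μ c (u ℓ) (u (ℓ + 1)) := by
  have h0 : Integrable (fun k : Fin (ℓ + 1) → Momentum => w (k 0) * ‖u (ℓ + 1) k‖ ^ 2)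
      (tupleMeasure μ (ℓ + 1)) := by
    refine (hu.integrable_energy hw (ℓ + 1)).mono' ((hw.comp (measurable_pi_apply 0)).mul
      ((hu.measurable (ℓ + 1)).norm.pow_const 2)).aestronglyMeasurable
      (Filter.Eventually.of_forall fun k => ?_)
    rw [Real.norm_of_nonneg (mul_nonneg (hw0 _) (sq_nonneg _))]
    exact mul_le_mul_of_nonneg_right (Finset.single_le_sum (f := fun i => w (k i))
      (fun j _ => hw0 _) (Finset.mem_univ 0)) (sq_nonneg _)
  -- The energy of ℓ + 1 photons is replaced by ℓ + 1 times that of the first, which is also the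
  -- photon created by the interaction. The square can then be completed pointwise.
  obtain ⟨hi, heq⟩ := integral_tupleEnergy_mul (χ := w) (F := fun k => ‖u (ℓ + 1) k‖ ^ 2)
    (fun s k => by simp only [hu.perm]) h0
  have h2 := hδi.mul_prod (hu.integrable_sq ℓ)
  have h3 := hu.integrable_interaction hc hc2 ℓ
  have h4 : (∫ k, c k ^ 2 / w k ∂μ) * ∫ k, ‖u ℓ k‖ ^ 2 ∂tupleMeasure μ ℓ ≤
      δ * ∫ k, ‖u ℓ k‖ ^ 2 ∂tupleMeasure μ ℓ :=
    mul_le_mul_of_nonneg_right hδ (integral_nonneg fun k => sq_nonneg _)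
  rw [← integral_prod_mul] at h4
  have h5 : 0 ≤ ∫ z, ((ℓ + 1 : ℕ) * (w z.1 * ‖u (ℓ + 1) (Fin.cons z.1 z.2)‖ ^ 2) +
      c z.1 ^ 2 / w z.1 * ‖u ℓ z.2‖ ^ 2) +
      2 * Real.sqrt (ℓ + 1) * interactionDensity c (u ℓ) (u (ℓ + 1)) z
        ∂μ.prod (tupleMeasure μ ℓ) := by
    refine integral_nonneg fun z => ?_
    have habs := abs_interactionDensity_le c (u ℓ) (u (ℓ + 1)) z
    set I := interactionDensity c (u ℓ) (u (ℓ + 1)) z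
    set a := ‖u (ℓ + 1) (Fin.cons z.1 z.2)‖
    set b := ‖u ℓ z.2‖
    have hs : Real.sqrt (ℓ + 1) ^ 2 = ((ℓ + 1 : ℕ) : ℝ) := by
      rw [Real.sq_sqrt (by positivity)]; push_cast; rfl
    set s := Real.sqrt (ℓ + 1)
    have hs0 : 0 ≤ s := Real.sqrt_nonneg _
    change 0 ≤ ((ℓ + 1 : ℕ) * (w z.1 * a ^ 2) + c z.1 ^ 2 / w z.1 * b ^ 2) + 2 * s * I
    rw [← hs]
    -- Where c vanishes, w may vanish too and the division by w below would be meaningless.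
    by_cases hcz : c z.1 = 0
    · have hI : I = 0 := by simpa [hcz] using habs
      rw [hI, hcz]
      have := hw0 z.1
      simp only [mul_zero, add_zero, ne_eq, OfNat.ofNat_ne_zero, not_false_eq_true, zero_pow,
        zero_div, zero_mul]
      positivity
    · have hwz := hcw _ hcz
      have hI : -(|c z.1| * (a * b)) ≤ I := (abs_le.1 habs).1
      have hI2 : 2 * s * -(|c z.1| * (a * b)) ≤ 2 * s * I :=
        mul_le_mul_of_nonneg_left hI (by positivity)
      have e : s ^ 2 * (w z.1 * a ^ 2) + c z.1 ^ 2 / w z.1 * b ^ 2 + 2 * s * -(|c z.1| * (a * b)) =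
          (s * w z.1 * a - |c z.1| * b) ^ 2 / w z.1 := by
        rw [← sq_abs (c z.1)]
        field_simp
        ring
      have e2 : 0 ≤ (s * w z.1 * a - |c z.1| * b) ^ 2 / w z.1 := by positivity
      linarith
  have hA := hi.const_mul ((ℓ + 1 : ℕ) : ℝ)
  have hAB : Integrable (fun z : Momentum × (Fin ℓ → Momentum) =>
      (ℓ + 1 : ℕ) * (w z.1 * ‖u (ℓ + 1) (Fin.cons z.1 z.2)‖ ^ 2) +
      c z.1 ^ 2 / w z.1 * ‖u ℓ z.2‖ ^ 2) (μ.prod (tupleMeasure μ ℓ)) := hA.add h2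
  rw [integral_add hAB (h3.const_mul _), integral_add hA h2, integral_const_mul,
    integral_const_mul, ← heq] at h5
  rw [interaction]
  linarith

theorem tupleEnergy_add {w w1 w2 : Momentum → ℝ} (h : ∀ k, w k = w1 k + w2 k) {ℓ : ℕ}
    (k : Fin ℓ → Momentum) : tupleEnergy w k = tupleEnergy w1 k + tupleEnergy w2 k := by
  simp only [tupleEnergy, h, Finset.sum_add_distrib]

/-- The effect of an additional interaction with photons of positive energy on the lower bounds of
the quadratic form. -/
theorem IsFormBound.add {c c1 c2 w w1 w2 : Momentum → ℝ} (hcadd : ∀ k, c k = c1 k + c2 k)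
    (hwadd : ∀ k, w k = w1 k + w2 k) (hc1 : Measurable c1)
    (hc1i : Integrable (fun k => c1 k ^ 2) μ) (hc2 : Measurable c2)
    (hc2i : Integrable (fun k => c2 k ^ 2) μ) (hw1 : Measurable w1) (hw10 : ∀ k, 0 ≤ w1 k)
    (hw2 : Measurable w2) (hw20 : ∀ k, 0 ≤ w2 k) (hcw : ∀ k, c2 k ≠ 0 → 0 < w2 k)
    (hδi : Integrable (fun k => c2 k ^ 2 / w2 k) μ) {δ : ℝ} (hδ : ∫ k, c2 k ^ 2 / w2 k ∂μ ≤ δ)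
    {e : ℝ} (h : IsFormBound μ c1 w1 e) : IsFormBound μ c w (e - δ) := by
  intro u hu L
  have hu1 : IsFiniteEnergy μ w1 u := hu.mono hw1 hw10 fun k => by
    rw [hwadd]; linarith [hw20 k]
  have hu2 : IsFiniteEnergy μ w2 u := hu.mono hw2 hw20 fun k => by
    rw [hwadd]; linarith [hw10 k]
  have hδ0 : 0 ≤ δ :=
    (integral_nonneg fun k => div_nonneg (sq_nonneg _) (hw20 k)).trans hδ
  have hE : ∀ ℓ, ∫ k, energyDensity w (e - δ) (u ℓ) k ∂tupleMeasure μ ℓ =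
      ∫ k, energyDensity w1 e (u ℓ) k ∂tupleMeasure μ ℓ +
        (∫ k, tupleEnergy w2 k * ‖u ℓ k‖ ^ 2 ∂tupleMeasure μ ℓ +
          δ * ∫ k, ‖u ℓ k‖ ^ 2 ∂tupleMeasure μ ℓ) := fun ℓ => by
    have hi := hu2.integrable_energy hw2 ℓ
    have hi' := (hu.integrable_sq ℓ).const_mul δ
    have hii : Integrable (fun k => tupleEnergy w2 k * ‖u ℓ k‖ ^ 2 + δ * ‖u ℓ k‖ ^ 2)
      (tupleMeasure μ ℓ) := hi.add hi'
    rw [← integral_const_mul, ← integral_add hi hi',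
      ← integral_add (hu1.integrable_energyDensity hw1 e ℓ) hii]
    refine integral_congr_ae (Filter.Eventually.of_forall fun k => ?_)
    simp only [energyDensity, tupleEnergy_add hwadd]
    ring
  have hI : ∀ ℓ, interaction μ c (u ℓ) (u (ℓ + 1)) =
      interaction μ c1 (u ℓ) (u (ℓ + 1)) + interaction μ c2 (u ℓ) (u (ℓ + 1)) := fun ℓ => by
    rw [interaction, interaction, interaction, ← mul_add,
      ← integral_add (hu.integrable_interaction hc1 hc1i ℓ)
        (hu.integrable_interaction hc2 hc2i ℓ)]
    congr 1
    refine integral_congr_ae (Filter.Eventually.of_forall fun z => ?_)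
    simp only [interactionDensity, hcadd]
    ring
  have hsq := fun ℓ =>
    photonEnergy_add_interaction_nonneg hc2 hc2i hw2 hw20 hcw hδi hδ hu2 ℓ
  have hX : ∀ ℓ, 0 ≤ ∫ k, tupleEnergy w2 k * ‖u ℓ k‖ ^ 2 ∂tupleMeasure μ ℓ := fun ℓ =>
    integral_nonneg fun k => mul_nonneg (tupleEnergy_nonneg hw20 k) (sq_nonneg _)
  have hN : ∀ ℓ, 0 ≤ δ * ∫ k, ‖u ℓ k‖ ^ 2 ∂tupleMeasure μ ℓ := fun ℓ =>
    mul_nonneg hδ0 (integral_nonneg fun k => sq_nonneg _)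
  have hmain := h u hu1 L
  rw [partialForm] at hmain ⊢
  simp only [hE, hI, Finset.sum_add_distrib]
  -- Each square uses the energy of the sector ℓ + 1 and δ times the norm of the sector ℓ, for ℓ <
  -- L. The energy of the sector 0 and the δ term of the sector L are left over and are nonnegative.
  have h1 := Finset.sum_nonneg fun ℓ (_ : ℓ ∈ Finset.range L) => hsq ℓ
  rw [Finset.sum_add_distrib, Finset.sum_add_distrib] at h1
  rw [Finset.sum_range_succ' (fun ℓ => ∫ k, tupleEnergy w2 k * ‖u ℓ k‖ ^ 2 ∂tupleMeasure μ ℓ) L,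
    Finset.sum_range_succ (fun ℓ => δ * ∫ k, ‖u ℓ k‖ ^ 2 ∂tupleMeasure μ ℓ) L]
  simp only [← Finset.mul_sum] at h1 ⊢
  linarith [hX 0, hN L]

theorem isFormBound_zero : IsFormBound μ 0 0 0 := fun u _ L => by
  have hI : ∀ ℓ, interaction μ 0 (u ℓ) (u (ℓ + 1)) = 0 := fun ℓ => by
    simp [interaction, interactionDensity]
  rw [partialForm]
  simp only [hI, Finset.sum_const_zero, mul_zero, add_zero]
  refine Finset.sum_nonneg fun ℓ _ => integral_nonneg fun k => ?_
  simpa [energyDensity, tupleEnergy] using atomForm_nonneg _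

/-- The infimum of the spectrum of a spin-boson Hamiltonian is the largest lower bound of its
quadratic form on states with finitely many photons. -/
theorem isGreatest_infSpectrum_spinBoson {c w : Momentum → ℝ} (hc : Measurable c)
    (hc2 : MemLp c 2 μ) (hwm : Measurable w) (hw : ∀ k, 0 ≤ w k) {r : ℝ} (hr0 : 0 < r)
    (hr : ∀ᵐ k ∂μ, r ≤ w k) (hcw : ∀ k, c k ≠ 0 → 0 < w k)
    (hci : Integrable (fun k => c k ^ 2 / w k) μ) :
    IsGLB (Complex.re '' spectrum (spinBoson μ c w)) (infSpectrum (spinBoson μ c w)) ∧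
      IsGreatest {e | IsFormBound μ c w e} (infSpectrum (spinBoson μ c w)) := by
  -- Starting from the atom alone, whose form is nonnegative, and switching on all photons gives the
  -- a priori lower bound that makes the infimum of the spectrum meaningful.
  have hb : IsFormBound μ c w (0 - ∫ k, c k ^ 2 / w k ∂μ) :=
    (isFormBound_zero (μ := μ)).add (c2 := c) (w2 := w) (by simp) (by simp) measurable_zero
      (by simp) hc hc2.integrable_sq measurable_zero (by simp) hwm hw hcw hci le_rfl
  obtain ⟨h1, h2, h3⟩ := infSpectrum_spec (isSelfAdjoint_spinBoson hc hc2 hwm hw hr0 hr)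
    (form_ge_of_isFormBound hc hc2 hwm hw hr0 hr hb)
  exact ⟨h1, isFormBound_of_form_ge hc hc2 hwm hw hr0 hr h2, fun e he =>
    h3 (form_ge_of_isFormBound hc hc2 hwm hw hr0 hr he)⟩

end Perturbation

/-! ### Independence of null sets -/

section Congruence

variable {μ : Measure Momentum} [SigmaFinite μ]

theorem maximalOp_congr {T T' : Fock μ → ∀ ℓ : ℕ, (Fin ℓ → Momentum) → Atom} {hadd hsmul hadd' hsmul'}
    (h : ∀ ψ ℓ, T ψ ℓ =ᵐ[tupleMeasure μ ℓ] T' ψ ℓ) :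
    maximalOp T hadd hsmul = maximalOp T' hadd' hsmul' := by
  refine LinearPMap.ext ?_ ?_
  · ext ψ
    exact exists_congr fun η => forall_congr' fun ℓ =>
      ⟨fun h1 => h1.trans (h ψ ℓ), fun h1 => h1.trans (h ψ ℓ).symm⟩
  · intro ψ h1 h2
    exact comp_ext fun ℓ => (comp_maximalOp ⟨ψ, h1⟩ ℓ).trans
      ((h ψ ℓ).trans (comp_maximalOp ⟨ψ, h2⟩ ℓ).symm)

/-- The coupling enters only through its almost everywhere class, so f may be replaced by a
measurable representative bounded everywhere. -/
theorem creation_congr {G G' : Momentum → Matrix (Fin 2) (Fin 2) ℂ} (h : G =ᵐ[μ] G') :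
    creation μ G = creation μ G' := by
  refine maximalOp_congr fun ψ ℓ => ?_
  cases ℓ with
  | zero => exact Filter.EventuallyEq.rfl
  | succ ℓ =>
    have h1 : ∀ᵐ k ∂tupleMeasure μ (ℓ + 1), ∀ i, G (k i) = G' (k i) :=
      ae_all_iff.2 fun i =>
        (Measure.quasiMeasurePreserving_eval (fun _ : Fin (ℓ + 1) => μ) i).ae h
    filter_upwards [h1] with k hk
    simp only [creationComp, hk]

theorem field_congr {G G' : Momentum → Matrix (Fin 2) (Fin 2) ℂ} (h : G =ᵐ[μ] G') :
    field μ G = field μ G' := by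
  rw [field, field, annihilation, annihilation, creation_congr h]

theorem IsFormBound.congr_measure {ν : Measure Momentum} [SigmaFinite ν] (h : μ = ν)
    {c w : Momentum → ℝ} {e : ℝ} (he : IsFormBound μ c w e) : IsFormBound ν c w e := by
  subst h
  exact he

end Congruence

/-! ### The concrete coupling and the energy of one momentum shell -/

section Concrete

/-- The scalar coupling function. -/
def scalarCoupling (g κ : ℝ) (f : Momentum → ℝ) (k : Momentum) : ℝ :=
  g * (Set.indicator {p : Momentum | ‖p‖ < κ} (fun _ => (1 : ℝ)) k
    / (4 * Real.pi * Real.sqrt (dispersion k))) * f k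

/-- The scalar coupling function with infrared cutoff. -/
def cutoffCoupling (g κ γ : ℝ) (f : Momentum → ℝ) (n : ℕ) : Momentum → ℝ :=
  (outside κ γ n).indicator (scalarCoupling g κ f)

/-- The photon dispersion relation with infrared cutoff. -/
def cutoffDispersion (κ γ : ℝ) (n : ℕ) : Momentum → ℝ := (outside κ γ n).indicator dispersion

theorem hamiltonian_eq_spinBoson (g κ γ : ℝ) {f f' : Momentum → ℝ} (h : f =ᵐ[volume] f') (n : ℕ) :
    hamiltonian g κ γ f n =
      spinBoson (outsideMeasure κ γ n) (cutoffCoupling g κ γ f' n) (cutoffDispersion κ γ n) := by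
  have hG : (outside κ γ n).indicator (coupling g κ f) =ᵐ[outsideMeasure κ γ n]
      pauliCoupling (cutoffCoupling g κ γ f' n) := by
    filter_upwards [ae_restrict_of_ae h] with k hk
    by_cases hk' : k ∈ outside κ γ n
    · simp only [cutoffCoupling, pauliCoupling, Set.indicator_of_mem hk', coupling, scalarCoupling,
        hk]
    · simp [cutoffCoupling, pauliCoupling, Set.indicator_of_notMem hk']
  rw [hamiltonian, spinBoson, field_congr hG]
  rfl

theorem exists_measurable_bounded_representative {f : Momentum → ℝ} (hf : MemLp f ⊤ volume)
    (hf1 : eLpNorm f ⊤ volume ≤ 1) :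
    ∃ f' : Momentum → ℝ, Measurable f' ∧ (∀ k, |f' k| ≤ 1) ∧ f =ᵐ[volume] f' := by
  have hm := hf.1.stronglyMeasurable_mk.measurable
  have hs : MeasurableSet {k | |hf.1.mk f k| ≤ 1} := measurableSet_le hm.abs measurable_const
  refine ⟨{k | |hf.1.mk f k| ≤ 1}.indicator (hf.1.mk f), hm.indicator hs, fun k => ?_, ?_⟩
  · by_cases hk : k ∈ {k | |hf.1.mk f k| ≤ 1}
    · rw [Set.indicator_of_mem hk]; exact hk
    · rw [Set.indicator_of_notMem hk]; simp
  · rw [eLpNorm_exponent_top] at hf1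
    filter_upwards [hf.1.ae_eq_mk, ae_le_eLpNormEssSup (f := f) (μ := volume)] with k h1 h2
    have h3 : |f k| ≤ 1 := by
      have h4 := h2.trans hf1
      rw [← ofReal_norm, ENNReal.ofReal_le_one] at h4
      exact h4
    rw [Set.indicator_of_mem, h1]
    rw [Set.mem_ofPred_eq, ← h1]
    exact h3

variable {g κ γ : ℝ} {f : Momentum → ℝ}

theorem measurable_dispersion : Measurable dispersion := measurable_norm

theorem measurableSet_outside (κ γ : ℝ) (n : ℕ) : MeasurableSet (outside κ γ n) :=
  (measurableSet_lt measurable_norm measurable_const).compl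

theorem measurable_scalarCoupling (hf : Measurable f) : Measurable (scalarCoupling g κ f) := by
  have h1 : Measurable (Set.indicator {p : Momentum | ‖p‖ < κ} fun _ => (1 : ℝ)) :=
    measurable_const.indicator (measurableSet_lt measurable_norm measurable_const)
  exact ((h1.div (measurable_dispersion.sqrt.const_mul _)).const_mul g).mul hf

theorem measurable_cutoffCoupling (hf : Measurable f) (n : ℕ) :
    Measurable (cutoffCoupling g κ γ f n) :=
  (measurable_scalarCoupling hf).indicator (measurableSet_outside κ γ n)

theorem measurable_cutoffDispersion (n : ℕ) : Measurable (cutoffDispersion κ γ n) :=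
  measurable_dispersion.indicator (measurableSet_outside κ γ n)

theorem cutoffDispersion_nonneg (n : ℕ) (k : Momentum) : 0 ≤ cutoffDispersion κ γ n k :=
  Set.indicator_nonneg (fun k _ => norm_nonneg k) k

theorem cutoff_pos (hκ : 0 < κ) (hγ : 0 < γ) (n : ℕ) : 0 < cutoff κ γ n :=
  mul_pos hκ (pow_pos hγ n)

theorem le_norm_of_mem_outside {n : ℕ} {k : Momentum} (hk : k ∈ outside κ γ n) :
    cutoff κ γ n ≤ ‖k‖ := not_lt.1 hk

theorem outside_subset (hκ : 0 < κ) (hγ : 0 < γ) (hγ1 : γ < 1) (n : ℕ) :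
    outside κ γ n ⊆ outside κ γ (n + 1) := fun k hk => by
  have h1 := le_norm_of_mem_outside hk
  have h2 : cutoff κ γ (n + 1) ≤ cutoff κ γ n := by
    rw [cutoff, cutoff]
    exact mul_le_mul_of_nonneg_left (pow_le_pow_of_le_one hγ.le hγ1.le n.le_succ) hκ.le
  exact not_lt.2 (h2.trans h1)

theorem scalarCoupling_sq_le (hf1 : ∀ k, |f k| ≤ 1) (k : Momentum) :
    scalarCoupling g κ f k ^ 2 ≤ g ^ 2 / (16 * Real.pi ^ 2) *
      (Metric.ball (0 : Momentum) κ).indicator (fun k => ‖k‖⁻¹) k := by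
  by_cases hk : ‖k‖ < κ
  · have h1 : k ∈ Metric.ball (0 : Momentum) κ := by simpa using hk
    have h2 : k ∈ {p : Momentum | ‖p‖ < κ} := hk
    rw [scalarCoupling, Set.indicator_of_mem h1, Set.indicator_of_mem h2, mul_pow, mul_pow, div_pow,
      mul_pow, mul_pow, dispersion, Real.sq_sqrt (norm_nonneg k)]
    have h3 : f k ^ 2 ≤ 1 := by rw [sq_le_one_iff_abs_le_one]; exact hf1 k
    have h4 : g ^ 2 * (1 ^ 2 / (4 ^ 2 * Real.pi ^ 2 * ‖k‖)) =
        g ^ 2 / (16 * Real.pi ^ 2) * ‖k‖⁻¹ := by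
      rw [one_pow, mul_one_div, ← div_eq_mul_inv, div_div]
      norm_num
    rw [h4]
    exact mul_le_of_le_one_right (by positivity) h3
  · have h1 : k ∉ Metric.ball (0 : Momentum) κ := by simpa using hk
    have h2 : k ∉ {p : Momentum | ‖p‖ < κ} := hk
    rw [scalarCoupling, Set.indicator_of_notMem h1, Set.indicator_of_notMem h2]
    simp

/-- Outside the removed ball 1 / |k| ≤ 1 / ρ_n, so the cut coupling is bounded with bounded support,
hence square integrable. -/
theorem cutoffCoupling_sq_le (hκ : 0 < κ) (hγ : 0 < γ) (hf1 : ∀ k, |f k| ≤ 1) (n : ℕ)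
    (k : Momentum) : cutoffCoupling g κ γ f n k ^ 2 ≤
      (Metric.ball (0 : Momentum) κ).indicator
        (fun _ => g ^ 2 / (16 * Real.pi ^ 2) * (cutoff κ γ n)⁻¹) k := by
  have hpos := cutoff_pos hκ hγ n
  by_cases hk : k ∈ outside κ γ n
  · rw [cutoffCoupling, Set.indicator_of_mem hk]
    refine (scalarCoupling_sq_le hf1 k).trans ?_
    by_cases hb : k ∈ Metric.ball (0 : Momentum) κ
    · rw [Set.indicator_of_mem hb, Set.indicator_of_mem hb]
      exact mul_le_mul_of_nonneg_left (inv_anti₀ hpos (le_norm_of_mem_outside hk)) (by positivity)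
    · rw [Set.indicator_of_notMem hb, Set.indicator_of_notMem hb, mul_zero]
  · rw [cutoffCoupling, Set.indicator_of_notMem hk]
    simp only [ne_eq, OfNat.ofNat_ne_zero, not_false_eq_true, zero_pow]
    exact Set.indicator_nonneg (fun _ _ => by positivity) k

theorem integrable_ball_const (κ C : ℝ) :
    Integrable ((Metric.ball (0 : Momentum) κ).indicator fun _ => C) volume :=
  (integrable_indicator_iff Metric.isOpen_ball.measurableSet).2
    (integrableOn_const measure_ball_lt_top.ne)

theorem integrable_cutoffCoupling_sq (hκ : 0 < κ) (hγ : 0 < γ) (hfm : Measurable f)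
    (hf1 : ∀ k, |f k| ≤ 1) (n : ℕ) :
    Integrable (fun k => cutoffCoupling g κ γ f n k ^ 2) volume := by
  refine (integrable_ball_const κ (g ^ 2 / (16 * Real.pi ^ 2) * (cutoff κ γ n)⁻¹)).mono'
    ((measurable_cutoffCoupling hfm n).pow_const 2).aestronglyMeasurable
    (Filter.Eventually.of_forall fun k => ?_)
  rw [Real.norm_of_nonneg (sq_nonneg _)]
  exact cutoffCoupling_sq_le hκ hγ hf1 n k

theorem cutoffDispersion_pos_of_coupling_ne_zero (hκ : 0 < κ) (hγ : 0 < γ) (n : ℕ) (k : Momentum)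
    (hk : cutoffCoupling g κ γ f n k ≠ 0) : 0 < cutoffDispersion κ γ n k := by
  have h := Set.mem_of_indicator_ne_zero hk
  rw [cutoffDispersion, Set.indicator_of_mem h]
  exact (cutoff_pos hκ hγ n).trans_le (le_norm_of_mem_outside h)

theorem integrable_cutoffCoupling_sq_div (hκ : 0 < κ) (hγ : 0 < γ) (hfm : Measurable f)
    (hf1 : ∀ k, |f k| ≤ 1) (n : ℕ) :
    Integrable (fun k => cutoffCoupling g κ γ f n k ^ 2 / cutoffDispersion κ γ n k) volume := by
  have hpos := cutoff_pos hκ hγ n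
  refine ((integrable_cutoffCoupling_sq (g := g) hκ hγ hfm hf1 n).mul_const (cutoff κ γ n)⁻¹).mono'
    (((measurable_cutoffCoupling hfm n).pow_const 2).div
      (measurable_cutoffDispersion n)).aestronglyMeasurable
    (Filter.Eventually.of_forall fun k => ?_)
  rw [Real.norm_of_nonneg (div_nonneg (sq_nonneg _) (cutoffDispersion_nonneg n k)),
    div_eq_mul_inv]
  by_cases hk : k ∈ outside κ γ n
  · rw [cutoffDispersion, Set.indicator_of_mem hk]
    exact mul_le_mul_of_nonneg_left (inv_anti₀ hpos (le_norm_of_mem_outside hk)) (sq_nonneg _)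
  · rw [cutoffCoupling, Set.indicator_of_notMem hk]
    simp

theorem isGreatest_groundEnergy (hκ : 0 < κ) (hγ : 0 < γ) {f' : Momentum → ℝ}
    (hff' : f =ᵐ[volume] f') (hfm : Measurable f') (hf1 : ∀ k, |f' k| ≤ 1) (n : ℕ) :
    IsSelfAdjoint (hamiltonian g κ γ f n) ∧
      IsGLB (Complex.re '' spectrum (hamiltonian g κ γ f n)) (groundEnergy g κ γ f n) ∧
      IsGreatest {e | IsFormBound (outsideMeasure κ γ n) (cutoffCoupling g κ γ f' n)
        (cutoffDispersion κ γ n) e} (groundEnergy g κ γ f n) := by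
  have hc := measurable_cutoffCoupling (g := g) (κ := κ) (γ := γ) hfm n
  have hc2 : MemLp (cutoffCoupling g κ γ f' n) 2 (outsideMeasure κ γ n) :=
    (memLp_two_iff_integrable_sq hc.aestronglyMeasurable).2
      (integrable_cutoffCoupling_sq hκ hγ hfm hf1 n).restrict
  have hw := measurable_cutoffDispersion (κ := κ) (γ := γ) n
  have hr : ∀ᵐ k ∂outsideMeasure κ γ n, cutoff κ γ n ≤ cutoffDispersion κ γ n k := by
    filter_upwards [ae_restrict_mem (measurableSet_outside κ γ n)] with k hk
    rw [cutoffDispersion, Set.indicator_of_mem hk]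
    exact le_norm_of_mem_outside hk
  rw [groundEnergy, hamiltonian_eq_spinBoson g κ γ hff' n]
  exact ⟨isSelfAdjoint_spinBoson hc hc2 hw (cutoffDispersion_nonneg n) (cutoff_pos hκ hγ n) hr,
    isGreatest_infSpectrum_spinBoson hc hc2 hw (cutoffDispersion_nonneg n) (cutoff_pos hκ hγ n) hr
      (cutoffDispersion_pos_of_coupling_ne_zero hκ hγ n)
      (integrable_cutoffCoupling_sq_div hκ hγ hfm hf1 n).restrict⟩

/-- The integral of `|k|⁻²` over a ball of radius `r` in `ℝ³` is `4 π r`. -/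
theorem integral_ball_inv_norm_sq {r : ℝ} (hr : 0 ≤ r) :
    Integrable (fun k : Momentum => (Set.Iio r).indicator (fun y : ℝ => (y ^ 2)⁻¹) ‖k‖) volume ∧
      ∫ k : Momentum, (Set.Iio r).indicator (fun y : ℝ => (y ^ 2)⁻¹) ‖k‖ = 4 * Real.pi * r := by
  have hdim : Module.finrank ℝ Momentum = 3 := by simp
  -- In polar coordinates the Jacobian y² cancels y⁻², leaving the length r. The remaining factor is
  -- 3 times the volume 4π/3 of the unit ball.
  have hfun : Set.EqOn (fun y : ℝ => y ^ (3 - 1) • (Set.Iio r).indicator (fun y : ℝ => (y ^ 2)⁻¹) y)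
      ((Set.Iio r).indicator fun _ => 1) (Set.Ioi 0) := by
    intro y hy
    have hy' : (0 : ℝ) < y := hy
    by_cases h : y ∈ Set.Iio r
    · simp only [Set.indicator_of_mem h, smul_eq_mul]
      have : y ^ (3 - 1) = y ^ 2 := rfl
      rw [this, mul_inv_cancel₀ (by positivity)]
    · simp only [Set.indicator_of_notMem h, smul_zero]
  have hset : Set.Iio r ∩ Set.Ioi 0 = Set.Ioo 0 r := by
    ext y; simp [and_comm]
  refine ⟨?_, ?_⟩
  · rw [integrable_fun_norm_addHaar, hdim, integrableOn_congr_fun hfun measurableSet_Ioi,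
      IntegrableOn, integrable_indicator_iff measurableSet_Iio, IntegrableOn,
      Measure.restrict_restrict measurableSet_Iio, hset]
    exact integrableOn_const (by simp)
  · rw [integral_fun_norm_addHaar, hdim, setIntegral_congr_fun measurableSet_Ioi hfun,
      integral_indicator measurableSet_Iio, Measure.restrict_restrict measurableSet_Iio, hset]
    have hv : (volume : Measure Momentum).real (Metric.ball 0 1) = Real.pi * 4 / 3 := by
      rw [Measure.real, EuclideanSpace.volume_ball_fin_three]
      simp [ENNReal.toReal_ofReal, (by positivity : 0 ≤ Real.pi * 4 / 3)]
    rw [hv]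
    simp [hr]
    ring

/-- Coupling and dispersion change only on the shell between the two cutoffs, where their increments
are the full coupling and |k|. -/
theorem cutoff_increment_cases (hκ : 0 < κ) (hγ : 0 < γ) (hγ1 : γ < 1) (g : ℝ) (f : Momentum → ℝ)
    (n : ℕ) (k : Momentum) :
    cutoffCoupling g κ γ f (n + 1) k - cutoffCoupling g κ γ f n k = 0 ∧
        cutoffDispersion κ γ (n + 1) k - cutoffDispersion κ γ n k = 0 ∨
      0 < ‖k‖ ∧ ‖k‖ < cutoff κ γ n ∧
        cutoffCoupling g κ γ f (n + 1) k - cutoffCoupling g κ γ f n k = scalarCoupling g κ f k ∧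
        cutoffDispersion κ γ (n + 1) k - cutoffDispersion κ γ n k = ‖k‖ ∧
        cutoffCoupling g κ γ f (n + 1) k = scalarCoupling g κ f k := by
  by_cases h1 : k ∈ outside κ γ n
  · have h2 := outside_subset hκ hγ hγ1 n h1
    left
    simp only [cutoffCoupling, cutoffDispersion, Set.indicator_of_mem h1, Set.indicator_of_mem h2,
      sub_self, and_self]
  · by_cases h2 : k ∈ outside κ γ (n + 1)
    · right
      refine ⟨(cutoff_pos hκ hγ _).trans_le (le_norm_of_mem_outside h2), not_not.1 h1, ?_⟩
      simp only [cutoffCoupling, cutoffDispersion, Set.indicator_of_notMem h1,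
        Set.indicator_of_mem h2, sub_zero, dispersion, and_self]
    · left
      simp only [cutoffCoupling, cutoffDispersion, Set.indicator_of_notMem h1,
        Set.indicator_of_notMem h2, sub_self, and_self]

/-- On the shell this is |G|² / |k|, with |G|² at most g² / (16π² |k|). Off the shell the left side
is 0 / 0 = 0, so the bound may be extended to the whole ball of radius ρ_n. -/
theorem increment_sq_div_le (hκ : 0 < κ) (hγ : 0 < γ) (hγ1 : γ < 1) (hf1 : ∀ k, |f k| ≤ 1) (n : ℕ)
    (k : Momentum) :
    (cutoffCoupling g κ γ f (n + 1) k - cutoffCoupling g κ γ f n k) ^ 2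
      / (cutoffDispersion κ γ (n + 1) k - cutoffDispersion κ γ n k) ≤
    g ^ 2 / (16 * Real.pi ^ 2) *
      (Set.Iio (cutoff κ γ n)).indicator (fun y : ℝ => (y ^ 2)⁻¹) ‖k‖ := by
  rcases cutoff_increment_cases hκ hγ hγ1 g f n k with ⟨h1, h2⟩ | ⟨h0, hlt, h1, h2, -⟩
  · rw [h1, h2, div_zero]
    exact mul_nonneg (by positivity) (Set.indicator_nonneg (fun _ _ => by positivity) _)
  · rw [h1, h2, Set.indicator_of_mem (Set.mem_Iio.2 hlt), div_le_iff₀ h0, mul_assoc]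
    refine (scalarCoupling_sq_le hf1 k).trans (mul_le_mul_of_nonneg_left ?_ (by positivity))
    have h3 : (‖k‖ ^ 2)⁻¹ * ‖k‖ = ‖k‖⁻¹ := by field_simp
    rw [h3]
    exact Set.indicator_le_self' (fun _ _ => by positivity) k

theorem increment_sq_div_nonneg (hκ : 0 < κ) (hγ : 0 < γ) (hγ1 : γ < 1) (n : ℕ) (k : Momentum) :
    0 ≤ (cutoffCoupling g κ γ f (n + 1) k - cutoffCoupling g κ γ f n k) ^ 2
      / (cutoffDispersion κ γ (n + 1) k - cutoffDispersion κ γ n k) := by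
  rcases cutoff_increment_cases hκ hγ hγ1 g f n k with ⟨h1, h2⟩ | ⟨h0, -, h1, h2, -⟩
  · rw [h2, div_zero]
  · rw [h2]; positivity

/-- The interaction with the photons between two cutoffs shifts the energy by at most `g ρ_n`. -/
theorem integral_increment_le (hg : 0 < g) (hg1 : g < 1) (hκ : 0 < κ) (hγ : 0 < γ) (hγ1 : γ < 1)
    (hfm : Measurable f) (hf1 : ∀ k, |f k| ≤ 1) (n : ℕ) :
    Integrable (fun k => (cutoffCoupling g κ γ f (n + 1) k - cutoffCoupling g κ γ f n k) ^ 2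
        / (cutoffDispersion κ γ (n + 1) k - cutoffDispersion κ γ n k))
        (outsideMeasure κ γ (n + 1)) ∧
      ∫ k, (cutoffCoupling g κ γ f (n + 1) k - cutoffCoupling g κ γ f n k) ^ 2
        / (cutoffDispersion κ γ (n + 1) k - cutoffDispersion κ γ n k)
        ∂outsideMeasure κ γ (n + 1) ≤ g * cutoff κ γ n := by
  have hρ := cutoff_pos hκ hγ n
  obtain ⟨h1, h2⟩ := integral_ball_inv_norm_sq hρ.le
  have h3 := h1.const_mul (g ^ 2 / (16 * Real.pi ^ 2))
  have hm : Measurable fun k => (cutoffCoupling g κ γ f (n + 1) k - cutoffCoupling g κ γ f n k) ^ 2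
      / (cutoffDispersion κ γ (n + 1) k - cutoffDispersion κ γ n k) :=
    (((measurable_cutoffCoupling hfm _).sub (measurable_cutoffCoupling hfm _)).pow_const 2).div
      ((measurable_cutoffDispersion _).sub (measurable_cutoffDispersion _))
  have h4 : Integrable (fun k =>
      (cutoffCoupling g κ γ f (n + 1) k - cutoffCoupling g κ γ f n k) ^ 2
        / (cutoffDispersion κ γ (n + 1) k - cutoffDispersion κ γ n k)) volume := by
    refine h3.mono' hm.aestronglyMeasurable (Filter.Eventually.of_forall fun k => ?_)
    rw [Real.norm_of_nonneg (increment_sq_div_nonneg hκ hγ hγ1 n k)]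
    exact increment_sq_div_le hκ hγ hγ1 hf1 n k
  refine ⟨h4.restrict, (setIntegral_le_integral h4 (Filter.Eventually.of_forall
    (increment_sq_div_nonneg hκ hγ hγ1 n))).trans
      ((integral_mono h4 h3 (increment_sq_div_le hκ hγ hγ1 hf1 n)).trans ?_)⟩
  rw [integral_const_mul, h2]
  have hπ := Real.pi_gt_three
  -- The integral gives g² ρ_n / (4π); the spare factor g / (4π) is below 1.
  have h5 : g ^ 2 / (16 * Real.pi ^ 2) * (4 * Real.pi * cutoff κ γ n) =
      g / (4 * Real.pi) * (g * cutoff κ γ n) := by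
    field_simp
    norm_num
  rw [h5]
  refine mul_le_of_le_one_left (by positivity) ((div_le_one (by positivity)).2 ?_)
  linarith

theorem outsideMeasure_restrict (hκ : 0 < κ) (hγ : 0 < γ) (hγ1 : γ < 1) (n : ℕ) :
    (outsideMeasure κ γ (n + 1)).restrict (outside κ γ n) = outsideMeasure κ γ n :=
  Measure.restrict_restrict_of_subset (outside_subset hκ hγ hγ1 n)

/-- Removing the photons between two cutoffs does not decrease the form bound. -/
theorem IsFormBound.of_succ (hκ : 0 < κ) (hγ : 0 < γ) (hγ1 : γ < 1) {n : ℕ} {e : ℝ}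
    (h : IsFormBound (outsideMeasure κ γ (n + 1)) (cutoffCoupling g κ γ f (n + 1))
      (cutoffDispersion κ γ (n + 1)) e) :
    IsFormBound (outsideMeasure κ γ n) (cutoffCoupling g κ γ f n) (cutoffDispersion κ γ n) e := by
  have hsub := outside_subset hκ hγ hγ1 n
  refine IsFormBound.congr_measure (outsideMeasure_restrict hκ hγ hγ1 n)
    (h.restrict (measurableSet_outside κ γ n) (fun k hk => ?_) fun k hk => ?_)
  · rw [cutoffCoupling, cutoffCoupling, Set.indicator_of_mem hk, Set.indicator_of_mem (hsub hk)]
  · rw [cutoffDispersion, cutoffDispersion, Set.indicator_of_mem hk,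
      Set.indicator_of_mem (hsub hk)]

/-- Adding the photons between two cutoffs decreases the form bound by at most `g ρ_n`. -/
theorem IsFormBound.succ (hg : 0 < g) (hg1 : g < 1) (hκ : 0 < κ) (hγ : 0 < γ) (hγ1 : γ < 1)
    (hfm : Measurable f) (hf1 : ∀ k, |f k| ≤ 1) {n : ℕ} {e : ℝ}
    (h : IsFormBound (outsideMeasure κ γ n) (cutoffCoupling g κ γ f n)
      (cutoffDispersion κ γ n) e) :
    IsFormBound (outsideMeasure κ γ (n + 1)) (cutoffCoupling g κ γ f (n + 1))
      (cutoffDispersion κ γ (n + 1)) (e - g * cutoff κ γ n) := by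
  have hcm := fun n => measurable_cutoffCoupling (g := g) (κ := κ) (γ := γ) hfm n
  have hwm := fun n => measurable_cutoffDispersion (κ := κ) (γ := γ) n
  have hci := fun n => (integrable_cutoffCoupling_sq (g := g) hκ hγ hfm hf1 n)
  -- The shell photons are first adjoined with the old coupling and dispersion, which vanish on
  -- them.
  have h1 := IsFormBound.of_restrict (measurableSet_outside κ γ n) (hcm n) (hci n).restrict
    (fun k hk => Set.indicator_of_notMem hk _) (hwm n)
    (fun k hk => Set.indicator_of_notMem hk _)
    (h.congr_measure (outsideMeasure_restrict hκ hγ hγ1 n).symm)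
  have hcases := cutoff_increment_cases hκ hγ hγ1 g f n
  obtain ⟨hi, hle⟩ := integral_increment_le hg hg1 hκ hγ hγ1 hfm hf1 n
  -- The increments then switch on their energy and interaction, at a cost bounded by g ρ_n.
  refine h1.add (fun k => (add_sub_cancel _ _).symm) (fun k => (add_sub_cancel _ _).symm)
    (hcm n) (hci n).restrict ((hcm (n + 1)).sub (hcm n)) ?_ (hwm n) (cutoffDispersion_nonneg n)
    ((hwm (n + 1)).sub (hwm n)) (fun k => ?_) (fun k hk => ?_) hi hle
  · refine ((hci (n + 1)).mono' (((hcm (n + 1)).sub (hcm n)).pow_const 2).aestronglyMeasurable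
      (Filter.Eventually.of_forall fun k => ?_)).restrict
    rw [Real.norm_of_nonneg (sq_nonneg _)]
    change (cutoffCoupling g κ γ f (n + 1) k - cutoffCoupling g κ γ f n k) ^ 2 ≤ _
    rcases hcases k with ⟨h2, -⟩ | ⟨-, -, h2, -, h3⟩
    · rw [h2, zero_pow two_ne_zero]; exact sq_nonneg _
    · rw [h2, h3]
  · rcases hcases k with ⟨-, h2⟩ | ⟨h0, -, -, h2, -⟩
    · simp only [h2]; exact le_rfl
    · simp only [h2]; exact h0.le
  · rcases hcases k with ⟨h2, -⟩ | ⟨h0, -, -, h2, -⟩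
    · exact absurd h2 hk
    · simp only [h2]; exact h0

end Concrete

end SpinBoson

end

/-- A real greatest lower bound exists only for a nonempty set bounded below, so `IsGLB` also
guarantees that the `sInf` defining the ground energy is not a default value. -/
theorem mainTheorem7 (g κ γ : ℝ) (hg : 0 < g) (hg1 : g < 1) (hκ : 0 < κ) (hκ1 : κ < 1)
    (hγ : 0 < γ) (hγ1 : γ < 1) (f : SpinBoson.Momentum → ℝ)
    (hf : MeasureTheory.MemLp f ⊤ MeasureTheory.volume)
    (hf1 : MeasureTheory.eLpNorm f ⊤ MeasureTheory.volume ≤ 1) :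
    (∀ n : ℕ, IsSelfAdjoint (SpinBoson.hamiltonian g κ γ f n) ∧
      IsGLB (Complex.re '' SpinBoson.spectrum (SpinBoson.hamiltonian g κ γ f n))
        (SpinBoson.groundEnergy g κ γ f n)) ∧
    ∀ n : ℕ, |SpinBoson.groundEnergy g κ γ f (n + 1) - SpinBoson.groundEnergy g κ γ f n| ≤
      g * SpinBoson.cutoff κ γ n := by
  obtain ⟨f', hfm, hf', hff'⟩ := SpinBoson.exists_measurable_bounded_representative hf hf1
  have h := SpinBoson.isGreatest_groundEnergy (g := g) hκ hγ hff' hfm hf'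
  refine ⟨fun n => ⟨(h n).1, (h n).2.1⟩, fun n => abs_le.2 ⟨?_, ?_⟩⟩
  -- E_n - g ρ_n is a form bound at stage n + 1, hence at most the greatest one.
  · have h1 := (h (n + 1)).2.2.2 ((h n).2.2.1.succ hg hg1 hκ hγ hγ1 hfm hf')
    linarith
  -- E_{n+1} is a form bound at stage n, which gives the stronger inequality E_{n+1} ≤ E_n.
  · have h1 := (h n).2.2.2 ((h (n + 1)).2.2.1.of_succ hκ hγ hγ1)
    have h2 := mul_pos hg (SpinBoson.cutoff_pos hκ hγ n)
    linarith
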